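/- **Model.** There are $k$ machines, pairwise connected, and a cloud that stores an $n$-bit input $x_1,\dots,x_n$ ($n\ge 2$, $1\le k\le n$) and provides independent fair global random bits. Computation proceeds in synchronous rounds. In each round a machine first sends queries to the cloud (at most $n$ of them), each for an input bit $x_j$ or for the $s$-th global random bit (the same bit for every machine), and receives the answers; then it sends at most one message of $O(\log n)$ bits to each machine. Before the first round an adversary, knowing only the algorithm and the input, which it may choose, fixes a set of at most $\beta k$ Byzantine machines, where $0\le\beta<1$ and $\beta k$ is an integer; their messages are arbitrary and may depend on everything, including all random bits. The algorithm knows $n$, $k$ and $\beta$. Put $\gamma=1-\beta$. $\mathcal Q$ is the maximum number of queries made by an honest machine, $\mathcal M$ the total number of messages sent by honest machines, and $\mathcal T$ the number of rounds until all honest machines have terminated. The problem $\mathsf{Parity}$ requires every honest machine to output $x_1\oplus\dots\oplus x_n$. "With high probability" means with probability $1-O(1/n)$. **Algorithm Converge_Parity.** 1. *Committees.* Consider a forest of $\min(\lceil n/k\rceil,k)$ balanced complete $\lceil n/k+1\rceil$-ary trees with $\lceil k^2/n\rceil$ leaves each; let $\nu$ be the number of its nodes and $\sigma=\lceil 9\log_2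 n/\gamma\rceil$. From the global random bits all machines compute the same $\sigma$ independent hash functions $h_1,\dots,h_\sigma$, each from a $\sigma$-wise independent family (random polynomials of degree less than $\sigma$ over the field with $2^m$ elements, $m=\max(1,\lceil\log_2\nu\rceil,\lceil\log_2 k\rceil)$, values being reduced modulo $k$). The $i$-th node is the committee $\{h_1(i),\dots,h_\sigma(i)\}$. 2. *Convergecast.* The indices $1,\dots,n$ are distributed evenly, in consecutive blocks, among the leaves of the forest; an inner node $v$ is assigned the set $I_v$ of all indices assigned to the leaves below it. The machines in a leaf query the bits assigned to it. Then, level by level, every machine in an inner node learns the bits assigned to each child $C$ of this node as follows: all members of $C$ send it these bits; it treats the bits one after the other, and whenever the members of $C$ that it has not blacklisted disagree about a bit, it queries this bit and blacklists those that sent the wrong value. 3. *Weak_Parity_Resolve.* Every machine $M$, for every root $v$ in parallel, asks the members of $v$ for $\bigoplus_{j\in I_v}x_j$. As long as the members that it has not blacklisted disagree about this value, $M$ performs a binary search: it keeps a range of $I_v$ on whose parity they disagree, asks them for the parity of the first half, deduces their claims about the second half, and continues with the first half if they disagree there and with the second half otherwise; when the range is a single index, $M$ queries that bit and blacklists the members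 whose claim about it is wrong. Finally $M$ outputs the sum modulo $2$ of the values obtained for all roots. Communication done in parallel for several committees is serialized on each link, so that one parallel step takes as many rounds as the maximum number of nodes to which a machine belongs. **Theorem.** There is an absolute constant $C$ such that for all $n,k,\beta$ as above, every input, every choice of the Byzantine machines and every behaviour of these, with probability at least $1-C/n$ Algorithm Converge_Parity solves $\mathsf{Parity}$ with $$\mathcal Q\le C\,\frac{n\log^3 n}{\gamma^3k},\qquad \mathcal M\le C\,\frac{n\log^3 n}{\gamma^2},$$ $$\mathcal T\le C\,\frac{\log^4 n}{\gamma^3}\ \text{ if } k^2\le n,\qquad \mathcal T\le C\Bigl(\frac nk+\frac{k^2}{n}+\frac{\log^2 n}{\gamma}\Bigr)\frac{\log^2 n}{\gamma^2}\ \text{ if } k^2>n,$$ all messages of honest machines having at most $C\log n$ bits. -/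

import Mathlib

namespace CCA

/-! ### The model: a congested clique of `k` machines with a read-only cloud -/

/-- A query to the cloud: `Sum.inl j` is `Cloud_Query(j)` (the `j`-th input bit), `Sum.inr s` is
`Cloud_RG(s)` (the `s`-th global random bit). -/
abbrev Query (n : ℕ) : Type := Fin n ⊕ ℕ

/-- The code of one machine, as a resumable program over messages from `μ` with result in `α`.
A round consists of a query sub-round, in which a set of queries is sent to the cloud, and a
message-passing sub-round, in which at most one message is sent to each machine; the messages may
depend on the answers of the cloud, and the continuation on these answers and on the messages
received (indexed by their sender). -/
inductive Prog (n k : ℕ) (μ α : Type) : Type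
  | halt (a : α) : Prog n k μ α
  | round (queries : Finset (Query n)) (send : (Query n → Bool) → Fin k → Option μ)
      (next : (Query n → Bool) → (Fin k → Option μ) → Prog n k μ α) : Prog n k μ α

namespace Prog

variable {n k : ℕ} {μ α σ : Type}

/-- Sequential composition. -/
def bind {β : Type} : Prog n k μ α → (α → Prog n k μ β) → Prog n k μ β
  | halt a, f => f a
  | round qs send next, f => round qs send fun ans inbox => (next ans inbox).bind f

instance : Monad (Prog n k μ) where
  pure := halt
  bind := bind

/-- `loop N body s` runs `body 0, …, body (N - 1)` one after the other on the state `s`. -/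
def loop (body : ℕ → σ → Prog n k μ σ) : ℕ → σ → Prog n k μ σ
  | 0, s => halt s
  | N + 1, s => (loop body N s).bind (body N)

/-- One round of `Cloud_Query`s. -/
def cloudQuery (S : Finset (Fin n)) : Prog n k μ (Fin n → Bool) :=
  round (S.map .inl) (fun _ _ => none) fun ans _ => halt fun j => ans (.inl j)

/-- One round of `Cloud_RG`s. -/
def cloudRG (S : Finset ℕ) : Prog n k μ (ℕ → Bool) :=
  round (S.map .inr) (fun _ _ => none) fun ans _ => halt fun s => ans (.inr s)

/-- One round of messages, without queries; returns the messages received. -/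
def exchange (out : Fin k → Option μ) : Prog n k μ (Fin k → Option μ) :=
  round ∅ (fun _ => out) fun _ inbox => halt inbox

/-- The queries made in the current round; a halted machine makes none. -/
def queries : Prog n k μ α → Finset (Query n)
  | halt _ => ∅
  | round qs _ _ => qs

/-- The answers seen by a machine that asked `qs`: only queries actually made are answered. -/
def answers (cloud : Query n → Bool) (qs : Finset (Query n)) : Query n → Bool :=
  fun q => if q ∈ qs then cloud q else false

/-- The messages sent in the current round; a halted machine sends none. -/
def outgoing (cloud : Query n → Bool) : Prog n k μ α → Fin k → Option μ
  | halt _ => fun _ => none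
  | round qs send _ => send (answers cloud qs)

/-- The remaining program after the current round. -/
def advance (cloud : Query n → Bool) (inbox : Fin k → Option μ) : Prog n k μ α → Prog n k μ α
  | halt a => halt a
  | round qs _ next => next (answers cloud qs) inbox

/-- The output of a machine that has terminated. -/
def result : Prog n k μ α → Option α
  | halt a => some a
  | round _ _ _ => none

end Prog

/-- The data that determine an execution: the code of every machine, the input in the cloud, the
global random bits, the set of Byzantine machines, and the messages `adversary t i j` that the
Byzantine machine `i` sends to `j` in round `t`. -/
structure Run (n k : ℕ) (μ α : Type) where
  code : Fin k → Prog n k μ α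
  input : Fin n → Bool
  coins : ℕ → Bool
  byzantine : Finset (Fin k)
  adversary : ℕ → Fin k → Fin k → Option μ

namespace Run

variable {n k : ℕ} {μ α : Type} (r : Run n k μ α)

def cloud : Query n → Bool := Sum.elim r.input r.coins

/-- The message sent by machine `i` to machine `j` in round `t` if `conf` describes the programs
that remain to be executed at the beginning of that round. -/
def message (conf : Fin k → Prog n k μ α) (t : ℕ) (i j : Fin k) : Option μ :=
  if i ∈ r.byzantine then r.adversary t i j else (conf i).outgoing r.cloud j

/-- What remains to be executed by each machine after `t` rounds (meaningless for Byzantine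
machines, whose messages are those of the adversary). -/
def config : ℕ → Fin k → Prog n k μ α
  | 0 => r.code
  | t + 1 => fun j => (config t j).advance r.cloud fun i => r.message (config t) t i j

/-- After `T` rounds all honest machines have terminated, with output `y`. -/
def HonestOutput (T : ℕ) (y : α) : Prop :=
  ∀ i ∉ r.byzantine, (r.config T i).result = some y

/-- Number of queries made by machine `i` in round `t`. -/
def queriesInRound (t : ℕ) (i : Fin k) : ℕ := (r.config t i).queries.card

/-- Number of queries made by machine `i` in the first `T` rounds. -/
def queryCount (T : ℕ) (i : Fin k) : ℕ := ∑ t ∈ Finset.range T, r.queriesInRound t i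

/-- Number of messages sent by honest machines in the first `T` rounds. Messages of a machine to
itself, which stand for local computation, are counted as well. -/
def messageCount (T : ℕ) : ℕ :=
  ∑ t ∈ Finset.range T, ∑ i ∈ r.byzantineᶜ,
    (Finset.univ.filter fun j => ((r.config t i).outgoing r.cloud j).isSome).card

end Run

/-- The law of the global random bits: independent fair coins. -/
noncomputable def coinMeasure : MeasureTheory.Measure (ℕ → Bool) :=
  MeasureTheory.Measure.infinitePi fun _ => (PMF.uniformOfFintype Bool).toMeasure

/-- The parity of the input: `true` iff the number of ones is odd. -/
def parity {n : ℕ} (x : Fin n → Bool) : Bool :=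
  decide (Odd (Finset.univ.filter fun j => x j = true).card)

/-! ### The convergecast forest

Trees are balanced: a node that is responsible for at least two leaves splits them as evenly as
possible into `arity` consecutive groups, one for each child, empty groups being dropped. -/

section Forest

variable (n k : ℕ)

def arity : ℕ := n ⌈/⌉ k + 1

/-- Number of leaves of a convergecast tree. -/
def leafCount : ℕ := k ^ 2 ⌈/⌉ n

/-- Number of convergecast trees. -/
def treeCount : ℕ := min (n ⌈/⌉ k) k

/-- The depth of a convergecast tree (the root has depth `0`). -/
def depth : ℕ := Nat.clog (arity n k) (leafCount n k)

/-- A node is given by its tree, its depth in that tree and its position among the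
`arity ^ depth` positions of this depth. -/
abbrev Node : Type := ℕ × ℕ × ℕ

/-- The leaves below position `q` at depth `t` of a tree, numbered within the tree, are those in
`[firstLeaf t q, firstLeaf t (q + 1))`. -/
def firstLeaf (t q : ℕ) : ℕ := q * leafCount n k / arity n k ^ t

/-- Number of leaves below position `q` at depth `t`. -/
def leavesBelow (t q : ℕ) : ℕ := firstLeaf n k t (q + 1) - firstLeaf n k t q

/-- The nodes of the forest, in a fixed order. A position other than the root is a node if its
parent is not a leaf and it has at least one leaf below it. -/
def forest : List Node :=
  (List.range (treeCount n k) ×ˢ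
    (List.range (depth n k + 1) ×ˢ List.range (arity n k ^ depth n k))).filter fun v =>
      v.2.2 < arity n k ^ v.2.1 ∧
        (v.2.1 = 0 ∨ (2 ≤ leavesBelow n k (v.2.1 - 1) (v.2.2 / arity n k) ∧
          1 ≤ leavesBelow n k v.2.1 v.2.2))

def parent (v : Node) : Node := (v.1, v.2.1 - 1, v.2.2 / arity n k)

def roots : List Node := (forest n k).filter fun v => v.2.1 = 0

def leaves : List Node := (forest n k).filter fun v => leavesBelow n k v.2.1 v.2.2 = 1

/-- The level of a node, i.e. the number of levels of its subtree; leaves have level `1`. (A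
balanced tree with `s` leaves has `clog s + 1` levels, the logarithm being to base `arity`.) -/
def level (v : Node) : ℕ := Nat.clog (arity n k) (leavesBelow n k v.2.1 v.2.2) + 1

/-- The non-root nodes whose parent is at level `i`. -/
def childrenOfLevel (i : ℕ) : List Node :=
  (forest n k).filter fun c => c.2.1 ≠ 0 ∧ level n k (parent n k c) = i

/-- The leaf, numbered through the whole forest, to which the index `j` is assigned: the indices
are distributed evenly in consecutive blocks. -/
def leafOfIndex (j : Fin n) : ℕ := j * (treeCount n k * leafCount n k) / n

/-- The increasing list of the indices assigned to a node: those assigned to the leaves below. -/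
def assigned (v : Node) : List (Fin n) :=
  (List.finRange n).filter fun j =>
    v.1 * leafCount n k + firstLeaf n k v.2.1 v.2.2 ≤ leafOfIndex n k j ∧
      leafOfIndex n k j < v.1 * leafCount n k + firstLeaf n k v.2.1 (v.2.2 + 1)

/-- The largest number of indices assigned to a node whose parent is at level `i`. -/
def maxAssigned (i : ℕ) : ℕ :=
  ((childrenOfLevel n k i).map fun c => (assigned n k c).length).foldr max 0

end Forest

/-! ### Public committees -/

section Committees

/-- The committee size `⌈9 log n / γ⌉`, where `γ = 1 - β` and `β = b / k`. -/
noncomputable def committeeSize (n k b : ℕ) : ℕ :=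
  ⌈9 * Real.logb 2 n / (1 - (b : ℝ) / k)⌉₊

/-- Hash values and node numbers are words of this length. -/
def wordLength (n k : ℕ) : ℕ := max 1 (max (Nat.clog 2 (forest n k).length) (Nat.clog 2 k))

/-- Words of length `m` as elements of the field with `2 ^ m` elements. -/
noncomputable def wordToField (m : ℕ) (w : ℕ → Bool) : GaloisField 2 m :=
  ∑ i : Fin (Module.finrank (ZMod 2) (GaloisField 2 m)),
    if w i then Module.finBasis (ZMod 2) (GaloisField 2 m) i else 0

/-- The number whose binary digits are the coordinates of a field element. -/
noncomputable def fieldToNat (m : ℕ) (y : GaloisField 2 m) : ℕ :=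
  ∑ i : Fin (Module.finrank (ZMod 2) (GaloisField 2 m)),
    if (Module.finBasis (ZMod 2) (GaloisField 2 m)).repr y i = 1 then 2 ^ (i : ℕ) else 0

/-- The `s`-wise independent hash function with values in words of length `m` whose description
is the word `w` of length `s * m`: the polynomial over the field with `2 ^ m` elements that has
the `s` blocks of `w` as coefficients, evaluated at (the field element that encodes) `i`. -/
noncomputable def hash (s m : ℕ) (w : ℕ → Bool) (i : ℕ) : ℕ :=
  fieldToNat m (∑ c ∈ Finset.range s,
    wordToField m (fun e => w (c * m + e)) * wordToField m i.testBit ^ c)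

/-- The committee of each node: the values at the node's number of `σ` hash functions described by
consecutive blocks of `rand`, with `σ` the committee size. A hash value denotes a machine by
reduction modulo `k`. -/
noncomputable def committee (n k b : ℕ) (rand : ℕ → Bool) (v : Node) : Finset (Fin k) :=
  Finset.univ.filter fun M => ∃ u < committeeSize n k b,
    hash (committeeSize n k b) (wordLength n k)
      (fun e => rand (u * (committeeSize n k b * wordLength n k) + e))
      ((forest n k).idxOf v) % k = M

/-- The number of random bits that describe all hash functions. -/
noncomputable def seedLength (n k b : ℕ) : ℕ :=
  committeeSize n k b * committeeSize n k b * wordLength n k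

/-- Procedure `Elect_Public` for the nodes of the forest: read the random bits, at most `n` per
round, and compute all committees. -/
noncomputable def electPublic {μ : Type} (n k b : ℕ) : Prog n k μ (Node → Finset (Fin k)) := do
  let rand ← Prog.loop (fun t (rand : ℕ → Bool) => do
      let batch := (Finset.range (seedLength n k b)).filter fun s => n * t ≤ s ∧ s < n * (t + 1)
      let ans ← Prog.cloudRG batch
      pure fun s => if s ∈ batch then ans s else rand s)
    (seedLength n k b ⌈/⌉ n) (fun _ => false)
  pure (committee n k b rand)

end Committees

/-! ### Communication on behalf of committees

`F` is the public assignment of committees to nodes. A machine may belong to many nodes and can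
use each link only once per round, so one step of communication that is performed for all nodes in
parallel takes `load F` rounds: in the `s`-th of them every link is used on behalf of the `s`-th
node of one of its ends. -/

section Communication

variable {n k : ℕ}

/-- A message is a bit, or a pair of positions that asks for the parity of a range. -/
abbrev Msg (n : ℕ) : Type := Bool ⊕ (Fin (n + 1) × Fin (n + 1))

/-- The bit carried by a message; a missing or ill-formed message counts as `0`. -/
def Msg.bit {n : ℕ} : Option (Msg n) → Bool
  | some (.inl a) => a
  | _ => false

/-- The nodes to which machine `M` belongs. -/
def memberships (n : ℕ) (F : Node → Finset (Fin k)) (M : Fin k) : List Node :=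
  (forest n k).filter fun v => M ∈ F v

/-- The largest number of nodes to which a machine belongs. -/
def load (n : ℕ) (F : Node → Finset (Fin k)) : ℕ :=
  Finset.univ.sup fun M => (memberships n F M).length

/-- `out v j` is the message that `me`, as a member of `v`, sends to `j`. The result at `(v, i)` is
the message that `me` received from `i` as a member of `v`. -/
def sendAsMember (F : Node → Finset (Fin k)) (me : Fin k)
    (out : Node → Fin k → Option (Msg n)) : Prog n k (Msg n) (Node → Fin k → Option (Msg n)) :=
  Prog.loop (fun s (got : Node → Fin k → Option (Msg n)) => do
      let inbox ← Prog.exchange fun j => (memberships n F me)[s]?.bind fun v => out v j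
      pure fun v i => if (memberships n F i)[s]? = some v then inbox i else got v i)
    (load n F) (fun _ _ => none)

/-- `out v j` is the message that `me` sends to `j` in its role as a member of `v`. The result at
`(v, i)` is the message that `me`, as a member of `v`, received from `i`. -/
def sendToMembers (F : Node → Finset (Fin k)) (me : Fin k)
    (out : Node → Fin k → Option (Msg n)) : Prog n k (Msg n) (Node → Fin k → Option (Msg n)) :=
  Prog.loop (fun s (got : Node → Fin k → Option (Msg n)) => do
      let inbox ← Prog.exchange fun j => (memberships n F j)[s]?.bind fun v => out v j
      pure fun v i => if (memberships n F me)[s]? = some v then inbox i else got v i)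
    (load n F) (fun _ _ => none)

/-- Two machines of `S` claim different bits. -/
abbrev Disputed (S : Finset (Fin k)) (claim : Fin k → Bool) : Prop :=
  ∃ i ∈ S, ∃ j ∈ S, claim i ≠ claim j

/-- The bit claimed by the machines of `S`, if it is undisputed. -/
def agreed (S : Finset (Fin k)) (claim : Fin k → Bool) : Bool := decide (∃ i ∈ S, claim i = true)

end Communication

/-! ### Convergecasting -/

section Convergecast

variable {n k : ℕ}

/-- The local state of a machine that runs `Weak_Resolve`: the bits it knows, and the machines it
has blacklisted in the invocation on each committee. -/
structure ResolveState (n k : ℕ) where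
  res : Fin n → Bool
  black : Node → Finset (Fin k)

/-- One step of `Weak_Resolve`, performed in parallel for all children of the nodes at level `i`
to which `me` belongs: settle the `p`-th index assigned to each child. `heard c M p` is the bit that
`M` sent for the `p`-th index of the child `c`. -/
def weakResolveStep (F : Node → Finset (Fin k)) (me : Fin k) (i : ℕ)
    (heard : Node → Fin k → ℕ → Bool) (p : ℕ) (s : ResolveState n k) :
    Prog n k (Msg n) (ResolveState n k) := do
  let mine := (childrenOfLevel n k i).filter fun c => me ∈ F (parent n k c)
  let claim := fun (c : Node) (M : Fin k) => heard c M p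
  let ans ← Prog.cloudQuery (Finset.univ.filter fun j => ∃ c ∈ mine,
    (assigned n k c)[p]? = some j ∧ Disputed (F c \ s.black c) (claim c))
  pure
    { res := mine.foldl (fun res c =>
        match (assigned n k c)[p]? with
        | none => res
        | some j => Function.update res j
            (if Disputed (F c \ s.black c) (claim c) then ans j
              else agreed (F c \ s.black c) (claim c))) s.res
      black := fun c =>
        match (assigned n k c)[p]? with
        | none => s.black c
        | some j =>
            if c ∈ mine ∧ Disputed (F c \ s.black c) (claim c) then
              s.black c ∪ (F c).filter fun M => claim c M ≠ ans j
            else s.black c }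

/-- Every machine in every node at level `i` learns the bits assigned to the children of this node
by `Weak_Resolve`: first all bits are sent, then they are settled one by one. -/
def convergeLevel (F : Node → Finset (Fin k)) (me : Fin k) (i : ℕ) (res : Fin n → Bool) :
    Prog n k (Msg n) (Fin n → Bool) := do
  let heard ← Prog.loop (fun p (heard : Node → Fin k → ℕ → Bool) => do
      let got ← sendAsMember F me fun c j =>
        if c ∈ childrenOfLevel n k i ∧ j ∈ F (parent n k c) then
          (assigned n k c)[p]?.map fun idx => Sum.inl (res idx)
        else none
      pure fun c M p' => if p' = p then Msg.bit (got c M) else heard c M p')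
    (maxAssigned n k i) (fun _ _ _ => false)
  let s ← Prog.loop (weakResolveStep F me i heard) (maxAssigned n k i) ⟨res, fun _ => ∅⟩
  pure s.res

/-- Procedure `Convergecast` for given committees: the leaves query the bits assigned to them, then
the levels `2, 3, …` are processed one after the other. Returns the bits known to `me`. -/
def convergecast (F : Node → Finset (Fin k)) (me : Fin k) :
    Prog n k (Msg n) (Fin n → Bool) := do
  let res ← Prog.cloudQuery (Finset.univ.filter fun j =>
    ∃ v ∈ leaves n k, me ∈ F v ∧ j ∈ assigned n k v)
  Prog.loop (fun i res => convergeLevel F me (i + 2) res) (depth n k) res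

end Convergecast

/-! ### Weak parity resolution -/

section Parity

variable {n k : ℕ}

/-- The parity of the bits at the positions `l, …, r - 1` (counted from `0`) of a list of
indices. -/
def xorRange (res : Fin n → Bool) (K : List (Fin n)) (l r : ℕ) : Bool :=
  ((K.take r).drop l).foldr (fun j acc => xor (res j) acc) false

/-- For all roots `v` in parallel, ask the machines of `v` that are not blacklisted for the parity
of the range `want v` of the indices assigned to `v` (if any), and answer the questions of others
on the basis of the known bits `res`. The result at `(v, M)` is the answer of `M`. -/
def askXor (F : Node → Finset (Fin k)) (me : Fin k) (res : Fin n → Bool)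
    (black : Node → Finset (Fin k)) (want : Node → Option (ℕ × ℕ)) :
    Prog n k (Msg n) (Node → Fin k → Bool) := do
  let asked ← sendToMembers F me fun v j =>
    if v ∈ roots n k ∧ j ∈ F v \ black v then
      (want v).map fun lr => Sum.inr (Fin.ofNat (n + 1) lr.1, Fin.ofNat (n + 1) lr.2)
    else none
  let replies ← sendAsMember F me fun v j =>
    if v ∈ roots n k then
      match asked v j with
      | some (.inr (l, r)) => some (.inl (xorRange res (assigned n k v) l r))
      | _ => none
    else none
  pure fun v M => Msg.bit (replies v M)

/-- The state of the binary searches, one for each root: the search is for a false claim in the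
range `lo, …, hi - 1`, and `claim v M` is what `M` claims about the parity of this range. -/
structure SearchState (k : ℕ) where
  lo : Node → ℕ
  hi : Node → ℕ
  claim : Node → Fin k → Bool

/-- One step of the binary searches for those roots that are `active` and whose range has more than
one element. -/
def searchStep (F : Node → Finset (Fin k)) (me : Fin k) (res : Fin n → Bool)
    (black : Node → Finset (Fin k)) (active : Node → Bool) (s : SearchState k) :
    Prog n k (Msg n) (SearchState k) := do
  let mid := fun v => (s.lo v + s.hi v + 1) / 2
  let going := fun v => active v && decide (s.lo v + 1 < s.hi v)
  let ans ← askXor F me res black fun v => if going v then some (s.lo v, mid v) else none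
  pure
    { lo := fun v =>
        if going v ∧ ¬ Disputed (F v \ black v) (ans v) then mid v else s.lo v
      hi := fun v =>
        if going v ∧ Disputed (F v \ black v) (ans v) then mid v else s.hi v
      claim := fun v M =>
        if going v then
          if Disputed (F v \ black v) (ans v) then ans v M else xor (s.claim v M) (ans v M)
        else s.claim v M }

/-- One iteration of the outer loop of `Weak_Parity_Resolve`, for all roots in parallel: where the
machines that are not blacklisted disagree about the parity `top` of all assigned bits, isolate one
index by binary search, query it, and blacklist the machines caught in a lie. -/
def blacklistStep (F : Node → Finset (Fin k)) (me : Fin k) (res : Fin n → Bool)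
    (top : Node → Fin k → Bool) (black : Node → Finset (Fin k)) :
    Prog n k (Msg n) (Node → Finset (Fin k)) := do
  let active := fun v => decide (Disputed (F v \ black v) (top v))
  let s ← Prog.loop (fun _ s => searchStep F me res black active s) (Nat.clog 2 n)
    ⟨fun _ => 0, fun v => (assigned n k v).length, top⟩
  let ans ← Prog.cloudQuery (Finset.univ.filter fun j =>
    ∃ v ∈ roots n k, active v = true ∧ (assigned n k v)[s.lo v]? = some j)
  pure fun v =>
    match (assigned n k v)[s.lo v]? with
    | none => black v
    | some j =>
        if v ∈ roots n k ∧ active v = true then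
          black v ∪ (F v).filter fun M => s.claim v M ≠ ans j
        else black v

/-- `Weak_Parity_Resolve` on all roots in parallel, given an upper bound `size` for the size of the
committees; returns the parity of the parities obtained. An iteration in which there is no
disagreement about a root is idle for this root, so that `size` iterations amount to the loop that
runs as long as there is disagreement. -/
def weakParityResolve (F : Node → Finset (Fin k)) (size : ℕ) (me : Fin k) (res : Fin n → Bool) :
    Prog n k (Msg n) Bool := do
  let top ← askXor F me res (fun _ => ∅) fun v => some (0, (assigned n k v).length)
  let black ← Prog.loop (fun _ black => blacklistStep F me res top black) size (fun _ => ∅)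
  pure (decide (Odd ((roots n k).filter fun v => agreed (F v \ black v) (top v)).length))

/-- Algorithm `Converge_Parity` for `n` bits and `k` machines of which at most `b` are Byzantine:
the code of machine `me`. -/
noncomputable def convergeParity (n k b : ℕ) (me : Fin k) : Prog n k (Msg n) Bool := do
  let F ← electPublic n k b
  let res ← convergecast F me
  weakParityResolve F (committeeSize n k b) me res

end Parity

/-- The execution of `Converge_Parity` on the input `x` with Byzantine machines `B` when the global
random bits are `ω`. The input and the set `B` are fixed in advance. The messages of the Byzantine
machines may depend on all random bits; as the algorithm is deterministic once the random bits and
the messages of the Byzantine machines are given, this includes every adaptive choice of these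
messages. -/
noncomputable def convergeParityRun (n k b : ℕ) (x : Fin n → Bool) (B : Finset (Fin k))
    (adv : (ℕ → Bool) → ℕ → Fin k → Fin k → Option (Msg n)) (ω : ℕ → Bool) :
    Run n k (Msg n) Bool where
  code := convergeParity n k b
  input := x
  coins := ω
  byzantine := B
  adversary := adv ω

end CCA

/-! Once the public committees are fixed, correctness is deterministic as soon as every committee
has an honest member. The cost is governed by the committee size σ and by the load, the largest
number of committees to which a machine belongs. The proof therefore separates a deterministic
analysis from an estimate of the probability that a committee lies inside `B` or that a machine is
overloaded.

Deterministic part. The lengths of all loops depend only on public data, so the machines run in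
lockstep. `Spec` is a Hoare logic for such executions that tracks results, queries and messages
together. Trust rests on one argument: an honest member that knows the bits in question is never
blacklisted, every dispute that is settled exposes a new liar, and an undisputed claim agrees with
that of an honest member and is true. So a machine pays at most σ queries for each child committee.
For the convergecast this is an induction on levels (`spec_settle`, `spec_convergecast`). For the
parity of a root, binary search keeps a range on which the members disagree (`DisputedRange`): if
they agree on the left half, they disagree on the right half, and about log n halvings isolate one
bit (`spec_blacklistStep`). A dispute that survived σ such searches would have blacklisted the whole
committee, its honest member included (`spec_weakParityResolve`). The roots partition the input, so
their parities add up to the answer (`parity_eq_roots`).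

Counting. The forest has at most 12k nodes (`length_forest_le`), a leaf holds at most ⌈n/k⌉ indices,
and the arity is ⌈n/k⌉ + 1. A geometric sum over the levels then bounds the steps of the
convergecast by a multiple of n/k + k²/n (`sum_maxAssigned_le`), each step costing at most load + 1
rounds.

Probability. By interpolation, values of the random polynomials at up to σ points are independent
(`card_forall_eval_mem`). A given committee lies inside `B` with probability at most (1 - γ/2)^σ ≤
n⁻². The σ-th factorial moment of the number of hits shows that a given machine has load at least
49σ with probability at most 2^(-σ) ≤ n⁻² (`two_pow_mul_card_many_hits_le`). A union bound gives
13/n (`coinMeasure_bad_le`). -/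

namespace CCA

/-! ### Lockstep executions -/

/-- What the machines cannot influence: the cloud, the set of Byzantine machines and their
messages. -/
structure Env (n k : ℕ) (μ : Type) where
  cloud : Query n → Bool
  byz : Finset (Fin k)
  adv : ℕ → Fin k → Fin k → Option μ

namespace Env

variable {n k : ℕ} {μ : Type} (E : Env n k μ)

/-- What `j` receives from `i` in round `t` if `send i j` is the message that `i` ought to send. -/
def inbox (t : ℕ) (send : Fin k → Fin k → Option μ) (j i : Fin k) : Option μ :=
  if i ∈ E.byz then E.adv t i j else send i j

/-- The number of messages sent by honest machines in one round. -/
def sent (send : Fin k → Fin k → Option μ) : ℕ :=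
  ∑ i ∈ E.byzᶜ, (Finset.univ.filter fun j => (send i j).isSome).card

lemma inbox_of_notMem {t : ℕ} {send : Fin k → Fin k → Option μ} {i j : Fin k} (h : i ∉ E.byz) :
    E.inbox t send j i = send i j := if_neg h

lemma sent_none : E.sent (fun _ _ => none) = 0 := by simp [sent]

end Env

/-- `Reaches E t P T a q m`: if the machines start the programs `P` in round `t`, then all of them
halt after exactly `T` rounds, with results `a`, each machine `i` having made `q i` queries, at most
`n` in each round, and the honest ones having sent `m` messages. -/
inductive Reaches {n k : ℕ} {μ α : Type} (E : Env n k μ) :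
    ℕ → (Fin k → Prog n k μ α) → ℕ → (Fin k → α) → (Fin k → ℕ) → ℕ → Prop
  | halt (t : ℕ) (a : Fin k → α) : Reaches E t (fun i => .halt (a i)) 0 a (fun _ => 0) 0
  | round {t : ℕ} {qs : Fin k → Finset (Query n)}
      {send : Fin k → (Query n → Bool) → Fin k → Option μ}
      {next : Fin k → (Query n → Bool) → (Fin k → Option μ) → Prog n k μ α}
      {T : ℕ} {a : Fin k → α} {q : Fin k → ℕ} {m : ℕ} (hq : ∀ i, (qs i).card ≤ n)
      (h : Reaches E (t + 1) (fun j => next j (Prog.answers E.cloud (qs j))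
        (E.inbox t (fun i => send i (Prog.answers E.cloud (qs i))) j)) T a q m) :
      Reaches E t (fun i => .round (qs i) (send i) (next i)) (T + 1) a
        (fun i => (qs i).card + q i)
        (E.sent (fun i => send i (Prog.answers E.cloud (qs i))) + m)

section Reaches

variable {n k : ℕ} {μ α β σ : Type} {E : Env n k μ}

/-- All machines halt in the same round, so the continuations start together in round `t + T`, and
the second execution can be appended to the first. -/
lemma Reaches.bind {t : ℕ} {P : Fin k → Prog n k μ α} {T : ℕ} {a : Fin k → α} {q : Fin k → ℕ}
    {m : ℕ} (h : Reaches E t P T a q m) {f : Fin k → α → Prog n k μ β} {T' : ℕ} {b : Fin k → β}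
    {q' : Fin k → ℕ} {m' : ℕ} (h' : Reaches E (t + T) (fun i => f i (a i)) T' b q' m') :
    Reaches E t (fun i => (P i).bind (f i)) (T + T') b (fun i => q i + q' i) (m + m') := by
  induction h with
  | halt t a => simpa [Prog.bind] using h'
  | @round t qs send next T a q m hq h ih =>
    have h₁ := ih (by rwa [add_assoc, add_comm 1])
    have h₂ := Reaches.round hq (send := send)
      (next := fun i ans inbox => (next i ans inbox).bind (f i)) h₁
    rw [add_right_comm]
    simpa only [add_assoc, Prog.bind] using h₂

/-- The data of a run that are not code. -/
def Run.env (r : Run n k μ α) : Env n k μ := ⟨r.cloud, r.byzantine, r.adversary⟩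

/-- This transfers the abstract execution to the actual run. The first conclusion, for all later
rounds, is what shows that nothing is queried after termination. -/
lemma Run.config_of_reaches (r : Run n k μ α) {t : ℕ} {P : Fin k → Prog n k μ α} {T : ℕ}
    {a : Fin k → α} {q : Fin k → ℕ} {m : ℕ} (h : Reaches r.env t P T a q m)
    (hP : r.config t = P) :
    (∀ s, r.config (t + T + s) = fun i => .halt (a i)) ∧
    (∀ i, ∑ s ∈ Finset.range T, r.queriesInRound (t + s) i = q i) ∧
    (∀ s < T, ∀ i, r.queriesInRound (t + s) i ≤ n) ∧
    ∑ s ∈ Finset.range T, ∑ i ∈ r.byzantineᶜ,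
      (Finset.univ.filter fun j => ((r.config (t + s) i).outgoing r.cloud j).isSome).card = m := by
  induction h with
  | halt t a =>
    refine ⟨fun s => ?_, by simp, by simp, by simp⟩
    induction s with
    | zero => exact hP
    | succ s ih =>
      rw [add_zero] at ih ⊢
      rw [← add_assoc, Run.config, ih]
      rfl
  | @round t qs send next T a q m hq h ih =>
    have h₁ : r.config (t + 1) = fun j => next j (Prog.answers r.cloud (qs j))
        (r.env.inbox t (fun i => send i (Prog.answers r.cloud (qs i))) j) := by
      funext j
      rw [Run.config, hP]
      rfl
    obtain ⟨i₁, i₂, i₃, i₄⟩ := ih h₁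
    refine ⟨fun s => ?_, fun i => ?_, fun s hs i => ?_, ?_⟩
    · rw [← i₁ s]; congr 1; omega
    · rw [Finset.sum_range_succ', add_comm]
      change _ = (qs i).card + q i
      rw [← i₂ i]
      congr 1
      · simp [Run.queriesInRound, hP, Prog.queries]
      · exact Finset.sum_congr rfl fun s _ => by rw [add_assoc, add_comm 1]
    · rcases s with _ | s
      · simpa [Run.queriesInRound, hP, Prog.queries] using hq i
      · rw [add_comm s, ← add_assoc]
        exact i₃ s (by omega) i
    · rw [Finset.sum_range_succ', add_comm, ← i₄]
      congr 1
      · simp only [add_zero, hP]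
        rfl
      · exact Finset.sum_congr rfl fun s _ => by rw [add_assoc t, add_comm 1]

/-- Started in any round, the programs `P` halt simultaneously after `T` rounds, and the results,
the numbers of queries and the number of messages satisfy `post`. -/
def Spec (E : Env n k μ) (P : Fin k → Prog n k μ α) (T : ℕ)
    (post : (Fin k → α) → (Fin k → ℕ) → ℕ → Prop) : Prop :=
  ∀ t, ∃ a q m, Reaches E t P T a q m ∧ post a q m

lemma Spec.mono {P : Fin k → Prog n k μ α} {T : ℕ}
    {post post' : (Fin k → α) → (Fin k → ℕ) → ℕ → Prop} (h : Spec E P T post)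
    (h' : ∀ a q m, post a q m → post' a q m) : Spec E P T post' := fun t =>
  let ⟨a, q, m, r, p⟩ := h t
  ⟨a, q, m, r, h' a q m p⟩

lemma Spec.pure {a : Fin k → α} {post : (Fin k → α) → (Fin k → ℕ) → ℕ → Prop}
    (h : post a (fun _ => 0) 0) :
    Spec E (fun i => (Pure.pure (a i) : Prog n k μ α)) 0 post :=
  fun t => ⟨a, _, _, .halt t a, h⟩

lemma Spec.bind {P : Fin k → Prog n k μ α} {f : Fin k → α → Prog n k μ β} {T T' : ℕ}
    {post : (Fin k → α) → (Fin k → ℕ) → ℕ → Prop}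
    {post' : (Fin k → β) → (Fin k → ℕ) → ℕ → Prop} (h : Spec E P T post)
    (h' : ∀ a q m, post a q m → Spec E (fun i => f i (a i)) T'
      fun b q' m' => post' b (fun i => q i + q' i) (m + m')) :
    Spec E (fun i => P i >>= f i) (T + T') post' := fun t => by
  obtain ⟨a, q, m, r, p⟩ := h t
  obtain ⟨b, q', m', r', p'⟩ := h' a q m p (t + T)
  exact ⟨b, _, _, r.bind r', p'⟩

lemma Spec.bind_pure {P : Fin k → Prog n k μ α} {f : Fin k → α → β} {T : ℕ}
    {post : (Fin k → β) → (Fin k → ℕ) → ℕ → Prop}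
    (h : Spec E P T fun a q m => post (fun i => f i (a i)) q m) :
    Spec E (fun i => P i >>= fun a => Pure.pure (f i a)) T post :=
  Spec.bind (T' := 0) (f := fun i a => Pure.pure (f i a)) h fun _ _ _ p => Spec.pure p

/-- The invariant speaks of the accumulated queries and messages as well. The duration `τ p` of an
iteration must not depend on the state, for otherwise lockstep would be lost. -/
lemma Spec.loop {body : Fin k → ℕ → σ → Prog n k μ σ} {s : Fin k → σ} {τ : ℕ → ℕ} (N : ℕ)
    (Inv : ℕ → (Fin k → σ) → (Fin k → ℕ) → ℕ → Prop) (h₀ : Inv 0 s (fun _ => 0) 0)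
    (step : ∀ p < N, ∀ s q m, Inv p s q m → Spec E (fun i => body i p (s i)) (τ p)
      fun s' q' m' => Inv (p + 1) s' (fun i => q i + q' i) (m + m')) :
    Spec E (fun i => Prog.loop (body i) N (s i)) (∑ p ∈ Finset.range N, τ p) (Inv N) := by
  induction N with
  | zero => exact Spec.pure h₀
  | succ N ih =>
    rw [Finset.sum_range_succ]
    exact Spec.bind (ih fun p hp => step p (by omega)) fun a q m h => step N (by omega) a q m h

lemma Spec.loop_const {body : Fin k → ℕ → σ → Prog n k μ σ} {s : Fin k → σ} (N τ : ℕ) {T : ℕ}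
    (hT : T = N * τ) (Inv : ℕ → (Fin k → σ) → (Fin k → ℕ) → ℕ → Prop) (h₀ : Inv 0 s (fun _ => 0) 0)
    (step : ∀ p < N, ∀ s q m, Inv p s q m → Spec E (fun i => body i p (s i)) τ
      fun s' q' m' => Inv (p + 1) s' (fun i => q i + q' i) (m + m')) :
    Spec E (fun i => Prog.loop (body i) N (s i)) T (Inv N) := by
  subst hT
  simpa using Spec.loop (τ := fun _ => τ) N Inv h₀ step

lemma spec_cloudQuery (S : Fin k → Finset (Fin n)) :
    Spec E (fun i => Prog.cloudQuery (S i)) 1 fun a q m =>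
      (∀ i, ∀ j ∈ S i, a i j = E.cloud (.inl j)) ∧ (∀ i, q i = (S i).card) ∧ m = 0 := by
  intro t
  refine ⟨_, _, _, .round (fun i => ?_) (.halt _ _), ?_, ?_, ?_⟩
  · rw [Finset.card_map]; simpa using Finset.card_le_univ (S i)
  · intro i j hj; simp [Prog.answers, hj]
  · simp
  · exact E.sent_none

lemma spec_cloudRG (S : Fin k → Finset ℕ) (hS : ∀ i, (S i).card ≤ n) :
    Spec E (fun i => Prog.cloudRG (S i)) 1 fun a q m =>
      (∀ i, ∀ s ∈ S i, a i s = E.cloud (.inr s)) ∧ (∀ i, q i = (S i).card) ∧ m = 0 := by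
  intro t
  refine ⟨_, _, _, .round (fun i => ?_) (.halt _ _), ?_, ?_, ?_⟩
  · rw [Finset.card_map]; exact hS i
  · intro i j hj; simp [Prog.answers, hj]
  · simp
  · exact E.sent_none

lemma spec_exchange (out : Fin k → Fin k → Option μ) :
    Spec E (fun i => Prog.exchange (out i)) 1 fun a q m =>
      (∀ j, ∀ i ∉ E.byz, a j i = out i j) ∧ (∀ i, q i = 0) ∧ m = E.sent out := by
  intro t
  refine ⟨_, _, _, .round (fun i => ?_) (.halt _ _), ?_, ?_, ?_⟩
  · simp
  · intro j i hi; exact E.inbox_of_notMem hi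
  · simp
  · rfl

end Reaches

/-! ### Serialized communication -/

/-- Slots beyond the end of a list are idle and contribute `g none = 0`; this turns a count by slots
into a count by nodes. -/
lemma sum_range_getElem? {α : Type*} (g : Option α → ℕ) (hg : g none = 0) (l : List α) (N : ℕ)
    (h : l.length ≤ N) :
    ∑ s ∈ Finset.range N, g l[s]? = (l.map fun a => g (some a)).sum := by
  induction l generalizing N with
  | nil => simp [hg]
  | cons a l ih =>
    obtain ⟨N, rfl⟩ : ∃ N', N = N' + 1 := ⟨N - 1, by simp at h; omega⟩
    rw [Finset.sum_range_succ']
    simp only [List.getElem?_cons_succ, List.getElem?_cons_zero, List.map_cons, List.sum_cons]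
    rw [ih N (by simpa using h), add_comm]

section Communication

variable {n k : ℕ} {E : Env n k (Msg n)} {F : Node → Finset (Fin k)}

lemma mem_memberships {M : Fin k} {v : Node} :
    v ∈ memberships n F M ↔ v ∈ forest n k ∧ M ∈ F v := by
  simp [memberships]

lemma length_memberships_le (M : Fin k) : (memberships n F M).length ≤ load n F :=
  Finset.le_sup (f := fun M => (memberships n F M).length) (Finset.mem_univ M)

/-- Double counting of the pairs of a machine and a node to which it belongs. -/
lemma sum_memberships (g : Node → ℕ) :
    ∑ M, ((memberships n F M).map g).sum =
      ((forest n k).map fun v => (F v).card * g v).sum := by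
  unfold memberships
  induction forest n k with
  | nil => simp
  | cons v l ih =>
    simp only [List.map_cons, List.sum_cons, ← ih, List.filter_cons, decide_eq_true_eq]
    have : ∀ M, ((if M ∈ F v then v :: l.filter fun v => M ∈ F v else
        l.filter fun v => M ∈ F v).map g).sum =
        (if M ∈ F v then g v else 0) + ((l.filter fun v => M ∈ F v).map g).sum := by
      intro M; split_ifs <;> simp
    simp only [this, Finset.sum_add_distrib]
    simp

lemma mem_take_succ {α : Type*} {l : List α} {s : ℕ} {a : α} (h : a ∈ l.take (s + 1)) :
    a ∈ l.take s ∨ l[s]? = some a := by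
  rw [List.take_add_one, List.mem_append] at h
  simpa [Option.mem_toList, Option.mem_def] using h

/-- In slot `s` a sender serves the `s`-th node of its own list, and the receiver, knowing `F`, can
tell which node that is. After `load` slots every list is exhausted. Nothing is claimed about
Byzantine senders. -/
lemma spec_sendAsMember (out : Fin k → Node → Fin k → Option (Msg n)) :
    Spec E (fun me => sendAsMember F me (out me)) (load n F) fun got q m =>
      (∀ me, ∀ i ∉ E.byz, ∀ v ∈ forest n k, i ∈ F v → got me v i = out i v me) ∧
      (∀ i, q i = 0) ∧
      m = ∑ i ∈ E.byzᶜ, ((memberships n F i).map fun v =>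
        (Finset.univ.filter fun j => (out i v j).isSome).card).sum := by
  unfold sendAsMember
  refine Spec.mono (Spec.loop_const _ 1 (mul_one _).symm
    (fun s (got : Fin k → Node → Fin k → Option (Msg n)) q m =>
    (∀ me, ∀ i ∉ E.byz, ∀ v ∈ (memberships n F i).take s, got me v i = out i v me) ∧
      (∀ i, q i = 0) ∧ m = ∑ p ∈ Finset.range s,
        E.sent fun i j => (memberships n F i)[p]?.bind fun v => out i v j) ?_ ?_) ?_
  · simp
  · rintro p - got q m ⟨h₁, h₂, h₃⟩
    refine Spec.bind_pure (Spec.mono (spec_exchange _) ?_)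
    rintro inbox q' m' ⟨g₁, g₂, g₃⟩
    refine ⟨fun me i hi v hv => ?_, fun i => by simp [h₂, g₂],
      by rw [Finset.sum_range_succ, h₃, g₃]⟩
    dsimp only
    split_ifs with hp
    · rw [g₁ me i hi, hp]; rfl
    · exact h₁ me i hi v ((mem_take_succ hv).resolve_right hp)
  · rintro got q m ⟨h₁, h₂, h₃⟩
    refine ⟨fun me i hi v hv hiv => h₁ me i hi v ?_, h₂, ?_⟩
    · rw [List.take_of_length_le (length_memberships_le i)]
      exact mem_memberships.2 ⟨hv, hiv⟩
    · rw [h₃]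
      simp only [Env.sent]
      rw [Finset.sum_comm]
      refine Finset.sum_congr rfl fun i _ => ?_
      exact sum_range_getElem? (fun o => (Finset.univ.filter fun j =>
        (o.bind fun v => out i v j).isSome).card) (by simp) _ _ (length_memberships_le i)

/-- Here the slots follow the list of the receiver, so that a sender may address all members of all
nodes without being a member itself. -/
lemma spec_sendToMembers (out : Fin k → Node → Fin k → Option (Msg n)) :
    Spec E (fun me => sendToMembers F me (out me)) (load n F) fun got q m =>
      (∀ me, ∀ i ∉ E.byz, ∀ v ∈ forest n k, me ∈ F v → got me v i = out i v me) ∧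
      (∀ i, q i = 0) ∧
      m = ∑ i ∈ E.byzᶜ, ∑ j, ((memberships n F j).map fun v =>
        if (out i v j).isSome then 1 else 0).sum := by
  unfold sendToMembers
  refine Spec.mono (Spec.loop_const _ 1 (mul_one _).symm
    (fun s (got : Fin k → Node → Fin k → Option (Msg n)) q m =>
    (∀ me, ∀ i ∉ E.byz, ∀ v ∈ (memberships n F me).take s, got me v i = out i v me) ∧
      (∀ i, q i = 0) ∧ m = ∑ p ∈ Finset.range s,
        E.sent fun i j => (memberships n F j)[p]?.bind fun v => out i v j) ?_ ?_) ?_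
  · simp
  · rintro p - got q m ⟨h₁, h₂, h₃⟩
    refine Spec.bind_pure (Spec.mono (spec_exchange _) ?_)
    rintro inbox q' m' ⟨g₁, g₂, g₃⟩
    refine ⟨fun me i hi v hv => ?_, fun i => by simp [h₂, g₂],
      by rw [Finset.sum_range_succ, h₃, g₃]⟩
    dsimp only
    split_ifs with hp
    · rw [g₁ me i hi, hp]; rfl
    · exact h₁ me i hi v ((mem_take_succ hv).resolve_right hp)
  · rintro got q m ⟨h₁, h₂, h₃⟩
    refine ⟨fun me i hi v hv hiv => h₁ me i hi v ?_, h₂, ?_⟩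
    · rw [List.take_of_length_le (length_memberships_le me)]
      exact mem_memberships.2 ⟨hv, hiv⟩
    · rw [h₃]
      simp only [Env.sent, Finset.card_filter]
      rw [Finset.sum_comm]
      refine Finset.sum_congr rfl fun i _ => ?_
      rw [Finset.sum_comm]
      refine Finset.sum_congr rfl fun j _ => ?_
      exact sum_range_getElem? (fun o => if (o.bind fun v => out i v j).isSome then 1 else 0)
        (by simp) _ _ (length_memberships_le j)

end Communication

/-! ### The shape of the forest -/

section Forest

variable {n k : ℕ}

lemma le_ceilDiv_mul (a : ℕ) {b : ℕ} (hb : 0 < b) : a ≤ a ⌈/⌉ b * b := by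
  simpa [mul_comm] using le_smul_ceilDiv (a := b) (b := a) hb

lemma ceilDiv_mul_lt (a : ℕ) {b : ℕ} (hb : 0 < b) : a ⌈/⌉ b * b < a + b := by
  rw [Nat.ceilDiv_eq_add_pred_div]
  have := Nat.div_mul_le_self (a + b - 1) b
  omega

lemma ceilDiv_pos' {a b : ℕ} (ha : 0 < a) (hb : 0 < b) : 0 < a ⌈/⌉ b := by
  have := le_ceilDiv_mul a hb
  by_contra h
  simp_all

lemma two_le_arity (hk : 0 < k) (hkn : k ≤ n) : 2 ≤ arity n k := by
  have := ceilDiv_pos' (hk.trans_le hkn) hk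
  unfold arity
  omega

lemma leafCount_pos (hk : 0 < k) (hkn : k ≤ n)
    : 0 < leafCount n k := ceilDiv_pos' (by positivity) (hk.trans_le hkn)

lemma treeCount_pos (hk : 0 < k) (hkn : k ≤ n)
    : 0 < treeCount n k := lt_min (ceilDiv_pos' (hk.trans_le hkn) hk) hk

/-- Either there are ⌈n/k⌉ trees, and (n/k)(k²/n) = k, or there are `k` trees with at least one leaf
each. -/
lemma le_treeCount_mul_leafCount (hk : 0 < k) (hkn : k ≤ n)
    : k ≤ treeCount n k * leafCount n k := by
  have hn := hk.trans_le hkn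
  have h₁ := le_ceilDiv_mul n hk
  have h₂ : k ^ 2 ≤ leafCount n k * n := le_ceilDiv_mul (k ^ 2) hn
  have h₃ := leafCount_pos hk hkn
  unfold treeCount
  rcases min_choice (n ⌈/⌉ k) k with h | h <;> rw [h]
  · have : n * k * k ≤ n * k * (n ⌈/⌉ k * leafCount n k) := by
      calc n * k * k = n * k ^ 2 := by ring
        _ ≤ (n ⌈/⌉ k * k) * (leafCount n k * n) := Nat.mul_le_mul h₁ h₂
        _ = _ := by ring
    exact Nat.le_of_mul_le_mul_left this (by positivity)
  · exact Nat.le_mul_of_pos_right _ h₃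

/-- For n ≤ k² each of the two ceilings at most doubles its argument; for k² ≤ n a tree is a single
leaf and there are at most `k` trees. -/
lemma treeCount_mul_leafCount_le (hk : 0 < k) (hkn : k ≤ n)
    : treeCount n k * leafCount n k ≤ 4 * k := by
  have hn := hk.trans_le hkn
  have h₁ := ceilDiv_mul_lt n hk
  have h₂ : leafCount n k * n < k ^ 2 + n := ceilDiv_mul_lt (k ^ 2) hn
  rcases le_total n (k ^ 2) with h | h
  · have h₃ : treeCount n k ≤ n ⌈/⌉ k := min_le_left _ _
    have : n * k * (treeCount n k * leafCount n k) ≤ n * k * (4 * k) := by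
      calc n * k * (treeCount n k * leafCount n k)
          = (treeCount n k * k) * (leafCount n k * n) := by ring
        _ ≤ (n ⌈/⌉ k * k) * (leafCount n k * n) := by gcongr
        _ ≤ (2 * n) * (2 * k ^ 2) := Nat.mul_le_mul (by omega) (by omega)
        _ = _ := by ring
    exact Nat.le_of_mul_le_mul_left this (by positivity)
  · have h₃ : treeCount n k ≤ k := min_le_right _ _
    have h₄ : leafCount n k < 2 := by
      by_contra h'
      have := Nat.mul_le_mul_right n (not_lt.1 h')
      omega
    nlinarith

lemma treeCount_mul_le (hk : 0 < k) (hkn : k ≤ n) : treeCount n k * k ≤ 2 * n := by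
  have h₁ := ceilDiv_mul_lt n hk
  have h₃ : treeCount n k ≤ n ⌈/⌉ k := min_le_left _ _
  nlinarith

lemma firstLeaf_mono (t : ℕ) {q q' : ℕ} (h : q ≤ q') : firstLeaf n k t q ≤ firstLeaf n k t q' :=
  Nat.div_le_div_right (Nat.mul_le_mul_right _ h)

/-- The factor `arity` cancels exactly, so the grid of depth `t + 1` refines that of depth `t`:
whatever the rounding, the children of a position partition its leaves. -/
lemma firstLeaf_succ_mul (t q : ℕ) : firstLeaf n k (t + 1) (q * arity n k) = firstLeaf n k t q := by
  have h : 0 < arity n k := by unfold arity; omega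
  unfold firstLeaf
  rw [pow_succ, show q * arity n k * leafCount n k = q * leafCount n k * arity n k by ring,
    Nat.mul_div_mul_right _ _ h]

lemma firstLeaf_zero_left (q : ℕ) : firstLeaf n k 0 q = q * leafCount n k := by
  simp [firstLeaf]

lemma firstLeaf_pow (t : ℕ) : firstLeaf n k t (arity n k ^ t) = leafCount n k := by
  have h : 0 < arity n k := by unfold arity; omega
  simp [firstLeaf, h]

lemma arity_pos : 0 < arity n k := by unfold arity; omega

/-- The rounding never makes a child bigger than an even split of the leaves of its parent. -/
lemma leavesBelow_child_le {t q c : ℕ} (h : leavesBelow n k t (q / arity n k) ≤ arity n k * c) :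
    leavesBelow n k (t + 1) q ≤ c := by
  have ha : 0 < arity n k := arity_pos
  generalize ha' : arity n k = a at *
  obtain ⟨Q, r, hr, rfl⟩ : ∃ Q r, r < a ∧ q = Q * a + r :=
    ⟨q / a, q % a, Nat.mod_lt _ ha, (Nat.div_add_mod' q a).symm⟩
  have hQ : (Q * a + r) / a = Q := by
    rw [mul_comm, Nat.mul_add_div ha, Nat.div_eq_of_lt hr, add_zero]
  rw [hQ] at h
  unfold leavesBelow at *
  rw [← firstLeaf_succ_mul t (Q + 1), ← firstLeaf_succ_mul t Q, ha'] at h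
  unfold firstLeaf at *
  rw [ha'] at *
  set D := a ^ (t + 1)
  have hD : 0 < D := by positivity
  set l := leafCount n k
  -- The average number of leaves of a child is l / D. If it is at most `c`, no step of the rounded
  -- sequence exceeds `c`. Otherwise every step is at least `c`, so a step above `c` would, together
  -- with the `r` earlier and `e` later siblings, exceed the bound a·c for the parent.
  rcases le_or_gt l (c * D) with hl | hl
  · rw [Nat.sub_le_iff_le_add]
    calc (Q * a + r + 1) * l / D ≤ ((Q * a + r) * l + D * c) / D := by
          apply Nat.div_le_div_right; nlinarith
      _ = _ := by rw [Nat.add_mul_div_left _ _ hD]; ring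
  · set f := Q * a * l / D with hf
    have h₁ : (Q + 1) * a * l / D ≤ f + a * c := by omega
    rw [Nat.div_le_iff_le_mul_add_pred hD] at h₁
    have h₂ : D * f ≤ Q * a * l := Nat.mul_div_le _ _
    have h₃ : (Q * a + r + 1) * l < D * (f + (r + 1) * c + 1) := by
      obtain ⟨e, he⟩ : ∃ e, a = r + 1 + e := ⟨a - (r + 1), by omega⟩
      have : e * (c * D) ≤ e * l := Nat.mul_le_mul_left _ hl.le
      have h₄ : (Q * a + r + 1) * l + e * l < D * (f + a * c) + D := by
        calc (Q * a + r + 1) * l + e * l = (Q * a + (r + 1 + e)) * l := by ring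
          _ = (Q + 1) * a * l := by rw [← he]; ring
          _ ≤ _ := h₁
          _ < _ := by omega
      have h₅ : D * (f + a * c) = D * (f + (r + 1) * c) + e * (c * D) := by rw [he]; ring
      rw [h₅] at h₄
      linarith [mul_add D (f + (r + 1) * c) 1]
    have h₅ : (Q * a + r + 1) * l / D < f + (r + 1) * c + 1 := by
      rw [Nat.div_lt_iff_lt_mul hD]; linarith
    have h₆ : f + r * c ≤ (Q * a + r) * l / D := by
      rw [Nat.le_div_iff_mul_le hD]
      nlinarith [Nat.mul_le_mul_left r hl.le]
    have : (r + 1) * c = r * c + c := by ring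
    omega

lemma leavesBelow_child_le_parent (t q : ℕ) :
    leavesBelow n k (t + 1) q ≤ leavesBelow n k t (q / arity n k) :=
  leavesBelow_child_le (Nat.le_mul_of_pos_left _ arity_pos)

lemma leavesBelow_le_leafCount (t q : ℕ) (h : q < arity n k ^ t) :
    leavesBelow n k t q ≤ leafCount n k := by
  unfold leavesBelow
  have := firstLeaf_mono (n := n) (k := k) t (show q + 1 ≤ _ from h)
  rw [firstLeaf_pow] at this
  omega

lemma leavesBelow_zero : leavesBelow n k 0 0 = leafCount n k := by
  simp [leavesBelow, firstLeaf]

lemma mem_forest {v : Node} : v ∈ forest n k ↔ (v.1 < treeCount n k ∧ v.2.1 < depth n k + 1 ∧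
    v.2.2 < arity n k ^ depth n k) ∧ v.2.2 < arity n k ^ v.2.1 ∧
      (v.2.1 = 0 ∨ (2 ≤ leavesBelow n k (v.2.1 - 1) (v.2.2 / arity n k) ∧
        1 ≤ leavesBelow n k v.2.1 v.2.2)) := by
  obtain ⟨a, b, c⟩ := v
  simp only [forest, List.mem_filter, decide_eq_true_eq]
  rw [show ∀ (l₁ : List ℕ) (l₂ : List (ℕ × ℕ)), l₁ ×ˢ l₂ = l₁.product l₂ from fun _ _ => rfl,
    show ∀ (l₁ l₂ : List ℕ), l₁ ×ˢ l₂ = l₁.product l₂ from fun _ _ => rfl,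
    List.pair_mem_product, List.pair_mem_product]
  simp

lemma nodup_forest : (forest n k).Nodup :=
  (List.nodup_range.product (List.nodup_range.product List.nodup_range)).filter _

/-- Iteration of the estimate for children from the root downwards. With `e = 0` it says that
positions at the full depth have at most one leaf. -/
lemma leavesBelow_depth_le {t q : ℕ} {e : ℕ} (h : leafCount n k ≤ arity n k ^ (t + e))
    (hq : q < arity n k ^ t) : leavesBelow n k t q ≤ arity n k ^ e := by
  induction t generalizing q e with
  | zero => exact (leavesBelow_le_leafCount 0 q hq).trans (by simpa using h)
  | succ t ih =>
    apply leavesBelow_child_le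
    rw [← pow_succ']
    exact ih (by rwa [show t + (e + 1) = t + 1 + e by ring])
      (Nat.div_lt_of_lt_mul (by rwa [← pow_succ']))

lemma leafCount_le_pow_depth (hk : 0 < k) (hkn : k ≤ n) : leafCount n k ≤ arity n k ^ depth n k :=
  Nat.le_pow_clog (two_le_arity hk hkn) _

lemma one_le_leavesBelow (hk : 0 < k) (hkn : k ≤ n)
    {v : Node} (hv : v ∈ forest n k) : 1 ≤ leavesBelow n k v.2.1 v.2.2 := by
  obtain ⟨-, h₁, h | h⟩ := mem_forest.1 hv
  · rw [h] at h₁ ⊢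
    obtain h₂ : v.2.2 = 0 := by simpa using h₁
    rw [h₂, leavesBelow_zero]
    exact leafCount_pos hk hkn
  · exact h.2

lemma mem_forest_of_pos {v : Node} (hv : v ∈ forest n k) (h : v.2.1 ≠ 0) :
    2 ≤ leavesBelow n k (v.2.1 - 1) (v.2.2 / arity n k) := by
  obtain ⟨-, -, h' | h'⟩ := mem_forest.1 hv
  · exact absurd h' h
  · exact h'.1

lemma parent_mem_forest {v : Node} (hv : v ∈ forest n k) (h : v.2.1 ≠ 0) :
    parent n k v ∈ forest n k := by
  have h₂ := mem_forest_of_pos hv h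
  obtain ⟨⟨h₃, h₄, h₅⟩, h₆, -⟩ := mem_forest.1 hv
  obtain ⟨τ, t, q⟩ := v
  obtain ⟨t, rfl⟩ : ∃ t', t = t' + 1 := ⟨t - 1, by simp at h; omega⟩
  simp only [parent, Nat.add_sub_cancel] at *
  refine mem_forest.2 ⟨⟨h₃, by dsimp only; omega, (Nat.div_le_self _ _).trans_lt h₅⟩,
    Nat.div_lt_of_lt_mul (by rwa [← pow_succ']), ?_⟩
  rcases t with _ | t
  · exact Or.inl rfl
  · refine Or.inr ⟨h₂.trans ?_, by dsimp only; omega⟩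
    exact leavesBelow_child_le_parent t _

/-- If the leaves of the parent number at most arity^(e+1), those of the child number at most
arity^e. This makes the level a valid induction parameter although leaves may occur at different
depths. -/
lemma level_lt_level_parent (hk : 0 < k) (hkn : k ≤ n)
    {v : Node} (hv : v ∈ forest n k) (h : v.2.1 ≠ 0) :
    level n k v < level n k (parent n k v) := by
  have h₂ := mem_forest_of_pos hv h
  have ha := two_le_arity hk hkn
  obtain ⟨τ, t, q⟩ := v
  obtain ⟨t, rfl⟩ : ∃ t', t = t' + 1 := ⟨t - 1, by simp at h; omega⟩
  simp only [parent, level, Nat.add_sub_cancel] at *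
  obtain ⟨e, he⟩ : ∃ e, Nat.clog (arity n k) (leavesBelow n k t (q / arity n k)) = e + 1 :=
    ⟨_, (Nat.succ_pred_eq_of_pos (Nat.clog_pos ha h₂)).symm⟩
  have h₃ := Nat.le_pow_clog ha (leavesBelow n k t (q / arity n k))
  rw [he, pow_succ'] at h₃
  have := Nat.clog_le_of_le_pow (leavesBelow_child_le h₃)
  omega

lemma level_le {v : Node} (hv : v ∈ forest n k) : level n k v ≤ depth n k + 1 := by
  have := leavesBelow_le_leafCount _ _ (mem_forest.1 hv).2.1
  exact Nat.succ_le_succ (Nat.clog_mono_right _ this)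

lemma mem_leaves_of_level_le_one (hk : 0 < k) (hkn : k ≤ n)
    {v : Node} (hv : v ∈ forest n k) (h : level n k v ≤ 1) :
    v ∈ leaves n k := by
  have h₁ := one_le_leavesBelow hk hkn hv
  have h₂ : ¬ 0 < Nat.clog (arity n k) (leavesBelow n k v.2.1 v.2.2) := by
    unfold level at h; omega
  have h₃ : ¬ 2 ≤ leavesBelow n k v.2.1 v.2.2 := fun h' =>
    h₂ (Nat.clog_pos (two_le_arity hk hkn) h')
  simp only [leaves, List.mem_filter, decide_eq_true_eq]
  exact ⟨hv, by omega⟩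

lemma mem_assigned {v : Node} {j : Fin n} : j ∈ assigned n k v ↔
    v.1 * leafCount n k + firstLeaf n k v.2.1 v.2.2 ≤ leafOfIndex n k j ∧
      leafOfIndex n k j < v.1 * leafCount n k + firstLeaf n k v.2.1 (v.2.2 + 1) := by
  simp [assigned]

lemma nodup_assigned (v : Node) : (assigned n k v).Nodup := (List.nodup_finRange n).filter _

lemma length_assigned_le (v : Node) : (assigned n k v).length ≤ n :=
  (List.length_filter_le _ _).trans (by simp)

/-- Consecutive intervals given by a monotone sequence cover what its ends enclose. -/
lemma exists_between_steps (f : ℕ → ℕ) {x : ℕ} (N : ℕ) (h₀ : f 0 ≤ x) (h₁ : x < f N) :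
    ∃ r < N, f r ≤ x ∧ x < f (r + 1) := by
  induction N with
  | zero => omega
  | succ N ih =>
    rcases le_or_gt (f N) x with h | h
    · exact ⟨N, by omega, h, h₁⟩
    · obtain ⟨r, hr, h'⟩ := ih h
      exact ⟨r, by omega, h'⟩

lemma exists_child (hk : 0 < k) (hkn : k ≤ n)
    {v : Node} (hv : v ∈ forest n k) (hl : 2 ≤ level n k v) {j : Fin n}
    (hj : j ∈ assigned n k v) :
    ∃ c ∈ forest n k, c.2.1 ≠ 0 ∧ parent n k c = v ∧ j ∈ assigned n k c := by
  have ha := two_le_arity hk hkn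
  have h₂ : 2 ≤ leavesBelow n k v.2.1 v.2.2 := by
    by_contra h
    have : Nat.clog (arity n k) (leavesBelow n k v.2.1 v.2.2) = 0 :=
      Nat.clog_of_right_le_one (by omega) _
    unfold level at hl
    omega
  rw [mem_assigned] at hj
  obtain ⟨⟨h₃, h₄, h₅⟩, h₆, -⟩ := mem_forest.1 hv
  obtain ⟨τ, t, q⟩ := v
  dsimp only at *
  -- The ends of the `arity` child intervals run from the first leaf of `v` to the first leaf after
  -- it, so one of them contains the leaf of `j`; being nonempty, it is not dropped from the forest.
  obtain ⟨r, hr, hr₁, hr₂⟩ := exists_between_steps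
    (fun r => τ * leafCount n k + firstLeaf n k (t + 1) (q * arity n k + r)) (arity n k)
    (x := leafOfIndex n k j) (by simpa [firstLeaf_succ_mul] using hj.1)
    (by
      have : q * arity n k + arity n k = (q + 1) * arity n k := by ring
      simpa [this, firstLeaf_succ_mul] using hj.2)
  have hq : (q * arity n k + r) / arity n k = q := by
    rw [mul_comm, Nat.mul_add_div (by omega), Nat.div_eq_of_lt hr, add_zero]
  -- A position at the full depth has at most one leaf, whereas `v` has two.
  have ht : t < depth n k := by
    by_contra h
    have := leavesBelow_depth_le (t := t) (e := 0)
      ((leafCount_le_pow_depth hk hkn).trans (Nat.pow_le_pow_right (by omega) (by omega))) h₆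
    simp at this
    omega
  have hq' : q * arity n k + r < arity n k ^ (t + 1) := by
    rw [pow_succ]
    calc q * arity n k + r < (q + 1) * arity n k := by linarith
      _ ≤ _ := Nat.mul_le_mul_right _ h₆
  refine ⟨(τ, t + 1, q * arity n k + r), mem_forest.2 ⟨⟨h₃, by dsimp only; omega,
    hq'.trans_le (Nat.pow_le_pow_right (by omega) ht)⟩, hq', Or.inr ⟨?_, ?_⟩⟩, by simp, ?_,
    mem_assigned.2 ⟨hr₁, hr₂⟩⟩
  · simpa [hq] using h₂
  · dsimp only at hr₁ hr₂ ⊢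
    unfold leavesBelow
    have := hr₁.trans_lt hr₂
    rw [← add_assoc (q * arity n k)] at this
    omega
  · simp [parent, hq]

end Forest

/-! ### Sizes in the forest -/

section Sizes

variable {n k : ℕ}

lemma mem_roots {v : Node} :
    v ∈ roots n k ↔ ∃ τ < treeCount n k, v = (τ, 0, 0) := by
  obtain ⟨τ, t, q⟩ := v
  simp only [roots, List.mem_filter, decide_eq_true_eq, mem_forest]
  constructor
  · rintro ⟨⟨⟨h₁, -, -⟩, h₂, -⟩, rfl⟩
    exact ⟨τ, h₁, by simpa using h₂⟩
  · rintro ⟨τ', h, h'⟩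
    simp only [Prod.mk.injEq] at h'
    obtain ⟨rfl, rfl, rfl⟩ := h'
    simp [h, arity_pos]

lemma nodup_roots : (roots n k).Nodup := nodup_forest.filter _

lemma roots_perm :
    (roots n k).Perm ((List.range (treeCount n k)).map fun τ => (τ, 0, 0)) := by
  rw [List.perm_ext_iff_of_nodup nodup_roots
    (List.nodup_range.map fun a b h => by simpa using h)]
  intro v
  rw [mem_roots]
  simp [eq_comm]

lemma length_roots : (roots n k).length = treeCount n k := by
  simpa using (roots_perm).length_eq

lemma mem_assigned_root (hk : 0 < k) (hkn : k ≤ n) {τ : ℕ} {j : Fin n} :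
    j ∈ assigned n k (τ, 0, 0) ↔ (j : ℕ) * treeCount n k / n = τ := by
  have hl := leafCount_pos hk hkn
  have : (j : ℕ) * treeCount n k / n = leafOfIndex n k j / leafCount n k := by
    rw [leafOfIndex, Nat.div_div_eq_div_mul, ← mul_assoc,
      Nat.mul_div_mul_right _ _ hl]
  rw [this, mem_assigned, Nat.div_eq_iff hl]
  simp only [firstLeaf_zero_left]
  rw [zero_mul, zero_add, one_mul, add_zero]
  constructor
  · rintro ⟨h₁, h₂⟩; exact ⟨h₁, by omega⟩
  · rintro ⟨h₁, h₂⟩; exact ⟨h₁, by omega⟩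

/-- There are at most k ≤ n trees, so every block contains an index, namely ⌈τn / treeCount⌉. A
binary search can thus start from a nonempty range; a dispute about an empty one could not be
settled by a query. -/
lemma assigned_root_pos (hk : 0 < k) (hkn : k ≤ n) {v : Node} (hv : v ∈ roots n k) :
    0 < (assigned n k v).length := by
  obtain ⟨τ, hτ, rfl⟩ := (mem_roots).1 hv
  have hn := hk.trans_le hkn
  have ht := treeCount_pos hk hkn
  have htn : treeCount n k ≤ n := (min_le_right _ _).trans hkn
  have h₁ := le_ceilDiv_mul (τ * n) ht
  have h₂ := ceilDiv_mul_lt (τ * n) ht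
  have h₃ : (τ + 1) * n ≤ treeCount n k * n := Nat.mul_le_mul_right _ hτ
  have hlt : τ * n ⌈/⌉ treeCount n k < n := by
    refine Nat.lt_of_mul_lt_mul_right (a := treeCount n k) ?_
    nlinarith
  refine List.length_pos_of_mem (a := ⟨_, hlt⟩) ((mem_assigned_root hk hkn).2 ?_)
  rw [Nat.div_eq_iff hn]
  constructor
  · simpa using h₁
  · have : (1 + τ) * n = τ * n + n := by ring
    dsimp only
    omega

/-- Indices of one leaf differ by less than n divided by the number of leaves, and there are at
least `k` leaves; so the offsets from the smallest index lie below ⌈n/k⌉. -/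
lemma card_filter_leafOfIndex_le (hk : 0 < k) (hkn : k ≤ n) (l : ℕ) :
    (Finset.univ.filter fun j : Fin n => leafOfIndex n k j = l).card ≤ n ⌈/⌉ k := by
  have hn := hk.trans_le hkn
  set S := Finset.univ.filter fun j : Fin n => leafOfIndex n k j = l with hS
  rcases S.eq_empty_or_nonempty with h | h
  · simp [h]
  obtain ⟨j₀, hj₀, hmin⟩ := S.exists_min_image id h
  have hmaps : ∀ j ∈ S, (j : ℕ) - j₀ ∈ Finset.range (n ⌈/⌉ k) := by
    intro j hj
    have h₁ : (j₀ : ℕ) ≤ j := hmin j hj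
    simp only [hS, Finset.mem_filter, Finset.mem_univ, true_and, leafOfIndex,
      Nat.div_eq_iff hn] at hj hj₀
    rw [Finset.mem_range]
    have h₂ := le_ceilDiv_mul n hk
    have h₃ := le_treeCount_mul_leafCount hk hkn
    set N := treeCount n k * leafCount n k
    obtain ⟨e, he⟩ := Nat.exists_eq_add_of_le h₁
    rw [he, Nat.add_sub_cancel_left]
    rw [he] at hj
    by_contra hlt
    have h₄ : n ⌈/⌉ k * k ≤ e * N := Nat.mul_le_mul (not_lt.1 hlt) h₃
    have h₅ : (j₀ + e) * N = j₀ * N + e * N := by ring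
    have h₆ : (1 + l) * n = l * n + n := by ring
    omega
  calc S.card ≤ (Finset.range (n ⌈/⌉ k)).card := by
        refine Finset.card_le_card_of_injOn (fun j => (j : ℕ) - j₀) hmaps ?_
        intro a ha b hb hab
        have h₁ : (j₀ : ℕ) ≤ a := hmin a ha
        have h₂ : (j₀ : ℕ) ≤ b := hmin b hb
        dsimp only at hab
        omega
    _ = _ := Finset.card_range _

lemma length_assigned_le_mul (hk : 0 < k) (hkn : k ≤ n) (v : Node) :
    (assigned n k v).length ≤ leavesBelow n k v.2.1 v.2.2 * (n ⌈/⌉ k) := by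
  classical
  rw [← List.toFinset_card_of_nodup (nodup_assigned v)]
  set lo := v.1 * leafCount n k + firstLeaf n k v.2.1 v.2.2
  set hi := v.1 * leafCount n k + firstLeaf n k v.2.1 (v.2.2 + 1)
  have h := Finset.card_le_mul_card_image_of_maps_to (s := (assigned n k v).toFinset)
    (t := Finset.Ico lo hi) (f := leafOfIndex n k)
    (fun j hj => by
      rw [List.mem_toFinset, mem_assigned] at hj
      exact Finset.mem_Ico.2 hj) (n ⌈/⌉ k)
    (fun l _ => (Finset.card_le_card (Finset.filter_subset_filter _ (Finset.subset_univ _))).trans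
      (card_filter_leafOfIndex_le hk hkn l))
  rw [Nat.card_Ico] at h
  have : hi - lo = leavesBelow n k v.2.1 v.2.2 := by simp only [hi, lo, leavesBelow]; omega
  rwa [this, mul_comm] at h

lemma mem_childrenOfLevel {i : ℕ} {c : Node} : c ∈ childrenOfLevel n k i ↔
    c ∈ forest n k ∧ c.2.1 ≠ 0 ∧ level n k (parent n k c) = i := by
  simp [childrenOfLevel]

lemma le_foldr_max {l : List ℕ} {x : ℕ} (h : x ∈ l) : x ≤ l.foldr max 0 := by
  induction l with
  | nil => simp at h
  | cons a l ih =>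
    rcases List.mem_cons.1 h with rfl | h
    · exact le_max_left _ _
    · exact (ih h).trans (le_max_right _ _)

lemma foldr_max_le {l : List ℕ} {b : ℕ} (h : ∀ x ∈ l, x ≤ b) : l.foldr max 0 ≤ b := by
  induction l with
  | nil => simp
  | cons a l ih =>
    exact max_le (h a (by simp)) (ih fun x hx => h x (by simp [hx]))

lemma length_assigned_le_maxAssigned {i : ℕ} {c : Node} (hc : c ∈ childrenOfLevel n k i) :
    (assigned n k c).length ≤ maxAssigned n k i :=
  le_foldr_max (List.mem_map.2 ⟨c, hc, rfl⟩)

lemma leavesBelow_le_of_pos {t q : ℕ} (ht : t ≠ 0) (hq : q < arity n k ^ t) :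
    leavesBelow n k t q ≤ leafCount n k ⌈/⌉ arity n k := by
  induction t generalizing q with
  | zero => exact absurd rfl ht
  | succ t ih =>
    have hq' : q / arity n k < arity n k ^ t := Nat.div_lt_of_lt_mul (by rwa [← pow_succ'])
    rcases t with _ | t
    · apply leavesBelow_child_le
      refine (leavesBelow_le_leafCount _ _ hq').trans ?_
      rw [mul_comm]
      exact le_ceilDiv_mul _ arity_pos
    · exact (leavesBelow_child_le_parent _ _).trans (ih (by simp) hq')

lemma maxAssigned_le_pow (hk : 0 < k) (hkn : k ≤ n) (i : ℕ) :
    maxAssigned n k (i + 2) ≤ arity n k ^ i * (n ⌈/⌉ k) := by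
  refine foldr_max_le fun x hx => ?_
  obtain ⟨c, hc, rfl⟩ := List.mem_map.1 hx
  obtain ⟨hc₁, hc₂, hc₃⟩ := mem_childrenOfLevel.1 hc
  refine (length_assigned_le_mul hk hkn c).trans (Nat.mul_le_mul_right _ ?_)
  have h₁ := level_lt_level_parent hk hkn hc₁ hc₂
  have h₂ := Nat.le_pow_clog (two_le_arity hk hkn) (leavesBelow n k c.2.1 c.2.2)
  refine h₂.trans (Nat.pow_le_pow_right arity_pos ?_)
  unfold level at *
  omega

lemma maxAssigned_le_ceilDiv (hk : 0 < k) (hkn : k ≤ n) (i : ℕ) :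
    maxAssigned n k i ≤ (leafCount n k ⌈/⌉ arity n k) * (n ⌈/⌉ k) := by
  refine foldr_max_le fun x hx => ?_
  obtain ⟨c, hc, rfl⟩ := List.mem_map.1 hx
  obtain ⟨hc₁, hc₂, hc₃⟩ := mem_childrenOfLevel.1 hc
  exact (length_assigned_le_mul hk hkn c).trans (Nat.mul_le_mul_right _
    (leavesBelow_le_of_pos hc₂ (mem_forest.1 hc₁).2.1))

lemma sum_pow_le_two_mul {a : ℕ} (ha : 2 ≤ a) (m : ℕ) :
    ∑ i ∈ Finset.range (m + 1), a ^ i ≤ 2 * a ^ m := by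
  induction m with
  | zero => simp
  | succ m ih =>
    rw [Finset.sum_range_succ, pow_succ]
    nlinarith [pow_pos (show 0 < a by omega) m]

lemma pow_lt_leafCount {m : ℕ} (h : m < depth n k) :
    arity n k ^ m < leafCount n k := by
  by_contra h'
  exact absurd (Nat.clog_le_of_le_pow (not_lt.1 h')) (not_le.2 h)

/-- All levels but the topmost are bounded by a geometric series whose last term, multiplied by the
arity, is still below `leafCount`. At the topmost level the power would lose up to a factor `arity`,
and the even split of the root's leaves is used instead. The factor `arity` on the left avoids
division. -/
lemma arity_mul_sum_maxAssigned_le (hk : 0 < k) (hkn : k ≤ n) :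
    arity n k * ∑ i ∈ Finset.range (depth n k), maxAssigned n k (i + 2) ≤
      (3 * leafCount n k + arity n k) * (n ⌈/⌉ k) := by
  have ha := two_le_arity hk hkn
  have h₀ := ceilDiv_mul_lt (leafCount n k) (arity_pos (n := n) (k := k))
  have h₁ : ∀ i, arity n k * maxAssigned n k i ≤
      (leafCount n k + arity n k) * (n ⌈/⌉ k) := fun i => by
    calc arity n k * maxAssigned n k i
        ≤ arity n k * ((leafCount n k ⌈/⌉ arity n k) * (n ⌈/⌉ k)) :=
          Nat.mul_le_mul_left _ (maxAssigned_le_ceilDiv hk hkn i)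
      _ = ((leafCount n k ⌈/⌉ arity n k) * arity n k) * (n ⌈/⌉ k) := by ring
      _ ≤ _ := Nat.mul_le_mul_right _ h₀.le
  rcases hd : depth n k with _ | _ | m
  · simp
  · rw [zero_add, Finset.sum_range_one]
    exact (h₁ _).trans (Nat.mul_le_mul_right _ (by omega))
  · rw [Finset.sum_range_succ, mul_add]
    have h₂ : arity n k * ∑ i ∈ Finset.range (m + 1), maxAssigned n k (i + 2) ≤
        2 * leafCount n k * (n ⌈/⌉ k) := by
      calc arity n k * ∑ i ∈ Finset.range (m + 1), maxAssigned n k (i + 2)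
          ≤ arity n k * ∑ i ∈ Finset.range (m + 1), arity n k ^ i * (n ⌈/⌉ k) :=
            Nat.mul_le_mul_left _ (Finset.sum_le_sum fun i _ => maxAssigned_le_pow hk hkn i)
        _ = arity n k * (∑ i ∈ Finset.range (m + 1), arity n k ^ i) * (n ⌈/⌉ k) := by
            rw [← Finset.sum_mul, mul_assoc]
        _ ≤ arity n k * (2 * arity n k ^ m) * (n ⌈/⌉ k) := by
            gcongr; exact sum_pow_le_two_mul ha m
        _ = 2 * arity n k ^ (m + 1) * (n ⌈/⌉ k) := by ring
        _ ≤ _ := by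
            gcongr; exact (pow_lt_leafCount (by omega)).le
    refine (Nat.add_le_add h₂ (h₁ _)).trans (le_of_eq (by ring))

/-- A sum over the children of all levels runs at most once over each node that is not a root. -/
lemma sum_childrenOfLevel_le (g : Node → ℕ) (p : Node → Prop) [DecidablePred p] (N : ℕ) :
    ∑ i ∈ Finset.range N, (((childrenOfLevel n k (i + 2)).filter fun c => p c).map g).sum ≤
      ∑ c ∈ (forest n k).toFinset.filter (fun c => c.2.1 ≠ 0 ∧ p c), g c := by
  -- The function `level - 2` sorts the nodes into disjoint classes. The subtraction is truncated,
  -- so levels below 2 are excluded separately.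
  have h : ∀ i, (((childrenOfLevel n k (i + 2)).filter fun c => p c).map g).sum =
      ∑ c ∈ ((forest n k).toFinset.filter fun c => c.2.1 ≠ 0 ∧ p c) with
        level n k (parent n k c) - 2 = i ∧ 2 ≤ level n k (parent n k c), g c := by
    intro i
    have hnd : (childrenOfLevel n k (i + 2)).Nodup := nodup_forest.filter _
    rw [← List.sum_toFinset g (hnd.filter _)]
    refine Finset.sum_congr ?_ fun _ _ => rfl
    ext c
    simp only [List.mem_toFinset, List.mem_filter, Finset.mem_filter, mem_childrenOfLevel,
      decide_eq_true_eq]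
    constructor
    · rintro ⟨⟨h₁, h₂, h₃⟩, h₄⟩; exact ⟨⟨h₁, h₂, h₄⟩, by omega, by omega⟩
    · rintro ⟨⟨h₁, h₂, h₄⟩, h₅, h₆⟩; exact ⟨⟨h₁, h₂, by omega⟩, h₄⟩
  simp only [h]
  set S := (forest n k).toFinset.filter fun c => c.2.1 ≠ 0 ∧ p c
  rw [← Finset.sum_biUnion]
  · refine Finset.sum_le_sum_of_subset ?_
    intro c hc
    obtain ⟨i, -, hi⟩ := Finset.mem_biUnion.1 hc
    exact (Finset.mem_filter.1 hi).1
  · intro i _ j _ hij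
    refine Finset.disjoint_left.2 fun c hc hc' => hij ?_
    exact (Finset.mem_filter.1 hc).2.1.symm.trans (Finset.mem_filter.1 hc').2.1

/-- A machine has at most `load` parents to serve, and siblings are told apart by their position
modulo the arity. -/
lemma card_children_le {F : Node → Finset (Fin k)} (me : Fin k) :
    ((forest n k).toFinset.filter fun c => c.2.1 ≠ 0 ∧ me ∈ F (parent n k c)).card ≤
      load n F * arity n k := by
  have hnd : (memberships n F me).Nodup := nodup_forest.filter _
  have h := Finset.card_le_mul_card_image_of_maps_to
    (s := (forest n k).toFinset.filter fun c => c.2.1 ≠ 0 ∧ me ∈ F (parent n k c))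
    (t := (memberships n F me).toFinset) (f := parent n k) (fun c hc => by
      simp only [Finset.mem_filter, List.mem_toFinset] at hc ⊢
      exact mem_memberships.2 ⟨parent_mem_forest hc.1 hc.2.1, hc.2.2⟩) (arity n k)
    (fun v _ => by
      have ha : 0 < arity n k := arity_pos
      have := Finset.card_le_card_of_injOn (s := Finset.filter (fun c => parent n k c = v)
        ((forest n k).toFinset.filter fun c => c.2.1 ≠ 0 ∧ me ∈ F (parent n k c)))
        (t := Finset.range (arity n k)) (fun c => c.2.2 % arity n k)
        (fun c _ => by simpa using Nat.mod_lt _ ha) ?_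
      · simpa using this
      · rintro ⟨τ, t, q⟩ hc ⟨τ', t', q'⟩ hc' he
        simp only [Finset.coe_filter, Set.mem_ofPred_eq, Finset.mem_filter] at hc hc'
        obtain ⟨⟨-, hc₁, -⟩, hc₂⟩ := hc
        obtain ⟨⟨-, hc₁', -⟩, hc₂'⟩ := hc'
        have := hc₂.trans hc₂'.symm
        simp only [parent, Prod.mk.injEq] at this
        dsimp only at hc₁ hc₁' he
        obtain ⟨h₁, h₂, h₃⟩ := this
        have h₄ := Nat.div_add_mod q (arity n k)
        have h₅ := Nat.div_add_mod q' (arity n k)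
        rw [h₃, he] at h₄
        simp only [Prod.mk.injEq]
        exact ⟨h₁, by omega, by omega⟩)
  rw [List.toFinset_card_of_nodup hnd] at h
  exact h.trans (by rw [mul_comm]; exact Nat.mul_le_mul_right _ (length_memberships_le me))

/-- Nodes of the same depth have no index in common. -/
lemma eq_of_mem_assigned (hk : 0 < k) (hkn : k ≤ n) {v w : Node} (hv : v ∈ forest n k)
    (hw : w ∈ forest n k) (h : v.2.1 = w.2.1) {l : ℕ}
    (hv₁ : v.1 * leafCount n k + firstLeaf n k v.2.1 v.2.2 ≤ l)
    (hv₂ : l < v.1 * leafCount n k + firstLeaf n k v.2.1 (v.2.2 + 1))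
    (hw₁ : w.1 * leafCount n k + firstLeaf n k w.2.1 w.2.2 ≤ l)
    (hw₂ : l < w.1 * leafCount n k + firstLeaf n k w.2.1 (w.2.2 + 1)) : v = w := by
  have hl := leafCount_pos hk hkn
  have htree : ∀ u ∈ forest n k, u.1 * leafCount n k + firstLeaf n k u.2.1 u.2.2 ≤ l →
      l < u.1 * leafCount n k + firstLeaf n k u.2.1 (u.2.2 + 1) → l / leafCount n k = u.1 := by
    intro u hu h₁ h₂
    have h₃ := firstLeaf_mono (n := n) (k := k) u.2.1
      (show u.2.2 + 1 ≤ _ from (mem_forest.1 hu).2.1)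
    rw [firstLeaf_pow] at h₃
    rw [Nat.div_eq_iff hl]
    have : (1 + u.1) * leafCount n k = u.1 * leafCount n k + leafCount n k := by ring
    constructor <;> omega
  have h₁ : v.1 = w.1 := (htree v hv hv₁ hv₂).symm.trans (htree w hw hw₁ hw₂)
  obtain ⟨τ, t, q⟩ := v
  obtain ⟨τ', t', q'⟩ := w
  dsimp only at *
  subst h₁ h
  have : q = q' := by
    rcases lt_trichotomy q q' with h | h | h
    · have := firstLeaf_mono (n := n) (k := k) t (show q + 1 ≤ q' from h)
      omega
    · exact h
    · have := firstLeaf_mono (n := n) (k := k) t (show q' + 1 ≤ q from h)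
      omega
  rw [this]

/-- Nodes of equal depth have disjoint assignments, so a pair of node and index is determined by
depth and index; non-roots have depths 1 to `depth`. -/
lemma sum_length_assigned_le (hk : 0 < k) (hkn : k ≤ n) :
    ∑ c ∈ (forest n k).toFinset.filter (fun c => c.2.1 ≠ 0), (assigned n k c).length ≤
      depth n k * n := by
  have h : ∀ c : Node, (assigned n k c).length = ((assigned n k c).toFinset).card := fun c =>
    (List.toFinset_card_of_nodup (nodup_assigned c)).symm
  simp only [h]
  rw [← Finset.card_sigma]
  have := Finset.card_le_card_of_injOn
    (s := ((forest n k).toFinset.filter fun c => c.2.1 ≠ 0).sigma fun c =>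
      (assigned n k c).toFinset)
    (t := (Finset.range (depth n k)) ×ˢ (Finset.univ : Finset (Fin n)))
    (fun x => (x.1.2.1 - 1, x.2)) ?_ ?_
  · simpa using this
  · rintro ⟨c, j⟩ hx
    simp only [Finset.coe_sigma, Set.mem_sigma_iff, Finset.coe_filter, Set.mem_ofPred_eq,
      List.mem_toFinset] at hx
    have := (mem_forest.1 hx.1.1).1.2.1
    simp
    omega
  · rintro ⟨c, j⟩ hx ⟨c', j'⟩ hx' he
    simp only [Finset.coe_sigma, Set.mem_sigma_iff, Finset.coe_filter, Set.mem_ofPred_eq,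
      List.mem_toFinset, Finset.mem_coe] at hx hx'
    simp only [Prod.mk.injEq] at he
    obtain ⟨he, rfl⟩ := he
    have h₁ := mem_assigned.1 hx.2
    have h₂ := mem_assigned.1 hx'.2
    have := eq_of_mem_assigned hk hkn hx.1.1 hx'.1.1 (by omega) h₁.1 h₁.2 h₂.1 h₂.2
    rw [this]

lemma card_forest_depth_le_pow (t : ℕ) :
    ((forest n k).toFinset.filter fun v => v.2.1 = t).card ≤ treeCount n k * arity n k ^ t := by
  have := Finset.card_le_card_of_injOn (s := (forest n k).toFinset.filter fun v => v.2.1 = t)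
    (t := Finset.range (treeCount n k) ×ˢ Finset.range (arity n k ^ t))
    (fun v => (v.1, v.2.2)) ?_ ?_
  · simpa using this
  · intro v hv
    simp only [Finset.coe_filter, Set.mem_ofPred_eq, List.mem_toFinset, mem_forest] at hv
    obtain ⟨⟨⟨h₁, -, -⟩, h₂, -⟩, h₃⟩ := hv
    rw [h₃] at h₂
    simp [h₁, h₂]
  · rintro ⟨a, b, c⟩ hv ⟨a', b', c'⟩ hv' he
    simp only [Finset.coe_filter, Set.mem_ofPred_eq] at hv hv'
    simp_all

/-- Every node has a leaf, so nodes of one depth are determined by their first leaf in the whole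
forest. -/
lemma card_forest_depth_le (hk : 0 < k) (hkn : k ≤ n) (t : ℕ) :
    ((forest n k).toFinset.filter fun v => v.2.1 = t).card ≤
      treeCount n k * leafCount n k := by
  have := Finset.card_le_card_of_injOn (s := (forest n k).toFinset.filter fun v => v.2.1 = t)
    (t := Finset.range (treeCount n k * leafCount n k))
    (fun v => v.1 * leafCount n k + firstLeaf n k v.2.1 v.2.2) ?_ ?_
  · simpa using this
  · intro v hv
    simp only [Finset.coe_filter, Set.mem_ofPred_eq, List.mem_toFinset] at hv
    have h₁ := one_le_leavesBelow hk hkn hv.1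
    have h₃ := firstLeaf_mono (n := n) (k := k) v.2.1
      (show v.2.2 + 1 ≤ _ from (mem_forest.1 hv.1).2.1)
    have h₄ := Nat.mul_le_mul_right (leafCount n k) (mem_forest.1 hv.1).1.1
    rw [firstLeaf_pow] at h₃
    rw [Nat.succ_mul] at h₄
    unfold leavesBelow at h₁
    simp only [Finset.coe_range, Set.mem_Iio]
    omega
  · intro v hv w hw he
    simp only [Finset.coe_filter, Set.mem_ofPred_eq, List.mem_toFinset] at hv hw
    dsimp only at he
    have h₁ := one_le_leavesBelow hk hkn hv.1
    have h₂ := one_le_leavesBelow hk hkn hw.1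
    unfold leavesBelow at h₁ h₂
    exact eq_of_mem_assigned hk hkn hv.1 hw.1 (hv.2.trans hw.2.symm) le_rfl (by omega) he.ge
      (by omega)

/-- The deepest layer has at most one node per leaf, hence at most 4k nodes. The layers above it
grow geometrically and stay below the number of leaves, which adds at most 8k. -/
lemma length_forest_le (hk : 0 < k) (hkn : k ≤ n) : (forest n k).length ≤ 12 * k := by
  rw [← List.toFinset_card_of_nodup nodup_forest]
  have h₀ := treeCount_mul_leafCount_le hk hkn
  have h₁ := Finset.card_eq_sum_card_fiberwise (s := (forest n k).toFinset)
    (t := Finset.range (depth n k + 1)) (f := fun v => v.2.1) (fun v hv => by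
      have hv' : v ∈ forest n k := by simpa using hv
      simpa using (mem_forest.1 hv').1.2.1)
  rw [h₁, Finset.sum_range_succ]
  have h₂ := card_forest_depth_le hk hkn (depth n k)
  suffices h : ∑ t ∈ Finset.range (depth n k),
      ((forest n k).toFinset.filter fun v => v.2.1 = t).card ≤
        2 * (treeCount n k * leafCount n k) by omega
  rcases hd : depth n k with _ | m
  · simp
  · calc _ ≤ ∑ t ∈ Finset.range (m + 1), treeCount n k * arity n k ^ t :=
          Finset.sum_le_sum fun t _ => card_forest_depth_le_pow t
      _ = treeCount n k * ∑ t ∈ Finset.range (m + 1), arity n k ^ t := by rw [Finset.mul_sum]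
      _ ≤ treeCount n k * (2 * arity n k ^ m) :=
          Nat.mul_le_mul_left _ (sum_pow_le_two_mul (two_le_arity hk hkn) m)
      _ ≤ treeCount n k * (2 * leafCount n k) := by
          gcongr
          exact (pow_lt_leafCount (by omega)).le
      _ = _ := by ring

end Sizes

/-! ### Convergecasting -/

/-- Every committee has at most `s` members, and one outside `B`. -/
structure GoodCommittees {k : ℕ} (n : ℕ) (B : Finset (Fin k)) (F : Node → Finset (Fin k))
    (s : ℕ) : Prop where
  card_le : ∀ v ∈ forest n k, (F v).card ≤ s
  honest : ∀ v ∈ forest n k, ∃ h ∈ F v, h ∉ B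

lemma sum_map_filter_eq {α : Type*} (l : List α) (p : α → Bool) (f : α → ℕ) :
    ((l.filter p).map f).sum = (l.map fun a => if p a then f a else 0).sum := by
  induction l with
  | nil => simp
  | cons a l ih => by_cases h : p a <;> simp [h, ih]

/-- Only an inequality, since several nodes may request the same index, which is then queried once.
-/
lemma card_filter_exists_list_le {α β : Type*} [Fintype β] [DecidableEq β] (l : List α)
    (idx : α → Option β) (P : α → Prop) [DecidablePred P] :
    (Finset.univ.filter fun j => ∃ c ∈ l, idx c = some j ∧ P c).card ≤
      (l.map fun c => if (idx c).isSome ∧ P c then 1 else 0).sum := by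
  induction l with
  | nil => simp
  | cons c l ih =>
    simp only [List.map_cons, List.sum_cons, List.mem_cons, exists_eq_or_imp,
      Finset.filter_or]
    refine (Finset.card_union_le _ _).trans (Nat.add_le_add ?_ ih)
    rcases h : idx c with _ | j
    · simp
    · by_cases hP : P c
      · simp [hP, Finset.filter_eq]
      · simp [hP]

/-- Every update writes the true value, so neither the order of the updates nor repeated indices
matter, and a correct entry is never spoiled. -/
lemma foldl_update_eq {α β : Type*} [DecidableEq β] (x : β → Bool) (idx : α → Option β)
    (f : (β → Bool) → α → β → Bool) (l : List α)
    (hf : ∀ c ∈ l, ∀ res, (idx c = none ∧ f res c = res) ∨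
      ∃ j, idx c = some j ∧ f res c = Function.update res j (x j)) (res : β → Bool) (j : β)
    (h : res j = x j ∨ ∃ c ∈ l, idx c = some j) : l.foldl f res j = x j := by
  induction l generalizing res with
  | nil => simpa using h
  | cons c l ih =>
    rw [List.foldl_cons]
    refine ih (fun c hc => hf c (by simp [hc])) _ ?_
    rcases hf c (by simp) res with ⟨h₁, h₂⟩ | ⟨j', h₁, h₂⟩
    · rw [h₂]
      rcases h with h | ⟨c', hc', h⟩
      · exact Or.inl h
      · rcases List.mem_cons.1 hc' with rfl | hc'
        · simp [h₁] at h
        · exact Or.inr ⟨c', hc', h⟩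
    · rw [h₂]
      by_cases hj : j = j'
      · subst hj; simp
      · rw [Function.update_of_ne hj]
        rcases h with h | ⟨c', hc', h⟩
        · exact Or.inl h
        · rcases List.mem_cons.1 hc' with rfl | hc'
          · rw [h₁] at h; exact absurd (Option.some.inj h).symm hj
          · exact Or.inr ⟨c', hc', h⟩

/-! ### Disputes and blacklists -/

section Claims

variable {k : ℕ} {S : Finset (Fin k)} {claim : Fin k → Bool}

/-- Applied with an honest `h`: without a dispute, liars that are not blacklisted must repeat the
truth. -/
lemma agreed_eq {h : Fin k} (hh : h ∈ S) (hd : ¬ Disputed S claim) :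
    agreed S claim = claim h := by
  rcases hc : claim h with _ | _
  · simp only [agreed, decide_eq_false_iff_not]
    rintro ⟨i, hi, hi'⟩
    exact hd ⟨i, hi, h, hh, by simp [hc, hi']⟩
  · exact decide_eq_true ⟨h, hh, hc⟩

lemma exists_ne_of_disputed (hd : Disputed S claim) (a : Bool) : ∃ i ∈ S, claim i ≠ a := by
  obtain ⟨i, hi, j, hj, hij⟩ := hd
  by_cases h : claim i = a
  · exact ⟨j, hj, fun h' => hij (h.trans h'.symm)⟩
  · exact ⟨i, hi, h⟩

/-- A dispute that is settled leads to a new entry in the blacklist. -/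
lemma card_lt_card_blacklist {C black : Finset (Fin k)} (hd : Disputed (C \ black) claim)
    (a : Bool) :
    (black ∩ C).card < ((black ∪ C.filter fun M => claim M ≠ a) ∩ C).card := by
  obtain ⟨i, hi, hia⟩ := exists_ne_of_disputed hd a
  rw [Finset.mem_sdiff] at hi
  refine Finset.card_lt_card (Finset.ssubset_iff_of_subset ?_ |>.2 ⟨i, ?_, ?_⟩)
  · exact Finset.inter_subset_inter_right Finset.subset_union_left
  · simp [hi.1, hia]
  · simp [hi.2]

end Claims

section Convergecast

variable {n k : ℕ} {E : Env n k (Msg n)} {F : Node → Finset (Fin k)}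

/-- The exchange of all bits at the beginning of `convergeLevel`. -/
lemma spec_hear {s : ℕ} (hF : ∀ v ∈ forest n k, (F v).card ≤ s) (i : ℕ)
    (res : Fin k → Fin n → Bool) :
    Spec E (fun me => Prog.loop (fun p (heard : Node → Fin k → ℕ → Bool) => do
      let got ← sendAsMember F me fun c j =>
        if c ∈ childrenOfLevel n k i ∧ j ∈ F (parent n k c) then
          (assigned n k c)[p]?.map fun idx => Sum.inl (res me idx)
        else none
      pure fun c M p' => if p' = p then Msg.bit (got c M) else heard c M p')
    (maxAssigned n k i) (fun _ _ _ => false)) (maxAssigned n k i * load n F) fun heard q m =>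
      (∀ me, ∀ c ∈ childrenOfLevel n k i, me ∈ F (parent n k c) → ∀ M ∈ F c, M ∉ E.byz →
        ∀ p j, (assigned n k c)[p]? = some j → heard me c M p = res M j) ∧
      (∀ me, q me = 0) ∧
      m ≤ ((childrenOfLevel n k i).map fun c => s ^ 2 * (assigned n k c).length).sum := by
  refine Spec.mono (Spec.loop_const _ _ rfl
    (fun P (heard : Fin k → Node → Fin k → ℕ → Bool) q m =>
      (∀ me, ∀ c ∈ childrenOfLevel n k i, me ∈ F (parent n k c) → ∀ M ∈ F c, M ∉ E.byz →
        ∀ p < P, ∀ j, (assigned n k c)[p]? = some j → heard me c M p = res M j) ∧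
      (∀ me, q me = 0) ∧
      m ≤ ((childrenOfLevel n k i).map fun c =>
        s ^ 2 * min (assigned n k c).length P).sum) ?_ ?_) ?_
  · simp
  · rintro P - heard q m ⟨h₁, h₂, h₃⟩
    refine Spec.bind_pure (Spec.mono (spec_sendAsMember _) ?_)
    rintro got q' m' ⟨g₁, g₂, g₃⟩
    refine ⟨fun me c hc hme M hM hMB p hp j hj => ?_, fun me => by simp [h₂, g₂], ?_⟩
    · dsimp only
      split_ifs with hpP
      · subst hpP
        rw [g₁ me M hMB c (mem_childrenOfLevel.1 hc).1 hM, if_pos ⟨hc, hme⟩, hj]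
        rfl
      · exact h₁ me c hc hme M hM hMB p (by omega) j hj
    · have key : m' ≤ ((childrenOfLevel n k i).map fun c =>
          s ^ 2 * if P < (assigned n k c).length then 1 else 0).sum := by
        rw [g₃]
        set g : Node → ℕ := fun c =>
          if c ∈ childrenOfLevel n k i ∧ P < (assigned n k c).length then s else 0 with hg
        calc _ ≤ ∑ M ∈ E.byzᶜ, ((memberships n F M).map g).sum := by
              refine Finset.sum_le_sum fun M _ => List.sum_le_sum fun c hc => ?_
              by_cases hcc : c ∈ childrenOfLevel n k i
              · by_cases hP : P < (assigned n k c).length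
                · simp only [hg, hcc, hP, and_self, if_true, true_and]
                  refine (Finset.card_le_card ?_).trans (hF _ (parent_mem_forest
                    (mem_childrenOfLevel.1 hcc).1 (mem_childrenOfLevel.1 hcc).2.1))
                  intro j hj
                  by_contra hj'
                  simp [hj'] at hj
                · have : (assigned n k c)[P]? = none := by simpa using hP
                  simp [this]
              · simp [hcc]
          _ ≤ ∑ M, ((memberships n F M).map g).sum :=
              Finset.sum_le_sum_of_subset (Finset.subset_univ _)
          _ = _ := sum_memberships g
          _ ≤ ((forest n k).map fun c => if c.2.1 ≠ 0 ∧ level n k (parent n k c) = i then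
                s ^ 2 * (if P < (assigned n k c).length then 1 else 0) else 0).sum := by
              refine List.sum_le_sum fun c hc => ?_
              have h := hF c hc
              simp only [hg, mem_childrenOfLevel, hc, true_and]
              by_cases hP : P < (assigned n k c).length
              · by_cases hcc : c.2.1 ≠ 0 ∧ level n k (parent n k c) = i
                · simp only [hP, hcc, and_self, if_true, mul_one, sq, ne_eq, not_false_eq_true]
                  exact Nat.mul_le_mul_right _ h
                · rw [if_neg (fun h => hcc h.1)]; simp
              · simp [hP]
          _ = _ := by
              rw [childrenOfLevel, sum_map_filter_eq]
              simp only [decide_eq_true_eq]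
      refine (Nat.add_le_add h₃ key).trans ?_
      rw [← List.sum_map_add]
      refine List.sum_le_sum fun c _ => ?_
      rw [← mul_add]
      refine Nat.mul_le_mul_left _ ?_
      split_ifs <;> omega
  · rintro heard q m ⟨h₁, h₂, h₃⟩
    refine ⟨fun me c hc hme M hM hMB p j hj => h₁ me c hc hme M hM hMB p ?_ j hj, h₂,
      h₃.trans (List.sum_le_sum fun c _ => Nat.mul_le_mul_left _ (min_le_left _ _))⟩
    exact (List.getElem?_eq_some_iff.1 hj).1.trans_le (length_assigned_le_maxAssigned hc)

/-- The children, with a parent at level `i`, whose bits `me` has to learn. -/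
def toLearn (n : ℕ) (F : Node → Finset (Fin k)) (me : Fin k) (i : ℕ) : List Node :=
  (childrenOfLevel n k i).filter fun c => me ∈ F (parent n k c)

lemma mem_toLearn {me : Fin k} {i : ℕ} {c : Node} :
    c ∈ toLearn n F me i ↔ c ∈ childrenOfLevel n k i ∧ me ∈ F (parent n k c) := by
  simp [toLearn]

/-- The settling of all bits at the end of `convergeLevel`. -/
lemma spec_settle {s : ℕ} (hF : GoodCommittees n E.byz F s) (i N : ℕ)
    (res : Fin k → Fin n → Bool) (heard : Fin k → Node → Fin k → ℕ → Bool)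
    (hh : ∀ me, ∀ c ∈ toLearn n F me i, ∀ M ∈ F c, M ∉ E.byz →
        ∀ p j, (assigned n k c)[p]? = some j → heard me c M p = E.cloud (.inl j)) :
    Spec E (fun me => Prog.loop (weakResolveStep F me i (heard me)) N ⟨res me, fun _ => ∅⟩)
      N fun st q m =>
        (∀ me j, res me j = E.cloud (.inl j) → (st me).res j = E.cloud (.inl j)) ∧
        (∀ me, ∀ c ∈ toLearn n F me i, ∀ p < N, ∀ j, (assigned n k c)[p]? = some j →
          (st me).res j = E.cloud (.inl j)) ∧
        (∀ me, q me ≤ s * (toLearn n F me i).length) ∧ m = 0 := by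
  -- Queries are charged to blacklist entries: a query about a child adds at least one of its
  -- members to the blacklist. As only members are counted, the charge ends at `s` per child. Honest
  -- members are never listed, which keeps the undisputed values true.
  refine Spec.mono (Spec.loop_const _ 1 (mul_one _).symm
    (fun P (st : Fin k → ResolveState n k) q m =>
      (∀ me j, res me j = E.cloud (.inl j) → (st me).res j = E.cloud (.inl j)) ∧
      (∀ me, ∀ c ∈ toLearn n F me i, ∀ p < P, ∀ j, (assigned n k c)[p]? = some j →
        (st me).res j = E.cloud (.inl j)) ∧
      (∀ me, ∀ c ∈ toLearn n F me i, ∀ h ∈ F c, h ∉ E.byz → h ∉ (st me).black c) ∧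
      (∀ me, q me ≤ ((toLearn n F me i).map fun c => ((st me).black c ∩ F c).card).sum) ∧
      m = 0) ?_ ?_) ?_
  · simp
  · rintro p - st q m ⟨h₁, h₂, h₃, h₄, h₅⟩
    unfold weakResolveStep
    dsimp only
    refine Spec.bind_pure (Spec.mono (spec_cloudQuery _) ?_)
    rintro ans q' m' ⟨g₁, g₂, g₃⟩
    change ∀ me, ∀ j ∈ Finset.univ.filter (fun j => ∃ c ∈ toLearn n F me i,
      (assigned n k c)[p]? = some j ∧ _), _ at g₁
    change ∀ me, q' me = (Finset.univ.filter (fun j => ∃ c ∈ toLearn n F me i,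
      (assigned n k c)[p]? = some j ∧ _)).card at g₂
    have htl : ∀ me, ((childrenOfLevel n k i).filter fun c => me ∈ F (parent n k c)) =
      toLearn n F me i := fun _ => rfl
    simp only [htl]
    have hans : ∀ me, ∀ c ∈ toLearn n F me i, ∀ j, (assigned n k c)[p]? = some j →
        Disputed (F c \ (st me).black c) (fun M => heard me c M p) →
        ans me j = E.cloud (.inl j) := fun me c hc j hj hd =>
      g₁ me j (by
        simp only [Finset.mem_filter, Finset.mem_univ, true_and]
        exact ⟨c, hc, hj, hd⟩)
    have hf : ∀ me, ∀ c ∈ toLearn n F me i, ∀ r : Fin n → Bool,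
        ((assigned n k c)[p]? = none ∧ (match (assigned n k c)[p]? with
        | none => r
        | some j => Function.update r j
            (if Disputed (F c \ (st me).black c) (fun M => heard me c M p) then ans me j
              else agreed (F c \ (st me).black c) (fun M => heard me c M p))) = r) ∨
        ∃ j, (assigned n k c)[p]? = some j ∧ (match (assigned n k c)[p]? with
        | none => r
        | some j => Function.update r j
            (if Disputed (F c \ (st me).black c) (fun M => heard me c M p) then ans me j
              else agreed (F c \ (st me).black c) (fun M => heard me c M p))) =
            Function.update r j (E.cloud (.inl j)) := by
      intro me c hc r
      rcases hj : (assigned n k c)[p]? with _ | j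
      · exact Or.inl ⟨rfl, rfl⟩
      · refine Or.inr ⟨j, rfl, ?_⟩
        dsimp only
        split_ifs with hd
        · rw [hans me c hc j hj hd]
        · obtain ⟨h, hhF, hhB⟩ := hF.honest c (mem_childrenOfLevel.1 (mem_toLearn.1 hc).1).1
          rw [agreed_eq (h := h) (Finset.mem_sdiff.2 ⟨hhF, h₃ me c hc h hhF hhB⟩) hd,
            hh me c hc h hhF hhB p j hj]
    refine ⟨fun me j hj => ?_, fun me c hc p' hp' j hj => ?_, fun me c hc h hhF hhB => ?_,
      fun me => ?_, by rw [h₅, g₃]⟩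
    · exact foldl_update_eq (fun j => E.cloud (.inl j)) (fun c => (assigned n k c)[p]?) _ _
        (hf me) _ _ (Or.inl (h₁ me j hj))
    · refine foldl_update_eq (fun j => E.cloud (.inl j)) (fun c => (assigned n k c)[p]?) _ _
        (hf me) _ _ ?_
      rcases Nat.lt_succ_iff_lt_or_eq.1 hp' with hp' | rfl
      · exact Or.inl (h₂ me c hc p' hp' j hj)
      · exact Or.inr ⟨c, hc, hj⟩
    · rcases hj : (assigned n k c)[p]? with _ | j
      · exact h₃ me c hc h hhF hhB
      · dsimp only
        split_ifs with hd
        · rw [Finset.mem_union, not_or]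
          refine ⟨h₃ me c hc h hhF hhB, ?_⟩
          simp [hhF, hans me c hc j hj hd.2, hh me c hc h hhF hhB p j hj]
        · exact h₃ me c hc h hhF hhB
    · refine (Nat.add_le_add (h₄ me) ((g₂ me).trans_le (card_filter_exists_list_le _ _ _))).trans ?_
      rw [← List.sum_map_add]
      refine List.sum_le_sum fun c hc => ?_
      rcases hj : (assigned n k c)[p]? with _ | j
      · simp
      · simp only [Option.isSome_some, true_and, hc]
        split_ifs with hd
        · exact card_lt_card_blacklist hd _
        · simp
  · rintro st q m ⟨h₁, h₂, h₃, h₄, h₅⟩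
    refine ⟨h₁, h₂, fun me => (h₄ me).trans ?_, h₅⟩
    calc _ ≤ ((toLearn n F me i).map fun _ => s).sum := List.sum_le_sum fun c hc =>
          (Finset.card_le_card Finset.inter_subset_right).trans
            (hF.card_le c (mem_childrenOfLevel.1 (mem_toLearn.1 hc).1).1)
      _ = _ := by simp [mul_comm]

/-- The honest members of the nodes up to level `i` know the bits assigned to them. -/
def Informed (E : Env n k (Msg n)) (F : Node → Finset (Fin k)) (i : ℕ)
    (res : Fin k → Fin n → Bool) : Prop :=
  ∀ M ∉ E.byz, ∀ v ∈ forest n k, level n k v ≤ i → M ∈ F v → ∀ j ∈ assigned n k v,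
    res M j = E.cloud (.inl j)

/-- Children of nodes at level `i + 2` have level at most `i + 1`, so their honest members already
know the bits that they have to send. -/
lemma spec_convergeLevel {s : ℕ} (hF : GoodCommittees n E.byz F s) (hk : 0 < k) (hkn : k ≤ n)
    (i : ℕ) (res : Fin k → Fin n → Bool) (hres : Informed E F (i + 1) res) :
    Spec E (fun me => convergeLevel F me (i + 2) (res me))
      (maxAssigned n k (i + 2) * load n F + maxAssigned n k (i + 2)) fun res' q m =>
        Informed E F (i + 2) res' ∧
        (∀ me, q me ≤ s * (toLearn n F me (i + 2)).length) ∧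
        m ≤ ((childrenOfLevel n k (i + 2)).map fun c => s ^ 2 * (assigned n k c).length).sum := by
  unfold convergeLevel
  refine Spec.bind (spec_hear hF.card_le (i + 2) res) ?_
  rintro heard q m ⟨h₁, h₂, h₃⟩
  refine Spec.bind_pure (Spec.mono (spec_settle hF (i + 2) _ res heard ?_) ?_)
  · intro me c hc M hM hMB p j hj
    obtain ⟨hc₁, hc₂⟩ := mem_toLearn.1 hc
    obtain ⟨hc₃, hc₄, hc₅⟩ := mem_childrenOfLevel.1 hc₁
    rw [h₁ me c hc₁ hc₂ M hM hMB p j hj]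
    have := level_lt_level_parent hk hkn hc₃ hc₄
    exact hres M hMB c hc₃ (by omega) hM j (List.mem_of_getElem? hj)
  · rintro st q' m' ⟨g₁, g₂, g₃, g₄⟩
    refine ⟨fun M hM v hv hl hMv j hj => ?_, fun me => by simpa [h₂] using g₃ me, by omega⟩
    rcases Nat.lt_or_ge (level n k v) (i + 2) with hl' | hl'
    · exact g₁ M j (hres M hM v hv (by omega) hMv j hj)
    · obtain ⟨c, hc, hc₁, rfl, hjc⟩ := exists_child hk hkn hv (by omega) hj
      have hcl : c ∈ childrenOfLevel n k (i + 2) := mem_childrenOfLevel.2 ⟨hc, hc₁, by omega⟩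
      obtain ⟨p, hp⟩ := List.mem_iff_getElem?.1 hjc
      exact g₂ M c (mem_toLearn.2 ⟨hcl, hMv⟩) p ((List.getElem?_eq_some_iff.1 hp).1.trans_le
        (length_assigned_le_maxAssigned hcl)) j hp

lemma card_leaf_queries_le (hk : 0 < k) (hkn : k ≤ n) (me : Fin k) :
    (Finset.univ.filter fun j : Fin n =>
      ∃ v ∈ leaves n k, me ∈ F v ∧ j ∈ assigned n k v).card ≤ load n F * (n ⌈/⌉ k) := by
  set L := ((memberships n F me).toFinset.filter fun v => leavesBelow n k v.2.1 v.2.2 = 1)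
  calc _ ≤ (L.biUnion fun v => (assigned n k v).toFinset).card := by
        refine Finset.card_le_card fun j hj => ?_
        obtain ⟨-, v, hv, hme, hj⟩ := Finset.mem_filter.1 hj
        simp only [leaves, List.mem_filter, decide_eq_true_eq] at hv
        obtain ⟨hv, hl⟩ := hv
        refine Finset.mem_biUnion.2 ⟨v, ?_, by simpa using hj⟩
        simp only [L, Finset.mem_filter, List.mem_toFinset]
        exact ⟨mem_memberships.2 ⟨hv, hme⟩, hl⟩
    _ ≤ L.card * (n ⌈/⌉ k) := by
        refine Finset.card_biUnion_le_card_mul _ _ _ fun v hv => ?_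
        rw [List.toFinset_card_of_nodup (nodup_assigned v)]
        have := length_assigned_le_mul hk hkn v
        rwa [(Finset.mem_filter.1 hv).2, one_mul] at this
    _ ≤ _ := by
        refine Nat.mul_le_mul_right _ ?_
        refine (Finset.card_filter_le _ _).trans ((List.toFinset_card_le _).trans ?_)
        exact length_memberships_le me

/-- The queries come from the leaves to which a machine belongs, ⌈n/k⌉ for each, and from disputes,
`s` for each of its at most load · arity children. The loop starts at level 2, so `depth` iterations
reach the largest possible level `depth + 1`. -/
lemma spec_convergecast {s : ℕ} (hF : GoodCommittees n E.byz F s) (hk : 0 < k) (hkn : k ≤ n) :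
    Spec E (fun me => convergecast F me)
      (1 + ∑ i ∈ Finset.range (depth n k),
        (maxAssigned n k (i + 2) * load n F + maxAssigned n k (i + 2))) fun res q m =>
        (∀ M ∉ E.byz, ∀ v ∈ forest n k, M ∈ F v → ∀ j ∈ assigned n k v,
          res M j = E.cloud (.inl j)) ∧
        (∀ me, q me ≤ load n F * (n ⌈/⌉ k) + s * (load n F * arity n k)) ∧
        m ≤ s ^ 2 * (depth n k * n) := by
  unfold convergecast
  refine Spec.bind (spec_cloudQuery _) ?_
  rintro res q m ⟨h₁, h₂, h₃⟩
  refine Spec.mono (Spec.loop _ (fun i res q m => Informed E F (i + 1) res ∧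
    (∀ me, q me ≤ s * ∑ i' ∈ Finset.range i, (toLearn n F me (i' + 2)).length) ∧
    m ≤ s ^ 2 * ∑ i' ∈ Finset.range i,
      ((childrenOfLevel n k (i' + 2)).map fun c => (assigned n k c).length).sum) ?_ ?_) ?_
  · refine ⟨fun M hM v hv hl hMv j hj => h₁ M j ?_, by simp, by simp⟩
    simp only [Finset.mem_filter, Finset.mem_univ, true_and]
    exact ⟨v, mem_leaves_of_level_le_one hk hkn hv hl, hMv, hj⟩
  · rintro i - res q m ⟨g₁, g₂, g₃⟩
    refine Spec.mono (spec_convergeLevel hF hk hkn i res g₁) ?_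
    rintro res' q' m' ⟨f₁, f₂, f₃⟩
    refine ⟨f₁, fun me => ?_, ?_⟩
    · rw [Finset.sum_range_succ, mul_add]
      exact Nat.add_le_add (g₂ me) (f₂ me)
    · rw [Finset.sum_range_succ, mul_add]
      refine Nat.add_le_add g₃ (f₃.trans_eq ?_)
      rw [List.sum_map_mul_left]
  · rintro res q' m' ⟨g₁, g₂, g₃⟩
    refine ⟨fun M hM v hv hMv j hj => g₁ M hM v hv (level_le hv) hMv j hj, fun me => ?_, ?_⟩
    · refine Nat.add_le_add ((h₂ me).trans_le (card_leaf_queries_le hk hkn me))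
        ((g₂ me).trans (Nat.mul_le_mul_left _ ?_))
      have := sum_childrenOfLevel_le (n := n) (k := k) (fun _ => 1)
        (fun c => me ∈ F (parent n k c)) (depth n k)
      simp only [List.map_const', List.sum_replicate, smul_eq_mul, mul_one, Finset.sum_const] at this
      exact this.trans (card_children_le me)
    · rw [h₃, zero_add]
      refine g₃.trans (Nat.mul_le_mul_left _ ?_)
      have := sum_childrenOfLevel_le (n := n) (k := k) (fun c => (assigned n k c).length)
        (fun _ => True) (depth n k)
      simp only [decide_true, List.filter_true, and_true] at this
      exact this.trans (sum_length_assigned_le hk hkn)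

end Convergecast

/-! ### Weak parity resolution -/

section Parity

variable {n k : ℕ} {E : Env n k (Msg n)} {F : Node → Finset (Fin k)}

lemma xorRange_congr {x y : Fin n → Bool} {K : List (Fin n)} (h : ∀ j ∈ K, x j = y j) (l r : ℕ) :
    xorRange x K l r = xorRange y K l r := by
  unfold xorRange
  have : ∀ j ∈ (K.take r).drop l, x j = y j := fun j hj =>
    h j (List.mem_of_mem_take (List.mem_of_mem_drop hj))
  generalize (K.take r).drop l = L at this
  induction L with
  | nil => rfl
  | cons a L ih =>
    rw [List.foldr_cons, List.foldr_cons, this a (by simp), ih fun j hj => this j (by simp [hj])]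

lemma foldr_xor_append (x : Fin n → Bool) (K L : List (Fin n)) :
    (K ++ L).foldr (fun j acc => xor (x j) acc) false =
      xor (K.foldr (fun j acc => xor (x j) acc) false)
        (L.foldr (fun j acc => xor (x j) acc) false) := by
  induction K with
  | nil => simp
  | cons a K ih => simp [ih]

lemma xorRange_add (x : Fin n → Bool) (K : List (Fin n)) {l m r : ℕ} (h₁ : l ≤ m) (h₂ : m ≤ r) :
    xor (xorRange x K l m) (xorRange x K m r) = xorRange x K l r := by
  unfold xorRange
  rw [← foldr_xor_append]
  congr 1
  simp only [List.drop_take]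
  obtain ⟨a, rfl⟩ := Nat.exists_eq_add_of_le h₁
  obtain ⟨b, rfl⟩ := Nat.exists_eq_add_of_le h₂
  rw [show l + a - l = a by omega, show l + a + b - (l + a) = b by omega,
    show l + a + b - l = a + b by omega, List.take_add, List.drop_drop]

lemma xorRange_single (x : Fin n → Bool) {K : List (Fin n)} {l : ℕ} {j : Fin n}
    (h : K[l]? = some j) : xorRange x K l (l + 1) = x j := by
  have : (K.take (l + 1)).drop l = [j] := by
    rw [List.drop_take, show l + 1 - l = 1 by omega]
    obtain ⟨h₁, rfl⟩ := List.getElem?_eq_some_iff.1 h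
    rw [List.drop_eq_getElem_cons h₁, List.take_succ_cons, List.take_zero]
  simp [xorRange, this]

/-- This links the exclusive or, additive over ranges, with the parity of a count in which the
problem is posed. -/
lemma foldr_xor_eq_decide (x : Fin n → Bool) (K : List (Fin n)) :
    K.foldr (fun j acc => xor (x j) acc) false = decide (Odd (K.filter x).length) := by
  induction K with
  | nil => simp
  | cons a K ih =>
    rw [List.foldr_cons, ih, List.filter_cons]
    by_cases h : x a <;> simp [h, Nat.odd_add_one, -Nat.not_odd_iff_even]

lemma xorRange_full (x : Fin n → Bool) (K : List (Fin n)) :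
    xorRange x K 0 K.length = decide (Odd (K.filter x).length) := by
  simp [xorRange, foldr_xor_eq_decide]

/-- The indices assigned to the roots partition the input. -/
lemma parity_eq_roots (hk : 0 < k) (hkn : k ≤ n) (x : Fin n → Bool) (p : Node → Bool)
    (hp : ∀ v ∈ roots n k, p v = xorRange x (assigned n k v) 0 (assigned n k v).length) :
    decide (Odd ((roots n k).filter fun v => p v).length) = parity x := by
  have hn := hk.trans_le hkn
  have ht := treeCount_pos hk hkn
  let f : ℕ → ℕ := fun τ => ((Finset.univ.filter fun j => x j = true).filter fun j : Fin n =>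
    (j : ℕ) * treeCount n k / n = τ).card
  have h₁ : ∀ τ < treeCount n k, (p (τ, 0, 0) = true ↔ Odd (f τ)) := by
    intro τ hτ
    rw [hp _ (mem_roots.2 ⟨τ, hτ, rfl⟩), xorRange_full, decide_eq_true_eq]
    have : ((assigned n k (τ, 0, 0)).filter x).length = f τ := by
      rw [← List.toFinset_card_of_nodup ((nodup_assigned _).filter _)]
      congr 1
      ext j
      simp only [List.mem_toFinset, List.mem_filter, mem_assigned_root hk hkn,
        Finset.mem_filter, Finset.mem_univ, true_and]
      tauto
    rw [this]
  have h₂ : ((roots n k).filter fun v => p v).length =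
      ((Finset.range (treeCount n k)).filter fun τ => Odd (f τ)).card := by
    rw [((roots_perm (n := n) (k := k)).filter _).length_eq, List.filter_map, List.length_map,
      ← List.toFinset_card_of_nodup (List.nodup_range.filter _)]
    congr 1
    ext τ
    simp only [List.mem_toFinset, List.mem_filter, List.mem_range, Finset.mem_filter,
      Finset.mem_range, Function.comp]
    constructor
    · rintro ⟨a, b⟩; exact ⟨a, (h₁ τ a).1 b⟩
    · rintro ⟨a, b⟩; exact ⟨a, (h₁ τ a).2 b⟩
  have h₃ : (Finset.univ.filter fun j => x j = true).card =
      ∑ τ ∈ Finset.range (treeCount n k), f τ :=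
    Finset.card_eq_sum_card_fiberwise fun j _ => by
      have hj : (j : ℕ) * treeCount n k < n * treeCount n k :=
        Nat.mul_lt_mul_of_pos_right j.2 ht
      simpa using Nat.div_lt_of_lt_mul hj
  unfold parity
  rw [h₂, h₃]
  congr 1
  -- A sum is odd iff the number of its odd terms is odd.
  rw [Finset.odd_sum_iff_odd_card_odd]

lemma sum_memberships_roots_le {s : ℕ} (hF : ∀ v ∈ forest n k, (F v).card ≤ s) (c : ℕ) :
    ∑ M, ((memberships n F M).map fun v => if v ∈ roots n k then c else 0).sum ≤
      c * (s * treeCount n k) := by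
  rw [sum_memberships]
  calc _ ≤ ((forest n k).map fun v => if v.2.1 = 0 then s * c else 0).sum := by
        refine List.sum_le_sum fun v hv => ?_
        simp only [roots, List.mem_filter, hv, true_and, decide_eq_true_eq]
        split_ifs
        · exact Nat.mul_le_mul_right _ (hF v hv)
        · simp
    _ = ((roots n k).map fun _ => s * c).sum := by
        rw [roots, sum_map_filter_eq]
        simp only [decide_eq_true_eq]
    _ = _ := by
        simp only [List.map_const', List.sum_replicate, length_roots, smul_eq_mul]
        ring

/-- Correct answers are asserted for honest askers only, since the question that a member receives
from a Byzantine machine is arbitrary. -/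
lemma spec_askXor {s : ℕ} (hF : ∀ v ∈ forest n k, (F v).card ≤ s) (res : Fin k → Fin n → Bool)
    (black : Fin k → Node → Finset (Fin k)) (want : Fin k → Node → Option (ℕ × ℕ)) :
    Spec E (fun me => askXor F me (res me) (black me) (want me)) (load n F + load n F)
      fun ans q m =>
        (∀ me ∉ E.byz, ∀ v ∈ roots n k, ∀ M ∈ F v \ black me v, M ∉ E.byz → ∀ l r, l ≤ n → r ≤ n →
          want me v = some (l, r) → ans me v M = xorRange (res M) (assigned n k v) l r) ∧
        (∀ me, q me = 0) ∧ m ≤ 2 * (k * (s * treeCount n k)) := by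
  unfold askXor
  refine Spec.bind (spec_sendToMembers _) ?_
  rintro asked q m ⟨h₁, h₂, h₃⟩
  refine Spec.bind_pure (Spec.mono (spec_sendAsMember _) ?_)
  rintro replies q' m' ⟨g₁, g₂, g₃⟩
  refine ⟨fun me hme v hv M hM hMB l r hl hr hw => ?_, fun me => by simp [h₂, g₂], ?_⟩
  · have hvf : v ∈ forest n k := (List.mem_filter.1 hv).1
    have hMF := (Finset.mem_sdiff.1 hM).1
    dsimp only
    rw [g₁ me M hMB v hvf hMF, if_pos hv, h₁ M me hme v hvf hMF, if_pos ⟨hv, hM⟩, hw]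
    simp only [Option.map_some, Msg.bit, Fin.val_ofNat]
    -- The ends of a range are at most `n`, so encoding them in `Fin (n + 1)` loses nothing.
    rw [Nat.mod_eq_of_lt (by omega), Nat.mod_eq_of_lt (by omega)]
  · rw [two_mul]
    refine Nat.add_le_add ?_ ?_
    · rw [h₃]
      calc _ ≤ ∑ i ∈ E.byzᶜ, ∑ j, ((memberships n F j).map fun v =>
              if v ∈ roots n k then 1 else 0).sum := by
            refine Finset.sum_le_sum fun i _ => Finset.sum_le_sum fun j _ =>
              List.sum_le_sum fun v _ => ?_
            by_cases hv : v ∈ roots n k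
            · simp only [hv, if_true]; split_ifs <;> simp
            · simp [hv]
        _ ≤ ∑ i ∈ E.byzᶜ, (s * treeCount n k) := Finset.sum_le_sum fun i _ => by
            simpa using sum_memberships_roots_le hF 1
        _ ≤ _ := by
            rw [Finset.sum_const, smul_eq_mul]
            exact Nat.mul_le_mul_right _ ((Finset.card_le_univ _).trans_eq (by simp))
    · rw [g₃]
      calc _ ≤ ∑ i ∈ E.byzᶜ, ((memberships n F i).map fun v =>
              if v ∈ roots n k then k else 0).sum := by
            refine Finset.sum_le_sum fun i _ => List.sum_le_sum fun v _ => ?_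
            by_cases hv : v ∈ roots n k
            · simp only [hv, if_true]
              exact (Finset.card_le_univ _).trans_eq (by simp)
            · simp [hv]
        _ ≤ _ := (Finset.sum_le_sum_of_subset (Finset.subset_univ _)).trans
            (sum_memberships_roots_le hF k)

/-- The honest members of the roots know the bits assigned to them. -/
def RootsInformed (E : Env n k (Msg n)) (F : Node → Finset (Fin k))
    (res : Fin k → Fin n → Bool) : Prop :=
  ∀ M ∉ E.byz, ∀ v ∈ roots n k, M ∈ F v → ∀ j ∈ assigned n k v, res M j = E.cloud (.inl j)

/-- The parity of a range of the indices assigned to `v`. -/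
def trueXor (E : Env n k (Msg n)) (v : Node) (l r : ℕ) : Bool :=
  xorRange (fun j => E.cloud (.inl j)) (assigned n k v) l r

/-- `lo, …, hi - 1` is a range of the indices assigned to `v` on whose parity the machines of `S`
disagree, the honest ones being right. -/
structure DisputedRange (E : Env n k (Msg n)) (S : Finset (Fin k)) (v : Node) (lo hi : ℕ)
    (claim : Fin k → Bool) : Prop where
  lt : lo < hi
  le : hi ≤ (assigned n k v).length
  disputed : Disputed S claim
  honest : ∀ M ∈ S, M ∉ E.byz → claim M = trueXor E v lo hi

lemma DisputedRange.left {S : Finset (Fin k)} {v : Node} {lo mid hi : ℕ} {claim ans : Fin k → Bool}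
    (h : DisputedRange E S v lo hi claim) (h₁ : lo < mid) (h₂ : mid < hi)
    (ha : ∀ M ∈ S, M ∉ E.byz → ans M = trueXor E v lo mid) (hd : Disputed S ans) :
    DisputedRange E S v lo mid ans :=
  ⟨h₁, h₂.le.trans h.le, hd, ha⟩

/-- Agreement on the left half means that the same bit is added to all claims, so the disagreement
about the whole range passes to the right half. Honest claims remain true by additivity. -/
lemma DisputedRange.right {S : Finset (Fin k)} {v : Node} {lo mid hi : ℕ}
    {claim ans : Fin k → Bool} (h : DisputedRange E S v lo hi claim) (h₁ : lo < mid)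
    (h₂ : mid < hi) (ha : ∀ M ∈ S, M ∉ E.byz → ans M = trueXor E v lo mid)
    (hd : ¬ Disputed S ans) :
    DisputedRange E S v mid hi fun M => xor (claim M) (ans M) := by
  refine ⟨h₂, h.le, ?_, fun M hM hMB => ?_⟩
  · obtain ⟨i, hi, j, hj, hij⟩ := h.disputed
    refine ⟨i, hi, j, hj, fun he => hij ?_⟩
    have : ans i = ans j := by
      by_contra hne
      exact hd ⟨i, hi, j, hj, hne⟩
    dsimp only at he
    rw [this] at he
    exact Bool.xor_left_inj.1 he
  · rw [ha M hM hMB, h.honest M hM hMB, trueXor, trueXor, trueXor,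
      ← xorRange_add _ _ h₁.le h₂.le, Bool.xor_comm, ← Bool.xor_assoc, Bool.xor_self,
      Bool.false_xor]

/-- The midpoint is rounded up, so each half of a range of length at most 2^(e+1) has length at most
2^e and, if the range has two elements or more, neither half is empty. A range with one element
stays as it is. -/
lemma spec_searchStep {s : ℕ} (hF : ∀ v ∈ forest n k, (F v).card ≤ s)
    {res : Fin k → Fin n → Bool} (hres : RootsInformed E F res)
    (black : Fin k → Node → Finset (Fin k)) (active : Fin k → Node → Bool)
    (st : Fin k → SearchState k) (e : ℕ)
    (hst : ∀ me ∉ E.byz, ∀ v ∈ roots n k, active me v = true →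
      DisputedRange E (F v \ black me v) v ((st me).lo v) ((st me).hi v) ((st me).claim v) ∧
      (st me).hi v ≤ (st me).lo v + 2 ^ (e + 1)) :
    Spec E (fun me => searchStep F me (res me) (black me) (active me) (st me))
      (load n F + load n F) fun st' q m =>
        (∀ me ∉ E.byz, ∀ v ∈ roots n k, active me v = true →
          DisputedRange E (F v \ black me v) v ((st' me).lo v) ((st' me).hi v)
            ((st' me).claim v) ∧ (st' me).hi v ≤ (st' me).lo v + 2 ^ e) ∧
        (∀ me, q me = 0) ∧ m ≤ 2 * (k * (s * treeCount n k)) := by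
  unfold searchStep
  dsimp only
  refine Spec.bind_pure (Spec.mono (spec_askXor hF res black _) ?_)
  rintro ans q m ⟨h₁, h₂, h₃⟩
  refine ⟨fun me hme v hv hact => ?_, h₂, h₃⟩
  obtain ⟨g₁, g₂⟩ := hst me hme v hv hact
  have hlen := length_assigned_le (n := n) (k := k) v
  have glt := g₁.lt
  have gle := g₁.le
  dsimp only
  rw [pow_succ] at g₂
  by_cases hgo : (st me).lo v + 1 < (st me).hi v
  · have hgoing : (active me v && decide ((st me).lo v + 1 < (st me).hi v)) = true := by
      simp [hact, hgo]
    have hans : ∀ M ∈ F v \ black me v, M ∉ E.byz →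
        ans me v M = trueXor E v ((st me).lo v) (((st me).lo v + (st me).hi v + 1) / 2) := by
      intro M hM hMB
      rw [h₁ me hme v hv M hM hMB ((st me).lo v) (((st me).lo v + (st me).hi v + 1) / 2)
        (by omega) (by omega) (by rw [if_pos hgoing])]
      exact xorRange_congr (hres M hMB v hv (Finset.mem_sdiff.1 hM).1) _ _
    by_cases hd : Disputed (F v \ black me v) (ans me v)
    · simp only [hgoing, hd, not_true_eq_false, and_false, and_self, if_true, if_false]
      exact ⟨g₁.left (by omega) (by omega) hans hd, by omega⟩
    · simp only [hgoing, hd, not_false_eq_true, and_false, and_self, if_true, if_false]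
      exact ⟨g₁.right (by omega) (by omega) hans hd, by omega⟩
  · have hgoing : ¬ (active me v && decide ((st me).lo v + 1 < (st me).hi v)) = true := by
      simp [hgo]
    simp only [hgoing, Bool.false_eq_true, false_and, if_false]
    have := Nat.one_le_two_pow (n := e)
    exact ⟨g₁, by omega⟩

lemma spec_blacklistStep {s : ℕ} (hk : 0 < k) (hkn : k ≤ n)
    (hF : ∀ v ∈ forest n k, (F v).card ≤ s)
    {res : Fin k → Fin n → Bool} (hres : RootsInformed E F res)
    {top : Fin k → Node → Fin k → Bool}
    (htop : ∀ me ∉ E.byz, ∀ v ∈ roots n k, ∀ M ∈ F v, M ∉ E.byz →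
      top me v M = trueXor E v 0 (assigned n k v).length)
    (black : Fin k → Node → Finset (Fin k)) :
    Spec E (fun me => blacklistStep F me (res me) (top me) (black me))
      (Nat.clog 2 n * (load n F + load n F) + 1) fun black' q m =>
        (∀ me ∉ E.byz, ∀ v ∈ roots n k,
          (∀ h ∈ F v, h ∉ E.byz → h ∉ black me v → h ∉ black' me v) ∧
          (¬ Disputed (F v \ black me v) (top me v) → black' me v = black me v) ∧
          (Disputed (F v \ black me v) (top me v) →
            (black me v ∩ F v).card < (black' me v ∩ F v).card)) ∧
        (∀ me, q me ≤ treeCount n k) ∧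
        m ≤ Nat.clog 2 n * (2 * (k * (s * treeCount n k))) := by
  unfold blacklistStep
  dsimp only
  -- The range starts with length at most n ≤ 2^(clog n) and has length at most 2^(clog n - i) after
  -- `i` halvings.
  refine Spec.bind (Spec.loop_const (Nat.clog 2 n) _ rfl
    (fun i (st : Fin k → SearchState k) q m =>
      (∀ me ∉ E.byz, ∀ v ∈ roots n k,
        decide (Disputed (F v \ black me v) (top me v)) = true →
        DisputedRange E (F v \ black me v) v ((st me).lo v) ((st me).hi v) ((st me).claim v) ∧
        (st me).hi v ≤ (st me).lo v + 2 ^ (Nat.clog 2 n - i)) ∧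
      (∀ me, q me = 0) ∧ m ≤ i * (2 * (k * (s * treeCount n k)))) ?_ ?_) ?_
  · refine ⟨fun me hme v hv hact => ⟨⟨assigned_root_pos hk hkn hv, le_rfl, by simpa using hact,
      fun M hM hMB => htop me hme v hv M (Finset.mem_sdiff.1 hM).1 hMB⟩, ?_⟩, by simp, by simp⟩
    have := Nat.le_pow_clog (b := 2) (by omega) n
    have := length_assigned_le (n := n) (k := k) v
    dsimp only
    simp only [Nat.sub_zero]
    omega
  · rintro i hi st q m ⟨h₁, h₂, h₃⟩
    refine Spec.mono (spec_searchStep hF hres black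
      (fun me v => decide (Disputed (F v \ black me v) (top me v))) st (Nat.clog 2 n - (i + 1))
      (by rwa [show Nat.clog 2 n - (i + 1) + 1 = Nat.clog 2 n - i by omega])) ?_
    rintro st' q' m' ⟨g₁, g₂, g₃⟩
    refine ⟨g₁, fun me => by simp [h₂, g₂], ?_⟩
    rw [Nat.succ_mul]
    omega
  · rintro st q m ⟨h₁, h₂, h₃⟩
    refine Spec.bind_pure (Spec.mono (spec_cloudQuery _) ?_)
    rintro ans q' m' ⟨g₁, g₂, g₃⟩
    refine ⟨fun me hme v hv => ?_, fun me => ?_, by rw [g₃]; exact h₃⟩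
    · dsimp only
      by_cases hd : Disputed (F v \ black me v) (top me v)
      · obtain ⟨f₁, f₂⟩ := h₁ me hme v hv (decide_eq_true hd)
        have flt := f₁.lt
        have fle := f₁.le
        -- The range is now a single index, the claims about it still differ, and whoever
        -- contradicts the cloud has lied.
        rw [Nat.sub_self, pow_zero] at f₂
        have hj : (assigned n k v)[(st me).lo v]? =
          some (assigned n k v)[(st me).lo v] := List.getElem?_eq_getElem (by omega)
        generalize (assigned n k v)[(st me).lo v] = j at hj
        have hans : ans me j = E.cloud (.inl j) := g₁ me j (by
          simp only [Finset.mem_filter, Finset.mem_univ, true_and]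
          exact ⟨v, hv, decide_eq_true hd, hj⟩)
        have hhi : (st me).hi v = (st me).lo v + 1 := by omega
        simp only [hj, hv, hd, decide_true, and_self, if_true, not_true_eq_false, false_imp_iff,
          true_and, true_imp_iff]
        refine ⟨fun h hhF hhB hhb => ?_, card_lt_card_blacklist f₁.disputed _⟩
        rw [Finset.mem_union, not_or]
        refine ⟨hhb, ?_⟩
        have := f₁.honest h (Finset.mem_sdiff.2 ⟨hhF, hhb⟩) hhB
        rw [hhi, trueXor, xorRange_single _ hj] at this
        simp [hhF, this, hans]
      · simp only [hd, decide_false, Bool.false_eq_true, and_false, if_false, false_imp_iff,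
          not_false_eq_true, true_imp_iff, and_true]
        split <;> simp
    · dsimp only
      rw [h₂, zero_add, g₂]
      -- Dropping the condition that the root is active leaves at most one isolated index per root.
      have h : ∀ j : Fin n, (∃ v ∈ roots n k, decide (Disputed (F v \ black me v) (top me v)) = true ∧
          (assigned n k v)[(st me).lo v]? = some j) → ∃ v ∈ roots n k,
          (assigned n k v)[(st me).lo v]? = some j ∧ True := fun j ⟨v, h₁, _, h₂⟩ =>
        ⟨v, h₁, h₂, trivial⟩
      refine (Finset.card_le_card (Finset.monotone_filter_right _ fun j _ => h j)).trans
        ((card_filter_exists_list_le _ _ _).trans ?_)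
      calc _ ≤ ((roots n k).map fun _ => 1).sum := List.sum_le_sum fun v _ => by
            split_ifs <;> simp
        _ = _ := by simp [length_roots]

lemma spec_weakParityResolve {s : ℕ} (hk : 0 < k) (hkn : k ≤ n)
    (hF : GoodCommittees n E.byz F s) {res : Fin k → Fin n → Bool}
    (hres : RootsInformed E F res) :
    Spec E (fun me => weakParityResolve F s me (res me))
      (load n F + load n F + s * (Nat.clog 2 n * (load n F + load n F) + 1)) fun out q m =>
        (∀ me ∉ E.byz, out me = parity fun j => E.cloud (.inl j)) ∧
        (∀ me, q me ≤ s * treeCount n k) ∧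
        m ≤ (1 + s * Nat.clog 2 n) * (2 * (k * (s * treeCount n k))) := by
  unfold weakParityResolve
  refine Spec.bind (spec_askXor hF.card_le res _ _) ?_
  rintro top q m ⟨h₁, h₂, h₃⟩
  have htop : ∀ me ∉ E.byz, ∀ v ∈ roots n k, ∀ M ∈ F v, M ∉ E.byz →
      top me v M = trueXor E v 0 (assigned n k v).length := by
    intro me hme v hv M hM hMB
    rw [h₁ me hme v hv M (by simpa using hM) hMB 0 (assigned n k v).length (by omega)
      (length_assigned_le v) rfl]
    exact xorRange_congr (hres M hMB v hv hM) _ _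
  -- The second part of the invariant says that a dispute still open after `i` iterations has cost
  -- at least `i` members their credibility; roots without a dispute are left unchanged.
  refine Spec.bind_pure (Spec.mono (Spec.loop_const s _ rfl
    (fun i (black : Fin k → Node → Finset (Fin k)) q m =>
      (∀ me ∉ E.byz, ∀ v ∈ roots n k, (∀ h ∈ F v, h ∉ E.byz → h ∉ black me v) ∧
        (Disputed (F v \ black me v) (top me v) → i ≤ (black me v ∩ F v).card)) ∧
      (∀ me, q me ≤ i * treeCount n k) ∧
      m ≤ i * (Nat.clog 2 n * (2 * (k * (s * treeCount n k))))) ?_ ?_) ?_)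
  · simp
  · rintro i hi black q m ⟨g₁, g₂, g₃⟩
    refine Spec.mono (spec_blacklistStep hk hkn hF.card_le hres htop black) ?_
    rintro black' q' m' ⟨f₁, f₂, f₃⟩
    refine ⟨fun me hme v hv => ?_, fun me => ?_, ?_⟩
    · obtain ⟨a₁, a₂⟩ := g₁ me hme v hv
      obtain ⟨b₁, b₂, b₃⟩ := f₁ me hme v hv
      refine ⟨fun h hhF hhB => b₁ h hhF hhB (a₁ h hhF hhB), fun hd => ?_⟩
      by_cases hd' : Disputed (F v \ black me v) (top me v)
      · exact (a₂ hd').trans_lt (b₃ hd')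
      · rw [b₂ hd'] at hd
        exact absurd hd hd'
    · rw [Nat.succ_mul]; exact Nat.add_le_add (g₂ me) (f₂ me)
    · rw [Nat.succ_mul]; exact Nat.add_le_add g₃ f₃
  · rintro black q' m' ⟨g₁, g₂, g₃⟩
    refine ⟨fun me hme => ?_, fun me => by simpa [h₂] using g₂ me, ?_⟩
    · refine parity_eq_roots hk hkn _ _ fun v hv => ?_
      have hvf : v ∈ forest n k := (List.mem_filter.1 hv).1
      obtain ⟨h, hhF, hhB⟩ := hF.honest v hvf
      obtain ⟨a₁, a₂⟩ := g₁ me hme v hv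
      have hh : h ∈ F v \ black me v := Finset.mem_sdiff.2 ⟨hhF, a₁ h hhF hhB⟩
      rw [agreed_eq hh, htop me hme v hv h hhF hhB]
      · rfl
      · intro hd
        -- A dispute after `s` iterations would mean that all members, hence also the honest `h`,
        -- are blacklisted.
        have h₄ := (hF.card_le v hvf).trans (a₂ hd)
        have h₅ := Finset.eq_of_subset_of_card_le Finset.inter_subset_right h₄
        have h₆ : h ∈ black me v ∩ F v := by rwa [h₅]
        exact a₁ h hhF hhB (Finset.mem_inter.1 h₆).1
    · calc _ ≤ _ := Nat.add_le_add h₃ g₃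
        _ = _ := by ring

end Parity

/-! ### The whole algorithm for given random bits -/

section Run

variable {n k b : ℕ}

lemma wordLength_pos : 0 < wordLength n k := lt_max_of_lt_left one_pos

lemma finrank_field {m : ℕ} (hm : 0 < m) : Module.finrank (ZMod 2) (GaloisField 2 m) = m :=
  GaloisField.finrank 2 hm.ne'

lemma wordToField_congr {m : ℕ} (hm : 0 < m) {w w' : ℕ → Bool} (h : ∀ i < m, w i = w' i) :
    wordToField m w = wordToField m w' := by
  unfold wordToField
  refine Finset.sum_congr rfl fun i _ => ?_
  rw [h i (i.2.trans_eq (finrank_field hm))]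

lemma hash_congr {s m : ℕ} (hm : 0 < m) {w w' : ℕ → Bool} (h : ∀ i < s * m, w i = w' i) (i : ℕ) :
    hash s m w i = hash s m w' i := by
  unfold hash
  congr 1
  refine Finset.sum_congr rfl fun c hc => ?_
  congr 1
  refine wordToField_congr hm fun e he => h _ ?_
  have := Nat.mul_le_mul_right m (Nat.succ_le_of_lt (Finset.mem_range.1 hc))
  rw [Nat.succ_mul] at this
  omega

/-- A machine has read only the first `seedLength` random bits; this identifies the committees it
computes with those determined by all coins. -/
lemma committee_congr {r r' : ℕ → Bool} (h : ∀ s < seedLength n k b, r s = r' s) :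
    committee n k b r = committee n k b r' := by
  funext v
  unfold committee
  refine Finset.filter_congr fun M _ => exists_congr fun u => and_congr_right fun hu => ?_
  rw [hash_congr wordLength_pos fun i hi => h _ ?_]
  have := Nat.mul_le_mul_right (committeeSize n k b * wordLength n k) (Nat.succ_le_of_lt hu)
  rw [Nat.succ_mul] at this
  unfold seedLength
  rw [mul_assoc]
  omega

lemma card_committee_le (rand : ℕ → Bool) (v : Node) :
    (committee n k b rand v).card ≤ committeeSize n k b := by
  have hsub : (committee n k b rand v).image (fun M : Fin k => (M : ℕ)) ⊆
      (Finset.range (committeeSize n k b)).image fun u =>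
        hash (committeeSize n k b) (wordLength n k)
          (fun e => rand (u * (committeeSize n k b * wordLength n k) + e))
          ((forest n k).idxOf v) % k := by
    intro y hy
    obtain ⟨M, hM, rfl⟩ := Finset.mem_image.1 hy
    obtain ⟨-, u, hu, h⟩ := Finset.mem_filter.1 hM
    exact Finset.mem_image.2 ⟨u, Finset.mem_range.2 hu, h⟩
  have h := (Finset.card_le_card hsub).trans Finset.card_image_le
  rwa [Finset.card_image_of_injective _ Fin.val_injective, Finset.card_range] at h

variable {E : Env n k (Msg n)}

/-- After `N` batches exactly the seed positions below n·N have been read; the batches are disjoint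
and have at most `n` elements. -/
lemma spec_electPublic (hn : 0 < n) :
    Spec E (fun _ => electPublic n k b) (seedLength n k b ⌈/⌉ n) fun F q m =>
      (∀ me, F me = committee n k b fun s => E.cloud (.inr s)) ∧
      (∀ me, q me ≤ seedLength n k b) ∧ m = 0 := by
  unfold electPublic
  refine Spec.bind_pure (Spec.mono (Spec.loop_const _ 1 (mul_one _).symm
    (fun N (rand : Fin k → ℕ → Bool) q m =>
      (∀ me, ∀ s < seedLength n k b, s < n * N → rand me s = E.cloud (.inr s)) ∧
      (∀ me, q me ≤ ((Finset.range (seedLength n k b)).filter fun s => s < n * N).card) ∧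
      m = 0) ?_ ?_) ?_)
  · simp
  · rintro N - rand q m ⟨h₁, h₂, h₃⟩
    refine Spec.bind_pure (Spec.mono (spec_cloudRG _ fun _ => ?_) ?_)
    · calc _ ≤ (Finset.Ico (n * N) (n * (N + 1))).card := Finset.card_le_card fun s hs => by
            simpa using (Finset.mem_filter.1 hs).2
        _ = n := by simp [mul_add]
    · rintro ans q' m' ⟨g₁, g₂, g₃⟩
      refine ⟨fun me s hs hsN => ?_, fun me => ?_, by rw [h₃, g₃]⟩
      · dsimp only
        split_ifs with hb
        · exact g₁ me s hb
        · refine h₁ me s hs ?_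
          by_contra hlt
          exact hb (by simp [hs, hsN]; omega)
      · refine (Nat.add_le_add (h₂ me) (g₂ me).le).trans ?_
        rw [← Finset.card_union_of_disjoint]
        · refine Finset.card_le_card fun s hs => ?_
          have : n * N ≤ n * (N + 1) := Nat.mul_le_mul_left _ (by omega)
          simp only [Finset.mem_union, Finset.mem_filter, Finset.mem_range] at hs ⊢
          omega
        · refine Finset.disjoint_left.2 fun s hs hs' => ?_
          simp only [Finset.mem_filter] at hs hs'
          omega
  · rintro rand q m ⟨h₁, h₂, h₃⟩
    refine ⟨fun me => committee_congr fun s hs => h₁ me s hs ?_, fun me => (h₂ me).trans ?_, h₃⟩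
    · have := le_ceilDiv_mul (seedLength n k b) hn
      rw [mul_comm]
      omega
    · exact (Finset.card_filter_le _ _).trans (by simp)

/-- The number of rounds of the convergecast. -/
def convergecastRounds {k : ℕ} (n : ℕ) (F : Node → Finset (Fin k)) : ℕ :=
  1 + ∑ i ∈ Finset.range (depth n k),
    (maxAssigned n k (i + 2) * load n F + maxAssigned n k (i + 2))

/-- The number of rounds of the weak parity resolution. -/
def resolveRounds {k : ℕ} (n : ℕ) (F : Node → Finset (Fin k)) (s : ℕ) : ℕ :=
  load n F + load n F + s * (Nat.clog 2 n * (load n F + load n F) + 1)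

theorem convergeParityRun_of_honest (hk : 0 < k) (hkn : k ≤ n) (x : Fin n → Bool)
    (B : Finset (Fin k)) (adv : (ℕ → Bool) → ℕ → Fin k → Fin k → Option (Msg n)) (ω : ℕ → Bool)
    (hB : ∀ v ∈ forest n k, ∃ h ∈ committee n k b ω v, h ∉ B) :
    ∃ T, T = seedLength n k b ⌈/⌉ n + (convergecastRounds n (committee n k b ω) +
        resolveRounds n (committee n k b ω) (committeeSize n k b)) ∧
      (convergeParityRun n k b x B adv ω).HonestOutput T (parity x) ∧
      (∀ t i, (convergeParityRun n k b x B adv ω).queriesInRound t i ≤ n) ∧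
      (∀ i, (convergeParityRun n k b x B adv ω).queryCount T i ≤ seedLength n k b +
        (load n (committee n k b ω) * (n ⌈/⌉ k) +
          committeeSize n k b * (load n (committee n k b ω) * arity n k) +
            committeeSize n k b * treeCount n k)) ∧
      (convergeParityRun n k b x B adv ω).messageCount T ≤
        committeeSize n k b ^ 2 * (depth n k * n) + (1 + committeeSize n k b * Nat.clog 2 n) *
          (2 * (k * (committeeSize n k b * treeCount n k))) := by
  set r := convergeParityRun n k b x B adv ω with hr
  set F := committee n k b ω with hFdef
  set s := committeeSize n k b with hs
  have hF : GoodCommittees n r.env.byz F s := ⟨fun v _ => card_committee_le ω v, hB⟩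
  have hspec : Spec r.env r.code (seedLength n k b ⌈/⌉ n + (convergecastRounds n F +
      resolveRounds n F s)) fun out q m => (∀ i ∉ B, out i = parity x) ∧
        (∀ i, q i ≤ seedLength n k b + (load n F * (n ⌈/⌉ k) + s * (load n F * arity n k) +
          s * treeCount n k)) ∧
        m ≤ s ^ 2 * (depth n k * n) + (1 + s * Nat.clog 2 n) *
          (2 * (k * (s * treeCount n k))) := by
    change Spec r.env (fun me => convergeParity n k b me) _ _
    unfold convergeParity
    refine Spec.bind (spec_electPublic (hk.trans_le hkn)) ?_
    rintro F' q m ⟨h₁, h₂, h₃⟩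
    -- All machines, in the bookkeeping also the Byzantine ones, obtain the same `F`; the later
    -- loops therefore have a common length.
    obtain rfl : F' = fun _ => F := funext h₁
    refine Spec.bind (spec_convergecast hF hk hkn) ?_
    rintro res q' m' ⟨g₁, g₂, g₃⟩
    refine Spec.mono (spec_weakParityResolve hk hkn hF
      fun M hM v hv => g₁ M hM v (List.mem_filter.1 hv).1) ?_
    rintro out q'' m'' ⟨f₁, f₂, f₃⟩
    refine ⟨f₁, fun i => ?_, ?_⟩
    · exact Nat.add_le_add (h₂ i) (Nat.add_le_add (g₂ i) (f₂ i))
    · rw [h₃, zero_add]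
      exact Nat.add_le_add g₃ f₃
  obtain ⟨out, q, m, hreach, h₁, h₂, h₃⟩ := hspec 0
  obtain ⟨g₁, g₂, g₃, g₄⟩ := r.config_of_reaches hreach rfl
  simp only [zero_add] at g₁ g₂ g₃ g₄
  refine ⟨_, rfl, fun i hi => ?_, fun t i => ?_, fun i => ?_, ?_⟩
  · have := g₁ 0
    rw [add_zero] at this
    rw [this, ← h₁ i hi]
    rfl
  · by_cases ht : t < seedLength n k b ⌈/⌉ n + (convergecastRounds n F + resolveRounds n F s)
    · exact g₃ t ht i
    · obtain ⟨e, rfl⟩ := Nat.exists_eq_add_of_le (not_lt.1 ht)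
      rw [Run.queriesInRound, g₁ e]
      simp [Prog.queries]
  · exact (g₂ i).trans_le (h₂ i)
  · exact g₄.trans_le h₃

end Run

/-! ### Random polynomials -/

section Polynomials

variable {K : Type*} [Field K] [DecidableEq K]

/-- Evaluation of polynomials, given by their coefficients, at the points of `X`. -/
def evalAt (s : ℕ) (X : Finset K) : (Fin s → K) →+ (X → K) where
  toFun c x := ∑ i, c i * (x : K) ^ (i : ℕ)
  map_zero' := by ext; simp
  map_add' c d := by ext; simp [add_mul, Finset.sum_add_distrib]

/-- Lagrange interpolation: any values at no more than `s` points are attained by a polynomial of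
degree less than `s`. -/
lemma evalAt_surjective {s : ℕ} (hs : 0 < s) {X : Finset K} (hX : X.card ≤ s) :
    Function.Surjective (evalAt s X) := by
  intro f
  let f' : K → K := fun x => if h : x ∈ X then f ⟨x, h⟩ else 0
  let P := Lagrange.interpolate X id f'
  have hdeg : P.degree < X.card := Lagrange.degree_interpolate_lt f' (Set.injOn_id _)
  have hP : P.natDegree < s := by
    by_cases h : P = 0
    · simpa [h] using hs
    · exact ((Polynomial.natDegree_lt_iff_degree_lt h).2 hdeg).trans_le hX
  refine ⟨fun i => P.coeff i, funext fun x => ?_⟩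
  have h₁ : P.eval (x : K) = f x := by
    have h : P.eval (x : K) = f' x :=
      Lagrange.eval_interpolate_at_node f' (v := id) (Set.injOn_id _) x.2
    rw [h]
    simp [f']
  rw [← h₁, Polynomial.eval_eq_sum_range' hP]
  exact Fin.sum_univ_eq_sum_range (fun i => P.coeff i * (x : K) ^ i) s

variable [Fintype K]

/-- The fibres of a surjective homomorphism all have the same size `N`, so a uniform polynomial has
uniform, independent values on `X`. -/
lemma card_eval_mem {s : ℕ} (hs : 0 < s) {X : Finset K} (hX : X.card ≤ s) (A : Finset K) :
    (Finset.univ.filter fun c : Fin s → K => ∀ x ∈ X, ∑ i, c i * x ^ (i : ℕ) ∈ A).card *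
      Fintype.card K ^ X.card = A.card ^ X.card * Fintype.card K ^ s := by
  have hsurj := evalAt_surjective hs hX
  obtain ⟨N, hN⟩ : ∃ N, ∀ y, (Finset.univ.filter fun c => evalAt s X c = y).card = N :=
    ⟨_, fun y => AddMonoidHom.card_fiber_eq_of_mem_range (evalAt s X) (hsurj y) (hsurj 0)⟩
  have h₁ : Fintype.card K ^ s = Fintype.card K ^ X.card * N := by
    have := Finset.card_eq_sum_card_fiberwise (s := (Finset.univ : Finset (Fin s → K)))
      (t := Finset.univ) (f := evalAt s X) (fun _ _ => by simp)
    simpa [hN] using this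
  have h₂ : (Finset.univ.filter fun c : Fin s → K =>
      ∀ x ∈ X, ∑ i, c i * x ^ (i : ℕ) ∈ A).card = A.card ^ X.card * N := by
    have h := Finset.card_eq_sum_card_fiberwise (s := Finset.univ.filter fun c : Fin s → K =>
      ∀ x ∈ X, ∑ i, c i * x ^ (i : ℕ) ∈ A) (t := Fintype.piFinset fun _ : X => A)
      (f := evalAt s X) (fun c hc => by simpa [evalAt] using hc)
    rw [h, Finset.sum_congr rfl (g := fun _ => N)]
    · simp
    · intro y hy
      rw [← hN y, Finset.filter_filter]
      congr 1
      refine Finset.filter_congr fun c _ => ⟨fun h => h.2, fun h => ⟨fun x hx => ?_, h⟩⟩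
      rw [Fintype.mem_piFinset] at hy
      have := hy ⟨x, hx⟩
      rwa [← h] at this
  rw [h₁, h₂]
  ring

variable {ι κ : Type*} [Fintype ι] [DecidableEq ι]

/-- The values of independent random polynomials at few points are independent. -/
lemma card_forall_eval_mem {s : ℕ} (hs : 0 < s) {x : κ → K} (hx : Function.Injective x)
    {R : Finset (ι × κ)} (hR : R.card ≤ s) (A : Finset K) :
    (Finset.univ.filter fun a : ι → Fin s → K =>
      ∀ p ∈ R, ∑ i, a p.1 i * x p.2 ^ (i : ℕ) ∈ A).card * Fintype.card K ^ R.card =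
        A.card ^ R.card * Fintype.card K ^ (s * Fintype.card ι) := by
  let X : ι → Finset K := fun u => (R.filter fun p => p.1 = u).image fun p => x p.2
  have hXcard : ∀ u, (X u).card = (R.filter fun p => p.1 = u).card := fun u =>
    Finset.card_image_of_injOn fun p hp q hq h => by
      simp only [Finset.coe_filter, Set.mem_ofPred_eq] at hp hq
      exact Prod.ext (hp.2.trans hq.2.symm) (hx h)
  have hsum : ∑ u, (X u).card = R.card := by
    simp only [hXcard]
    exact (Finset.card_eq_sum_card_fiberwise (t := Finset.univ) (f := Prod.fst)
      fun _ _ => by simp).symm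
  have hXle : ∀ u, (X u).card ≤ s := fun u => by
    rw [hXcard]; exact (Finset.card_filter_le _ _).trans hR
  -- The constraints split by polynomial, the `u`-th one being constrained on `X u` only, so the
  -- count is a product.
  have hpi : (Finset.univ.filter fun a : ι → Fin s → K =>
      ∀ p ∈ R, ∑ i, a p.1 i * x p.2 ^ (i : ℕ) ∈ A) =
      Fintype.piFinset fun u => Finset.univ.filter fun c : Fin s → K =>
        ∀ y ∈ X u, ∑ i, c i * y ^ (i : ℕ) ∈ A := by
    ext a
    simp only [Finset.mem_filter, Finset.mem_univ, true_and, Fintype.mem_piFinset, X,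
      Finset.mem_image, forall_exists_index, and_imp]
    constructor
    · rintro h u y p hp rfl rfl; exact h p hp
    · intro h p hp; exact h p.1 _ p hp rfl rfl
  rw [hpi, Fintype.card_piFinset, ← hsum, ← Finset.prod_pow_eq_pow_sum,
    ← Finset.prod_mul_distrib, Finset.prod_congr rfl fun u _ => card_eval_mem hs (hXle u) A,
    Finset.prod_mul_distrib, Finset.prod_pow_eq_pow_sum, Finset.prod_const, ← pow_mul]
  rfl

/-- The `s`-th factorial moment of the number of hits. -/
lemma card_many_hits_le [Fintype κ] [DecidableEq κ] {s : ℕ} (hs : 0 < s) {x : κ → K} (hx : Function.Injective x)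
    (A : Finset K) (N : ℕ) :
    (Finset.univ.filter fun a : ι → Fin s → K => N ≤ (Finset.univ.filter fun p : ι × κ =>
      ∑ i, a p.1 i * x p.2 ^ (i : ℕ) ∈ A).card).card * N.choose s * Fintype.card K ^ s ≤
        (Fintype.card ι * Fintype.card κ).choose s * A.card ^ s *
          Fintype.card K ^ (s * Fintype.card ι) := by
  let hits : (ι → Fin s → K) → Finset (ι × κ) := fun a =>
    Finset.univ.filter fun p => ∑ i, a p.1 i * x p.2 ^ (i : ℕ) ∈ A
  -- Markov's inequality for the number of `s`-element sets of hits; next, this number is summed by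
  -- sets instead of by polynomials.
  have h₁ : (Finset.univ.filter fun a => N ≤ (hits a).card).card * N.choose s ≤
      ∑ a, ((hits a).powersetCard s).card := by
    rw [← smul_eq_mul, ← Finset.sum_const]
    refine (Finset.sum_le_sum fun a ha => ?_).trans
      (Finset.sum_le_sum_of_subset (Finset.subset_univ _))
    rw [Finset.card_powersetCard]
    exact Nat.choose_le_choose _ (Finset.mem_filter.1 ha).2
  have h₂ : ∑ a, ((hits a).powersetCard s).card =
      ∑ R ∈ (Finset.univ : Finset (ι × κ)).powersetCard s,
        (Finset.univ.filter fun a : ι → Fin s → K =>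
          ∀ p ∈ R, ∑ i, a p.1 i * x p.2 ^ (i : ℕ) ∈ A).card := by
    have h := Finset.sum_card_bipartiteAbove_eq_sum_card_bipartiteBelow
      (s := (Finset.univ : Finset (ι → Fin s → K)))
      (t := (Finset.univ : Finset (ι × κ)).powersetCard s)
      (fun (a : ι → Fin s → K) (R : Finset (ι × κ)) => ∀ p ∈ R, ∑ i : Fin s, a p.1 i * x p.2 ^ (i : ℕ) ∈ A)
    refine Eq.trans (Finset.sum_congr rfl fun a _ => ?_) h
    congr 1
    ext R
    simp only [Finset.mem_powersetCard, Finset.bipartiteAbove, Finset.mem_filter,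
      true_and, hits, Finset.subset_iff, Finset.mem_univ]
    tauto
  calc _ ≤ (∑ a, ((hits a).powersetCard s).card) * Fintype.card K ^ s :=
        Nat.mul_le_mul_right _ h₁
    _ = ∑ R ∈ (Finset.univ : Finset (ι × κ)).powersetCard s,
          A.card ^ s * Fintype.card K ^ (s * Fintype.card ι) := by
        rw [h₂, Finset.sum_mul]
        refine Finset.sum_congr rfl fun R hR => ?_
        have hc := (Finset.mem_powersetCard.1 hR).2
        have := card_forall_eval_mem hs hx hc.le A
        rw [hc] at this
        convert this
    _ = _ := by
        rw [Finset.sum_const, Finset.card_powersetCard, Finset.card_univ, Fintype.card_prod,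
          smul_eq_mul, mul_assoc]

/-- Up to the common s!, the moment is at most (s · 12k · 2/k)^s = (24s)^s, while 49s hits contain
at least (48s)^s / s! sets of size `s`. The quotient is 2^(-s). -/
lemma two_pow_mul_card_many_hits_le [Fintype κ] [DecidableEq κ] {s k : ℕ} (hs : 0 < s) {x : κ → K}
    (hx : Function.Injective x) {A : Finset K} (hA : A.card * k ≤ 2 * Fintype.card K)
    (hκ : Fintype.card κ ≤ 12 * k) (hι : Fintype.card ι = s) :
    (Finset.univ.filter fun a : ι → Fin s → K => 49 * s ≤ (Finset.univ.filter fun p : ι × κ =>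
      ∑ i, a p.1 i * x p.2 ^ (i : ℕ) ∈ A).card).card * 2 ^ s ≤ Fintype.card K ^ (s * s) := by
  have h := card_many_hits_le (ι := ι) hs hx A (49 * s)
  rw [hι] at h
  set bad := (Finset.univ.filter fun a : ι → Fin s → K => 49 * s ≤
    (Finset.univ.filter fun p : ι × κ => ∑ i, a p.1 i * x p.2 ^ (i : ℕ) ∈ A).card).card
  set q := Fintype.card K
  have hq : 0 < q := Fintype.card_pos
  have h₁ : (48 * s) ^ s ≤ s.factorial * (49 * s).choose s := by
    rw [← Nat.descFactorial_eq_factorial_mul_choose]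
    exact (Nat.pow_le_pow_left (by omega) _).trans (Nat.pow_sub_le_descFactorial _ _)
  have h₂ : s.factorial * (s * Fintype.card κ).choose s ≤ (s * Fintype.card κ) ^ s := by
    rw [← Nat.descFactorial_eq_factorial_mul_choose]
    exact Nat.descFactorial_le_pow _ _
  have h₃ : s * Fintype.card κ * A.card ≤ 24 * s * q := by
    calc s * Fintype.card κ * A.card ≤ s * (12 * k) * A.card := by gcongr
      _ = 12 * s * (A.card * k) := by ring
      _ ≤ 12 * s * (2 * q) := by gcongr
      _ = _ := by ring
  have h₄ : (24 * s * q) ^ s * (bad * 2 ^ s) ≤ (24 * s * q) ^ s * q ^ (s * s) := by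
    calc (24 * s * q) ^ s * (bad * 2 ^ s) = bad * (48 * s) ^ s * q ^ s := by
          rw [show 48 * s = 24 * s * 2 by ring, mul_pow, mul_pow (24 * s) 2]; ring
      _ ≤ bad * (s.factorial * (49 * s).choose s) * q ^ s := by gcongr
      _ = s.factorial * (bad * (49 * s).choose s * q ^ s) := by ring
      _ ≤ s.factorial * ((s * Fintype.card κ).choose s * A.card ^ s * q ^ (s * s)) := by gcongr
      _ = s.factorial * (s * Fintype.card κ).choose s * A.card ^ s * q ^ (s * s) := by ring
      _ ≤ (s * Fintype.card κ) ^ s * A.card ^ s * q ^ (s * s) := by gcongr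
      _ = (s * Fintype.card κ * A.card) ^ s * q ^ (s * s) := by rw [← mul_pow]
      _ ≤ _ := by gcongr
  exact Nat.le_of_mul_le_mul_left h₄ (by positivity)

end Polynomials

/-! ### Words, field elements and numbers -/

section Words

variable {m : ℕ}

lemma repr_wordToField (w : ℕ → Bool) (i : Fin (Module.finrank (ZMod 2) (GaloisField 2 m))) :
    (Module.finBasis (ZMod 2) (GaloisField 2 m)).repr (wordToField m w) i =
      if w i then 1 else 0 := by
  have : wordToField m w = ∑ j : Fin (Module.finrank (ZMod 2) (GaloisField 2 m)), (if w j then (1 : ZMod 2) else 0) •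
      Module.finBasis (ZMod 2) (GaloisField 2 m) j := by
    unfold wordToField
    refine Finset.sum_congr rfl fun j _ => ?_
    split_ifs <;> simp
  rw [this, Module.Basis.repr_sum_self]

lemma wordToField_inj (hm : 0 < m) {w w' : ℕ → Bool} (h : wordToField m w = wordToField m w')
    {i : ℕ} (hi : i < m) : w i = w' i := by
  have h₁ := repr_wordToField w ⟨i, hi.trans_eq (finrank_field hm).symm⟩
  have h₂ := repr_wordToField w' ⟨i, hi.trans_eq (finrank_field hm).symm⟩
  rw [h, h₂] at h₁
  dsimp only at h₁
  cases hw : w i <;> cases hw' : w' i <;> simp_all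

lemma wordToField_testBit_inj (hm : 0 < m) {i j : ℕ} (hi : i < 2 ^ m) (hj : j < 2 ^ m)
    (h : wordToField m i.testBit = wordToField m j.testBit) : i = j := by
  refine Nat.eq_of_testBit_eq fun e => ?_
  rcases lt_or_ge e m with he | he
  · exact wordToField_inj hm h he
  · rw [Nat.testBit_eq_false_of_lt (hi.trans_le (Nat.pow_le_pow_right (by omega) he)),
      Nat.testBit_eq_false_of_lt (hj.trans_le (Nat.pow_le_pow_right (by omega) he))]

/-- The positions of the ones among the coordinates of a field element. -/
noncomputable def ones (m : ℕ) (y : GaloisField 2 m) : Finset ℕ :=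
  (Finset.univ.filter fun i => (Module.finBasis (ZMod 2) (GaloisField 2 m)).repr y i = 1).map
    Fin.valEmbedding

lemma fieldToNat_eq (y : GaloisField 2 m) : fieldToNat m y = ∑ i ∈ ones m y, 2 ^ i := by
  simp [fieldToNat, ones, Finset.sum_filter]

lemma fieldToNat_lt (hm : 0 < m) (y : GaloisField 2 m) : fieldToNat m y < 2 ^ m := by
  rw [fieldToNat_eq]
  refine Nat.geomSum_lt le_rfl fun i hi => ?_
  obtain ⟨j, -, rfl⟩ := Finset.mem_map.1 hi
  exact j.2.trans_eq (finrank_field hm)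

/-- Binary expansions are unique and coordinates over the field with two elements are bits; together
with `fieldToNat_lt`, counting field elements becomes counting numbers below 2^m. -/
lemma fieldToNat_injective : Function.Injective (fieldToNat m) := by
  intro y z h
  rw [fieldToNat_eq, fieldToNat_eq] at h
  have h₁ := Finset.geomSum_injective (n := 2) le_rfl h
  refine (Module.finBasis (ZMod 2) (GaloisField 2 m)).ext_elem fun i => ?_
  have h₂ : ∀ y, (i : ℕ) ∈ ones m y ↔
      (Module.finBasis (ZMod 2) (GaloisField 2 m)).repr y i = 1 := fun y => by
    simp [ones, Fin.val_inj]
  have h₃ := (h₂ y).symm.trans ((by rw [h₁] : _ ↔ _).trans (h₂ z))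
  generalize (Module.finBasis (ZMod 2) (GaloisField 2 m)).repr y i = a at h₃ ⊢
  generalize (Module.finBasis (ZMod 2) (GaloisField 2 m)).repr z i = b at h₃ ⊢
  revert a b
  decide

end Words

/-! ### Random committees -/

lemma card_filter_mod_eq_le {N k : ℕ} (r : ℕ) :
    ((Finset.range N).filter fun z => z % k = r).card ≤ N / k + 1 := by
  calc _ ≤ (Finset.range (N / k + 1)).card := by
        refine Finset.card_le_card_of_injOn (fun z => z / k) (fun z hz => ?_) ?_
        · simp only [Finset.coe_filter, Finset.mem_range, Set.mem_ofPred_eq] at hz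
          simpa [Nat.lt_succ_iff] using Nat.div_le_div_right hz.1.le
        · intro a ha b hb hab
          simp only [Finset.coe_filter, Finset.mem_range, Set.mem_ofPred_eq] at ha hb
          dsimp only at hab
          rw [← Nat.div_add_mod a k, ← Nat.div_add_mod b k, hab, ha.2, hb.2]
    _ = _ := Finset.card_range _

lemma mul_div_le_card_filter_mod {N k : ℕ} (H : Finset (Fin k)) :
    H.card * (N / k) ≤ ((Finset.range N).filter fun z => ∃ M ∈ H, z % k = M).card := by
  calc H.card * (N / k) = (H ×ˢ Finset.range (N / k)).card := by simp
    _ ≤ _ := by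
        refine Finset.card_le_card_of_injOn (fun p => p.2 * k + p.1) (fun p hp => ?_) ?_
        · simp only [Finset.coe_product, Set.mem_prod, Finset.mem_coe, Finset.mem_range] at hp
          have h₁ : (p.2 + 1) * k ≤ N := (Nat.mul_le_mul_right _ hp.2).trans (Nat.div_mul_le_self _ _)
          have h₂ := p.1.2
          have h₃ : (p.2 * k + p.1) % k = p.1 := by
            rw [mul_comm, Nat.mul_add_mod, Nat.mod_eq_of_lt h₂]
          rw [add_mul] at h₁
          simp only [Finset.coe_filter, Finset.mem_range, Set.mem_ofPred_eq]
          exact ⟨by omega, p.1, hp.1, h₃⟩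
        · rintro ⟨a, q⟩ - ⟨a', q'⟩ - h
          dsimp only at h
          have h₁ : (q * k + a) % k = a := by rw [mul_comm, Nat.mul_add_mod, Nat.mod_eq_of_lt a.2]
          have h₂ : (q' * k + a') % k = a' := by
            rw [mul_comm, Nat.mul_add_mod, Nat.mod_eq_of_lt a'.2]
          have h₃ : a = a' := Fin.ext (by rw [← h₁, ← h₂, h])
          subst h₃
          have : q = q' := Nat.eq_of_mul_eq_mul_right a.pos (Nat.add_right_cancel h)
          rw [this]

/-- The law of finitely many coins. -/
lemma coinMeasure_cylinder (N : ℕ) (w : ℕ → Bool) :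
    coinMeasure {ω | ∀ s < N, ω s = w s} = (2 ^ N : ENNReal)⁻¹ := by
  have h : {ω : ℕ → Bool | ∀ s < N, ω s = w s} =
      Set.pi (Finset.range N : Set ℕ) fun s => {w s} := by
    ext ω; simp [Set.mem_pi]
  rw [h, coinMeasure, MeasureTheory.Measure.infinitePi_pi _ fun _ _ => measurableSet_singleton _]
  rw [Finset.prod_congr rfl (g := fun _ => (2 : ENNReal)⁻¹)]
  · simp [ENNReal.inv_pow]
  · intro s _
    rw [PMF.toMeasure_apply_singleton _ _ (measurableSet_singleton _)]
    simp

section Committees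

variable {n k b : ℕ}

noncomputable instance (m : ℕ) : Fintype (GaloisField 2 m) := Fintype.ofFinite _

noncomputable instance (m : ℕ) : DecidableEq (GaloisField 2 m) := Classical.decEq _

lemma card_field {m : ℕ} (hm : 0 < m) : Fintype.card (GaloisField 2 m) = 2 ^ m := by
  rw [← Nat.card_eq_fintype_card, GaloisField.card 2 m hm.ne']

/-- The coefficients of `s` polynomials of degree less than `s`. -/
noncomputable def coeffs (s m : ℕ) (ω : ℕ → Bool) (u c : Fin s) : GaloisField 2 m :=
  wordToField m fun e => ω (u * (s * m) + (c * m + e))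

lemma coinMeasure_coeffs_le {s m : ℕ} (hm : 0 < m) (a : Fin s → Fin s → GaloisField 2 m) :
    coinMeasure {ω | coeffs s m ω = a} ≤ (2 ^ (s * s * m) : ENNReal)⁻¹ := by
  rcases Set.eq_empty_or_nonempty {ω | coeffs s m ω = a} with h | ⟨w, hw⟩
  · rw [h]; simp
  · rw [← coinMeasure_cylinder (s * s * m) w]
    refine MeasureTheory.measure_mono fun ω hω t ht => ?_
    -- Coin `t` is a bit of the coefficient in block t / (sm), position (t mod sm) / m. Hence fixing
    -- all coefficients fixes the first s·s·m coins, and the event lies in one cylinder.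
    have h₁ : t / (s * m) < s := Nat.div_lt_of_lt_mul (by rwa [mul_comm (s * m), ← mul_assoc])
    have hs : 0 < s := (Nat.zero_le _).trans_lt h₁
    have h₂ : t % (s * m) / m < s :=
      Nat.div_lt_of_lt_mul (by rw [mul_comm m]; exact Nat.mod_lt _ (by positivity))
    have h₃ := wordToField_inj hm
      (congrFun (congrFun (hω.trans hw.symm) ⟨t / (s * m), h₁⟩) ⟨t % (s * m) / m, h₂⟩)
      (Nat.mod_lt (t % (s * m)) hm)
    dsimp only at h₃
    rwa [Nat.div_add_mod', Nat.div_add_mod'] at h₃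

lemma coinMeasure_coeffs_mem_le {s m : ℕ} (hm : 0 < m)
    (S : Finset (Fin s → Fin s → GaloisField 2 m)) :
    coinMeasure {ω | coeffs s m ω ∈ S} ≤ ENNReal.ofReal (S.card / (2 ^ m) ^ (s * s)) := by
  have h : {ω | coeffs s m ω ∈ S} = ⋃ a ∈ S, {ω | coeffs s m ω = a} := by ext; simp
  rw [h]
  refine (MeasureTheory.measure_biUnion_finset_le _ _).trans ?_
  refine (Finset.sum_le_sum fun a _ => coinMeasure_coeffs_le hm a).trans ?_
  rw [Finset.sum_const, nsmul_eq_mul, div_eq_mul_inv, ENNReal.ofReal_mul (by positivity),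
    ENNReal.ofReal_natCast, ENNReal.ofReal_inv_of_pos (by positivity),
    ENNReal.ofReal_pow (by positivity), ENNReal.ofReal_pow (by positivity), ENNReal.ofReal_ofNat,
    ← pow_mul, mul_comm m]

/-- The value of a random polynomial at the point that encodes `i`. -/
noncomputable def valueAt {s m : ℕ} (a : Fin s → Fin s → GaloisField 2 m) (u : Fin s) (i : ℕ) :
    GaloisField 2 m :=
  ∑ c, a u c * wordToField m i.testBit ^ (c : ℕ)

lemma hash_eq {s m : ℕ} (ω : ℕ → Bool) (u : Fin s) (i : ℕ) :
    hash s m (fun e => ω (u * (s * m) + e)) i = fieldToNat m (valueAt (coeffs s m ω) u i) := by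
  unfold hash valueAt coeffs
  rw [← Fin.sum_univ_eq_sum_range (fun c => wordToField m (fun e => ω (u * (s * m) + (c * m + e))) *
    wordToField m i.testBit ^ c) s]

lemma mem_committee {ω : ℕ → Bool} {v : Node} {M : Fin k} : M ∈ committee n k b ω v ↔
    ∃ u, fieldToNat _ (valueAt (coeffs (committeeSize n k b) (wordLength n k) ω) u
      ((forest n k).idxOf v)) % k = M := by
  simp only [committee, Finset.mem_filter, Finset.mem_univ, true_and]
  constructor
  · rintro ⟨u, hu, h⟩
    exact ⟨⟨u, hu⟩, by rwa [← hash_eq]⟩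
  · rintro ⟨u, h⟩
    exact ⟨u, u.2, by rwa [hash_eq]⟩

/-- The field elements that denote a machine of `H`. -/
noncomputable def denoting (m : ℕ) (H : Finset (Fin k)) : Finset (GaloisField 2 m) :=
  Finset.univ.filter fun y => ∃ M ∈ H, fieldToNat m y % k = M

lemma card_denoting_le {m : ℕ} (hm : 0 < m) (H : Finset (Fin k)) : (denoting m H).card ≤
    ((Finset.range (2 ^ m)).filter fun z => ∃ M ∈ H, z % k = M).card :=
  Finset.card_le_card_of_injOn (fieldToNat m)
    (fun y hy => by
      have := (Finset.mem_filter.1 hy).2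
      simp only [Finset.coe_filter, Finset.mem_range, Set.mem_ofPred_eq]
      exact ⟨fieldToNat_lt hm y, this⟩)
    fieldToNat_injective.injOn

/-- Reduction modulo `k` is not uniform, but as k ≤ 2^m no machine gets more than twice its fair
share. -/
lemma card_denoting_singleton_mul_le {m : ℕ} (hm : 0 < m) (hk : k ≤ 2 ^ m) (M : Fin k) :
    (denoting m {M}).card * k ≤ 2 * 2 ^ m := by
  have h := (card_denoting_le hm {M}).trans
    (by simpa using card_filter_mod_eq_le (N := 2 ^ m) (k := k) M)
  calc _ ≤ (2 ^ m / k + 1) * k := Nat.mul_le_mul_right _ h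
    _ = 2 ^ m / k * k + k := by ring
    _ ≤ 2 ^ m + 2 ^ m := Nat.add_le_add (Nat.div_mul_le_self _ _) hk
    _ = _ := by ring

/-- Each machine outside `B` is denoted by at least ⌊2^m/k⌋ ≥ 2^m/(2k) values, so at least a
fraction γ/2 of the field avoids `B`. The halving is the price of the reduction modulo `k`. -/
lemma card_denoting_le_mul {m : ℕ} (hm : 0 < m) (hk : k ≤ 2 ^ m) (hk₀ : 0 < k) (hb : b ≤ k)
    {B : Finset (Fin k)} (hB : B.card ≤ b) :
    ((denoting m B).card : ℝ) ≤ (1 - (1 - (b : ℝ) / k) / 2) * 2 ^ m := by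
  have h₁ := card_denoting_le hm B
  have h₂ := mul_div_le_card_filter_mod (N := 2 ^ m) Bᶜ
  have h₃ : ((Finset.range (2 ^ m)).filter fun z => ∃ M ∈ B, z % k = M).card +
      ((Finset.range (2 ^ m)).filter fun z => ∃ M ∈ Bᶜ, z % k = M).card ≤ 2 ^ m := by
    rw [← Finset.card_union_of_disjoint]
    · refine (Finset.card_le_card (Finset.union_subset (Finset.filter_subset _ _)
        (Finset.filter_subset _ _))).trans_eq (Finset.card_range _)
    · refine Finset.disjoint_left.2 fun z hz hz' => ?_
      obtain ⟨-, M, hM, h⟩ := Finset.mem_filter.1 hz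
      obtain ⟨-, M', hM', h'⟩ := Finset.mem_filter.1 hz'
      have : M = M' := Fin.ext (h.symm.trans h')
      subst this
      exact Finset.mem_compl.1 hM' hM
  have h₄ : k - b ≤ Bᶜ.card := by rw [Finset.card_compl, Fintype.card_fin]; omega
  have h₅ : 2 ^ m ≤ 2 * k * (2 ^ m / k) := by
    have h₆ := Nat.div_add_mod (2 ^ m) k
    have h₇ := Nat.mod_lt (2 ^ m) hk₀
    have h₈ : 1 ≤ 2 ^ m / k := Nat.div_pos hk hk₀
    nlinarith
  have h₆ : (denoting m B).card + (k - b) * (2 ^ m / k) ≤ 2 ^ m := by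
    have := Nat.mul_le_mul_right (2 ^ m / k) h₄
    omega
  have h₆' : ((denoting m B).card : ℝ) + ((k : ℝ) - b) * ((2 ^ m / k : ℕ) : ℝ) ≤ 2 ^ m := by
    have := (Nat.cast_le (α := ℝ)).2 h₆
    rw [Nat.cast_add, Nat.cast_mul, Nat.cast_sub hb] at this
    simpa using this
  have h₅' : (2 : ℝ) ^ m ≤ 2 * k * ((2 ^ m / k : ℕ) : ℝ) := by
    have := (Nat.cast_le (α := ℝ)).2 h₅
    rw [Nat.cast_mul] at this
    simpa using this
  have hk' : (0 : ℝ) < k := by exact_mod_cast hk₀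
  have hb' : (b : ℝ) ≤ k := by exact_mod_cast hb
  have h₇ : (1 - (b : ℝ) / k) / 2 * 2 ^ m ≤ ((k : ℝ) - b) * ((2 ^ m / k : ℕ) : ℝ) := by
    have : (1 - (b : ℝ) / k) / 2 = ((k : ℝ) - b) * (1 / (2 * k)) := by field_simp
    rw [this, mul_assoc]
    refine mul_le_mul_of_nonneg_left ?_ (by linarith)
    rw [one_div, inv_mul_le_iff₀ (by positivity)]
    exact h₅'
  linarith

lemma length_forest_le_two_pow : (forest n k).length ≤ 2 ^ wordLength n k :=
  (Nat.le_pow_clog (by omega) _).trans (Nat.pow_le_pow_right (by omega)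
    ((le_max_left _ _).trans (le_max_right _ _)))

lemma le_two_pow_wordLength : k ≤ 2 ^ wordLength n k :=
  (Nat.le_pow_clog (by omega) _).trans (Nat.pow_le_pow_right (by omega)
    ((le_max_right _ _).trans (le_max_right _ _)))

lemma point_injective : Function.Injective fun i : Fin (forest n k).length =>
    wordToField (wordLength n k) (i : ℕ).testBit := fun i j h =>
  Fin.ext (wordToField_testBit_inj wordLength_pos (i.2.trans_le length_forest_le_two_pow)
    (j.2.trans_le length_forest_le_two_pow) h)

/-- The probability that a given committee has only members in `B`. -/
lemma coinMeasure_committee_subset_le (hs : 0 < committeeSize n k b) (hk : 0 < k) (hb : b ≤ k)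
    {B : Finset (Fin k)} (hB : B.card ≤ b) {v : Node} (hv : v ∈ forest n k) :
    coinMeasure {ω | committee n k b ω v ⊆ B} ≤
      ENNReal.ofReal ((1 - (1 - (b : ℝ) / k) / 2) ^ committeeSize n k b) := by
  set s := committeeSize n k b with hsdef
  set m := wordLength n k with hmdef
  have hm : 0 < m := wordLength_pos
  let x : Fin (forest n k).length → GaloisField 2 m := fun i => wordToField m (i : ℕ).testBit
  have hx : Function.Injective x := point_injective
  let i₀ : Fin (forest n k).length := ⟨_, List.idxOf_lt_length_iff.2 hv⟩
  -- One evaluation point for each of the `s` hash functions, so the probability is the `s`-th power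
  -- of that for a single value.
  let R : Finset (Fin s × Fin (forest n k).length) := Finset.univ ×ˢ {i₀}
  have hR : R.card = s := by simp [R]
  obtain ⟨S, hS⟩ : ∃ S, S = Finset.univ.filter fun a : Fin s → Fin s → GaloisField 2 m =>
    ∀ p ∈ R, ∑ i, a p.1 i * x p.2 ^ (i : ℕ) ∈ denoting m B := ⟨_, rfl⟩
  have hcard : S.card * (2 ^ m) ^ s = (denoting m B).card ^ s * (2 ^ m) ^ (s * s) := by
    have h := card_forall_eval_mem hs hx hR.le (denoting m B)
    rw [hR, Fintype.card_fin, card_field hm] at h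
    rw [hS]
    convert h
  refine (MeasureTheory.measure_mono (t := {ω | coeffs s m ω ∈ S}) fun ω hω => ?_).trans
    ((coinMeasure_coeffs_mem_le hm S).trans (ENNReal.ofReal_le_ofReal ?_))
  · simp only [hS, Set.mem_ofPred_eq, Finset.mem_filter, Finset.mem_univ, true_and]
    intro p hp
    have hp₂ : (p.2 : ℕ) = (forest n k).idxOf v :=
      congrArg Fin.val (Finset.mem_singleton.1 (Finset.mem_product.1 hp).2)
    simp only [denoting, Finset.mem_filter, Finset.mem_univ, true_and]
    let M : Fin k := ⟨fieldToNat m (valueAt (coeffs s m ω) p.1 p.2) % k, Nat.mod_lt _ hk⟩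
    exact ⟨M, hω (mem_committee.2 ⟨p.1, by rw [← hp₂]⟩), rfl⟩
  · have hcard' : (S.card : ℝ) * (2 ^ m) ^ s = (denoting m B).card ^ s * (2 ^ m) ^ (s * s) := by
      exact_mod_cast hcard
    have h₁ := card_denoting_le_mul hm le_two_pow_wordLength hk hb hB
    rw [div_le_iff₀ (by positivity)]
    refine le_of_mul_le_mul_right ?_ (show (0 : ℝ) < (2 ^ m) ^ s by positivity)
    rw [hcard']
    calc _ ≤ ((1 - (1 - (b : ℝ) / k) / 2) * 2 ^ m) ^ s * (2 ^ m) ^ (s * s) := by gcongr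
      _ = _ := by rw [mul_pow]; ring

/-- The probability that a given machine belongs to many committees. -/
lemma coinMeasure_memberships_le (hs : 0 < committeeSize n k b) (hk : 0 < k) (hkn : k ≤ n)
    (M : Fin k) :
    coinMeasure {ω | 49 * committeeSize n k b ≤
      (memberships n (committee n k b ω) M).length} ≤
        ENNReal.ofReal ((1 / 2) ^ committeeSize n k b) := by
  set s := committeeSize n k b with hsdef
  set m := wordLength n k with hmdef
  have hm : 0 < m := wordLength_pos
  let x : Fin (forest n k).length → GaloisField 2 m := fun i => wordToField m (i : ℕ).testBit
  have hx : Function.Injective x := point_injective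
  obtain ⟨S, hS⟩ : ∃ S, S = Finset.univ.filter fun a : Fin s → Fin s → GaloisField 2 m =>
    49 * s ≤ (Finset.univ.filter fun p : Fin s × Fin (forest n k).length =>
      ∑ i, a p.1 i * x p.2 ^ (i : ℕ) ∈ denoting m {M}).card := ⟨_, rfl⟩
  have hcard := two_pow_mul_card_many_hits_le (ι := Fin s) (k := k) hs hx (A := denoting m {M})
    (by rw [card_field hm]; exact card_denoting_singleton_mul_le hm le_two_pow_wordLength M)
    (by simpa using length_forest_le hk hkn) (by simp)
  rw [← hS, card_field hm] at hcard
  refine (MeasureTheory.measure_mono (t := {ω | coeffs s m ω ∈ S}) fun ω hω => ?_).trans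
    ((coinMeasure_coeffs_mem_le hm S).trans (ENNReal.ofReal_le_ofReal ?_))
  · simp only [hS, Set.mem_ofPred_eq, Finset.mem_filter, Finset.mem_univ, true_and]
    refine le_trans hω ?_
    have hnd : (memberships n (committee n k b ω) M).Nodup := nodup_forest.filter _
    rw [← List.toFinset_card_of_nodup hnd]
    -- Each node to which `M` belongs is the image of a pair of hash function and node that hits
    -- `M`, so the hits are at least as many as the memberships.
    refine (Finset.card_le_card fun v hv => ?_).trans
      (Finset.card_image_le (f := fun p => (forest n k).get p.2))
    obtain ⟨hv₁, hv₂⟩ := mem_memberships.1 (List.mem_toFinset.1 hv)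
    obtain ⟨u, hu⟩ := mem_committee.1 hv₂
    refine Finset.mem_image.2 ⟨(u, ⟨_, List.idxOf_lt_length_iff.2 hv₁⟩), ?_, by simp⟩
    simp only [denoting, Finset.mem_filter, Finset.mem_univ, true_and, Finset.mem_singleton,
      exists_eq_left]
    exact hu
  · have hcard' : (S.card : ℝ) * 2 ^ s ≤ (2 ^ m) ^ (s * s) := by exact_mod_cast hcard
    rw [div_le_iff₀ (by positivity), one_div, inv_pow, inv_mul_eq_div, le_div_iff₀ (by positivity)]
    exact hcard'

end Committees

/-! ### Estimates -/

section Estimates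

variable {n k b : ℕ}

/-- The uniform lower bound by which constants and lower powers of the logarithm are absorbed into
higher ones. -/
lemma half_lt_log (hn : 2 ≤ n) : 1 / 2 < Real.log n := by
  have h₁ : Real.log 2 ≤ Real.log n := Real.log_le_log (by norm_num) (by exact_mod_cast hn)
  linarith [Real.log_two_gt_d9]

lemma logb_le_two_mul_log (hn : 2 ≤ n) : Real.logb 2 n ≤ 2 * Real.log n := by
  have h := half_lt_log hn
  rw [Real.logb, div_le_iff₀ (Real.log_pos (by norm_num))]
  nlinarith [Real.log_two_gt_d9]

lemma log_le_logb (hn : 2 ≤ n) : Real.log n ≤ Real.logb 2 n := by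
  have h := half_lt_log hn
  rw [Real.logb, le_div_iff₀ (Real.log_pos (by norm_num))]
  nlinarith [Real.log_two_lt_d9]

lemma one_le_logb (hn : 2 ≤ n) : 1 ≤ Real.logb 2 n := by
  rw [Real.le_logb_iff_rpow_le (by norm_num) (by positivity), Real.rpow_one]
  exact_mod_cast hn

lemma clog_two_le {N : ℕ} : (Nat.clog 2 N : ℝ) ≤ 2 * Real.log N + 1 := by
  rcases Nat.lt_or_ge 1 N with h | h
  · have h₁ := Nat.pow_pred_clog_lt_self (b := 2) (by omega) h
    have h₂ := Nat.clog_pos (b := 2) (by omega) h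
    obtain ⟨c, hc⟩ : ∃ c, Nat.clog 2 N = c + 1 := ⟨Nat.clog 2 N - 1, by omega⟩
    rw [hc] at h₁ ⊢
    simp only [Nat.pred_succ] at h₁
    have h₃ : (2 : ℝ) ^ c ≤ N := by exact_mod_cast h₁.le
    have h₄ := Real.log_le_log (by positivity) h₃
    rw [Real.log_pow] at h₄
    push_cast
    nlinarith [Real.log_two_gt_d9, (Nat.cast_nonneg c : (0 : ℝ) ≤ c)]
  · rw [Nat.clog_of_right_le_one h]
    have : 0 ≤ Real.log N := Real.log_natCast_nonneg N
    push_cast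
    linarith

lemma clog_two_le_log (hn : 2 ≤ n) : (Nat.clog 2 n : ℝ) ≤ 4 * Real.log n := by
  linarith [clog_two_le (N := n), half_lt_log hn]

lemma clog_two_le_of_le {N : ℕ} (hn : 2 ≤ n) (h : N ≤ 12 * n) :
    (Nat.clog 2 N : ℝ) ≤ 12 * Real.log n := by
  have h₀ := half_lt_log hn
  -- With n ≥ 2 one has 12 ≤ n⁴, and 2 · 5 log n + 1 ≤ 12 log n because log n > 1/2.
  have h₁ : 12 * n ≤ n ^ 5 := by
    have : 2 ^ 4 ≤ n ^ 4 := Nat.pow_le_pow_left hn 4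
    rw [pow_succ n 4]
    exact Nat.mul_le_mul_right _ (by omega)
  have h₂ : (Nat.clog 2 N : ℝ) ≤ Nat.clog 2 (n ^ 5) := by
    exact_mod_cast Nat.clog_mono_right 2 (h.trans h₁)
  have h₃ := clog_two_le (N := n ^ 5)
  rw [Nat.cast_pow, Real.log_pow] at h₃
  push_cast at h₃
  linarith

lemma wordLength_le (hn : 2 ≤ n) (hk : 0 < k) (hkn : k ≤ n) :
    (wordLength n k : ℝ) ≤ 12 * Real.log n := by
  unfold wordLength
  rw [Nat.cast_max, Nat.cast_max]
  refine max_le ?_ (max_le (clog_two_le_of_le hn ?_) (clog_two_le_of_le hn (by omega)))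
  · push_cast; linarith [half_lt_log hn]
  · have := length_forest_le hk hkn
    omega

lemma leafCount_le (hk : 0 < k) (hkn : k ≤ n) : leafCount n k ≤ 4 * k :=
  (Nat.le_mul_of_pos_left _ (treeCount_pos hk hkn)).trans (treeCount_mul_leafCount_le hk hkn)

lemma depth_le (hn : 2 ≤ n) (hk : 0 < k) (hkn : k ≤ n) :
    (depth n k : ℝ) ≤ 12 * Real.log n := by
  have h₁ : depth n k ≤ Nat.clog 2 (leafCount n k) :=
    Nat.clog_anti_left (by omega) (two_le_arity hk hkn)
  have h₂ := leafCount_le hk hkn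
  exact (Nat.cast_le.2 h₁).trans (clog_two_le_of_le hn (by omega))

lemma depth_eq_zero (hn : 0 < n) (h : k ^ 2 ≤ n) : depth n k = 0 := by
  have h₁ : leafCount n k * n < k ^ 2 + n := ceilDiv_mul_lt (k ^ 2) hn
  refine Nat.clog_of_right_le_one ?_ _
  by_contra h₂
  have : 2 * n ≤ leafCount n k * n := Nat.mul_le_mul_right _ (by omega)
  omega

/-- This is where the choice of the arity pays off: it exceeds ⌈n/k⌉, the number of indices per
leaf, and the two factors cancel. -/
lemma sum_maxAssigned_le (hk : 0 < k) (hkn : k ≤ n) :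
    ∑ i ∈ Finset.range (depth n k), maxAssigned n k (i + 2) ≤ 3 * leafCount n k + n ⌈/⌉ k := by
  have h := arity_mul_sum_maxAssigned_le hk hkn
  refine Nat.le_of_mul_le_mul_left (h.trans ?_) arity_pos
  have : n ⌈/⌉ k ≤ arity n k := Nat.le_succ _
  nlinarith [Nat.mul_le_mul_left (3 * leafCount n k) this]

variable {γ : ℝ}

lemma gamma_pos (hb : b < k) (hγ : γ = 1 - (b : ℝ) / k) : 0 < γ := by
  have hk : (0 : ℝ) < k := by exact_mod_cast (Nat.zero_le b).trans_lt hb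
  have : (b : ℝ) / k < 1 := by rw [div_lt_one hk]; exact_mod_cast hb
  linarith

lemma gamma_le_one (hγ : γ = 1 - (b : ℝ) / k) : γ ≤ 1 := by
  have : (0 : ℝ) ≤ (b : ℝ) / k := by positivity
  linarith

lemma le_committeeSize (hγ : γ = 1 - (b : ℝ) / k) :
    9 * Real.logb 2 n / γ ≤ committeeSize n k b := by
  rw [hγ]; exact Nat.le_ceil _

lemma committeeSize_le (hn : 2 ≤ n) (hb : b < k) (hγ : γ = 1 - (b : ℝ) / k) :
    (committeeSize n k b : ℝ) ≤ 20 * (Real.log n / γ) := by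
  have h₀ := gamma_pos hb hγ
  have h₁ := gamma_le_one hγ
  have h₂ := one_le_logb hn
  have h₃ : (committeeSize n k b : ℝ) < 9 * Real.logb 2 n / γ + 1 := by
    rw [hγ] at h₀ ⊢
    exact Nat.ceil_lt_add_one (by positivity)
  have h₄ : 1 ≤ Real.logb 2 n / γ := by rw [le_div_iff₀ h₀]; linarith
  have h₅ : Real.logb 2 n / γ ≤ 2 * Real.log n / γ :=
    div_le_div_of_nonneg_right (logb_le_two_mul_log hn) h₀.le
  have h₆ : 9 * Real.logb 2 n / γ = 9 * (Real.logb 2 n / γ) := by ring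
  have h₇ : 2 * Real.log n / γ = 2 * (Real.log n / γ) := by ring
  linarith

lemma committeeSize_pos (hn : 2 ≤ n) (hb : b < k) : 0 < committeeSize n k b := by
  have h₀ := gamma_pos hb rfl
  have h₁ := le_committeeSize (n := n) (k := k) (b := b) rfl
  have h₂ := one_le_logb hn
  have : (0 : ℝ) < committeeSize n k b := lt_of_lt_of_le (by positivity) h₁
  exact_mod_cast this

/-- With high probability all committees have honest members and no machine is overloaded. -/
theorem coinMeasure_bad_le (hn : 2 ≤ n) (hkn : k ≤ n) (hb : b < k) {B : Finset (Fin k)}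
    (hB : B.card ≤ b) :
    coinMeasure {ω | ¬ ((∀ v ∈ forest n k, ∃ h ∈ committee n k b ω v, h ∉ B) ∧
      load n (committee n k b ω) ≤ 49 * committeeSize n k b)} ≤ ENNReal.ofReal (13 / n) := by
  have hk : 0 < k := (Nat.zero_le b).trans_lt hb
  have hs := committeeSize_pos hn hb
  obtain ⟨γ, hγ⟩ : ∃ γ, γ = 1 - (b : ℝ) / k := ⟨_, rfl⟩
  have hγ₀ := gamma_pos hb hγ
  have hγ₁ := gamma_le_one hγ
  have hL := log_le_logb hn
  have hl := half_lt_log hn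
  have hn₀ : (0 : ℝ) < n := by positivity
  set s := committeeSize n k b with hsdef
  have hsL : 9 * Real.logb 2 n / γ ≤ s := le_committeeSize hγ
  have hsL' : 9 * Real.logb 2 n ≤ γ * s := by rwa [div_le_iff₀' hγ₀] at hsL
  have hexp : Real.exp (-(2 * Real.log n)) = 1 / (n : ℝ) ^ 2 := by
    rw [Real.exp_neg, mul_comm, Real.exp_mul, Real.exp_log hn₀, one_div]
    norm_num
  -- From γs ≥ 9 log₂ n follows γs/2 ≥ 2 log n, and 1 - x ≤ exp(-x). The same bound serves for
  -- 2^(-s), since 1/2 ≤ 1 - γ/2.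
  have hp₁ : (1 - γ / 2) ^ s ≤ 1 / (n : ℝ) ^ 2 := by
    calc (1 - γ / 2) ^ s ≤ Real.exp (-(γ / 2)) ^ s := by
          refine pow_le_pow_left₀ (by linarith) ?_ _
          linarith [Real.add_one_le_exp (-(γ / 2))]
      _ = Real.exp (-(γ * s / 2)) := by rw [← Real.exp_nat_mul]; congr 1; ring
      _ ≤ Real.exp (-(2 * Real.log n)) := Real.exp_le_exp.2 (by linarith)
      _ = _ := hexp
  have hp₂ : (1 / 2 : ℝ) ^ s ≤ 1 / (n : ℝ) ^ 2 := by
    calc (1 / 2 : ℝ) ^ s ≤ (1 - γ / 2) ^ s := pow_le_pow_left₀ (by norm_num) (by linarith) _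
      _ ≤ _ := hp₁
  have hsub : {ω | ¬ ((∀ v ∈ forest n k, ∃ h ∈ committee n k b ω v, h ∉ B) ∧
      load n (committee n k b ω) ≤ 49 * s)} ⊆
      (⋃ v ∈ (forest n k).toFinset, {ω | committee n k b ω v ⊆ B}) ∪
        ⋃ M ∈ (Finset.univ : Finset (Fin k)),
          {ω | 49 * s ≤ (memberships n (committee n k b ω) M).length} := by
    intro ω hω
    by_contra hnot
    simp only [Set.mem_union, Set.mem_iUnion, not_or, not_exists, List.mem_toFinset,
      Set.mem_ofPred_eq, Finset.subset_iff, not_forall] at hnot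
    refine hω ⟨fun v hv => ?_, Finset.sup_le fun M _ => ?_⟩
    · obtain ⟨h, h₁, h₂⟩ := hnot.1 v hv
      exact ⟨h, h₁, h₂⟩
    · exact (not_le.1 (hnot.2 M (Finset.mem_univ M))).le
  refine (MeasureTheory.measure_mono hsub).trans ((MeasureTheory.measure_union_le _ _).trans ?_)
  have h₁ : coinMeasure (⋃ v ∈ (forest n k).toFinset, {ω | committee n k b ω v ⊆ B}) ≤
      ENNReal.ofReal (12 / n) := by
    refine (MeasureTheory.measure_biUnion_finset_le _ _).trans ((Finset.sum_le_sum fun v hv =>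
      coinMeasure_committee_subset_le hs hk hb.le hB (List.mem_toFinset.1 hv)).trans ?_)
    rw [Finset.sum_const, nsmul_eq_mul, ← ENNReal.ofReal_natCast,
      ← ENNReal.ofReal_mul (by positivity), ← hγ]
    refine ENNReal.ofReal_le_ofReal ?_
    have hc : ((forest n k).toFinset.card : ℝ) ≤ 12 * n := by
      have := (List.toFinset_card_le (forest n k)).trans (length_forest_le hk hkn)
      exact_mod_cast this.trans (Nat.mul_le_mul_left _ hkn)
    calc _ ≤ 12 * (n : ℝ) * (1 / (n : ℝ) ^ 2) :=
          mul_le_mul hc hp₁ (pow_nonneg (by linarith) _) (by positivity)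
      _ = _ := by field_simp
  have h₂ : coinMeasure (⋃ M ∈ (Finset.univ : Finset (Fin k)),
      {ω | 49 * s ≤ (memberships n (committee n k b ω) M).length}) ≤ ENNReal.ofReal (1 / n) := by
    refine (MeasureTheory.measure_biUnion_finset_le _ _).trans ((Finset.sum_le_sum fun M _ =>
      coinMeasure_memberships_le hs hk hkn M).trans ?_)
    rw [Finset.sum_const, nsmul_eq_mul, ← ENNReal.ofReal_natCast,
      ← ENNReal.ofReal_mul (by positivity)]
    refine ENNReal.ofReal_le_ofReal ?_
    have hc : ((Finset.univ : Finset (Fin k)).card : ℝ) ≤ n := by simpa using hkn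
    calc _ ≤ (n : ℝ) * (1 / (n : ℝ) ^ 2) := mul_le_mul hc hp₂ (by positivity) (by positivity)
      _ = _ := by field_simp
  refine (add_le_add h₁ h₂).trans ?_
  rw [← ENNReal.ofReal_add (by positivity) (by positivity)]
  exact ENNReal.ofReal_le_ofReal (le_of_eq (by ring))

lemma ceilDiv_cast_le (hk : 0 < k) (hkn : k ≤ n) : ((n ⌈/⌉ k : ℕ) : ℝ) ≤ 2 * ((n : ℝ) / k) := by
  have h : ((n ⌈/⌉ k : ℕ) : ℝ) * k ≤ 2 * n := by
    exact_mod_cast (ceilDiv_mul_lt n hk).le.trans (by omega)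
  have hk' : (0 : ℝ) < k := by exact_mod_cast hk
  rw [← mul_div_assoc, le_div_iff₀ hk']
  exact h

lemma one_le_div (hk : 0 < k) (hkn : k ≤ n) : 1 ≤ (n : ℝ) / k := by
  rw [one_le_div₀ (by exact_mod_cast hk)]
  exact_mod_cast hkn

lemma sq_le_two_mul_cube {y : ℝ} (hy : 1 / 2 < y) : y ^ 2 ≤ 2 * y ^ 3 := by
  nlinarith [sq_nonneg y]

lemma le_two_mul_sq {y : ℝ} (hy : 1 / 2 < y) : y ≤ 2 * y ^ 2 := by
  nlinarith

/-- With y = log n / γ and r = n/k, the seed costs a multiple of y³, leaves and final resolution a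
multiple of ry, and the disputes of the convergecast a multiple of ry². Since r ≥ 1 and y > 1/2, all
are bounded by ry³. -/
lemma query_bound (hn : 2 ≤ n) (hkn : k ≤ n) (hb : b < k) (hγ : γ = 1 - (b : ℝ) / k) {ld : ℕ}
    (hld : ld ≤ 49 * committeeSize n k b) :
    ((seedLength n k b + (ld * (n ⌈/⌉ k) + committeeSize n k b * (ld * arity n k) +
      committeeSize n k b * treeCount n k) : ℕ) : ℝ) ≤
        1000000 * (n * Real.log n ^ 3 / (γ ^ 3 * k)) := by
  have hk : 0 < k := (Nat.zero_le b).trans_lt hb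
  have hγ₀ := gamma_pos hb hγ
  have hγ₁ := gamma_le_one hγ
  have hl := half_lt_log hn
  have hs := committeeSize_le hn hb hγ
  have hm := wordLength_le hn hk hkn
  have hw := ceilDiv_cast_le hk hkn
  have hr := one_le_div hk hkn
  have ht : (treeCount n k : ℝ) ≤ ((n ⌈/⌉ k : ℕ) : ℝ) := Nat.cast_le.2 (min_le_left _ _)
  have hld' : (ld : ℝ) ≤ 49 * committeeSize n k b := by exact_mod_cast hld
  have hy : Real.log n ≤ Real.log n / γ := by
    rw [le_div_iff₀ hγ₀]; nlinarith
  have hZ : n * Real.log n ^ 3 / (γ ^ 3 * k) = (n : ℝ) / k * (Real.log n / γ) ^ 3 := by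
    field_simp
  rw [hZ]
  unfold seedLength arity
  push_cast
  set s := (committeeSize n k b : ℝ)
  set w := ((n ⌈/⌉ k : ℕ) : ℝ)
  set l := Real.log n
  set y := l / γ
  set r := (n : ℝ) / k
  have hs₀ : 0 ≤ s := Nat.cast_nonneg _
  have hw₀ : 0 ≤ w := Nat.cast_nonneg _
  have hy₀ : 1 / 2 < y := by linarith
  have hld₁ : (ld : ℝ) ≤ 980 * y := by linarith
  have e₁ : s * s * wordLength n k ≤ 20 * y * (20 * y) * (12 * y) := by
    gcongr; linarith
  have e₂ : (ld : ℝ) * w ≤ 980 * y * (2 * r) := by gcongr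
  have e₃ : s * (ld * (w + 1)) ≤ 20 * y * (980 * y * (3 * r)) := by
    gcongr; linarith
  have e₄ : s * treeCount n k ≤ 20 * y * (2 * r) := by
    gcongr; linarith
  have hr₀ : 0 ≤ r := by linarith
  have p₃ : y ^ 3 ≤ r * y ^ 3 := le_mul_of_one_le_left (by positivity) hr
  have q₂ : r * y ^ 2 ≤ r * (2 * y ^ 3) :=
    mul_le_mul_of_nonneg_left (sq_le_two_mul_cube hy₀) hr₀
  have q₁ : r * y ≤ r * (2 * y ^ 2) := mul_le_mul_of_nonneg_left (le_two_mul_sq hy₀) hr₀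
  have hpos : 0 ≤ r * y ^ 3 := by positivity
  calc _ ≤ 20 * y * (20 * y) * (12 * y) + (980 * y * (2 * r) + 20 * y * (980 * y * (3 * r)) +
        20 * y * (2 * r)) := by linarith
    _ = 4800 * y ^ 3 + 2000 * (r * y) + 58800 * (r * y ^ 2) := by ring
    _ ≤ _ := by linarith

/-- The convergecast contributes σ² · depth · n. The resolution asks at most 1 + σ · clog n times,
each time exchanging messages between all machines and the root committees; there treeCount · k ≤
2n. -/
lemma message_bound (hn : 2 ≤ n) (hkn : k ≤ n) (hb : b < k) (hγ : γ = 1 - (b : ℝ) / k) :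
    ((committeeSize n k b ^ 2 * (depth n k * n) + (1 + committeeSize n k b * Nat.clog 2 n) *
      (2 * (k * (committeeSize n k b * treeCount n k))) : ℕ) : ℝ) ≤
        1000000 * (n * Real.log n ^ 3 / γ ^ 2) := by
  have hk : 0 < k := (Nat.zero_le b).trans_lt hb
  have hγ₀ := gamma_pos hb hγ
  have hl := half_lt_log hn
  have hs := committeeSize_le hn hb hγ
  have hd := depth_le hn hk hkn
  have hc := clog_two_le_log hn
  have ht : (treeCount n k : ℝ) * k ≤ 2 * n := by exact_mod_cast treeCount_mul_le hk hkn
  have hsc : (1 : ℝ) ≤ committeeSize n k b * Nat.clog 2 n := by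
    have := Nat.mul_pos (committeeSize_pos hn hb) (Nat.clog_pos (b := 2) (by omega) hn)
    exact_mod_cast this
  have hZ : n * Real.log n ^ 3 / γ ^ 2 = n * ((Real.log n / γ) ^ 2 * Real.log n) := by
    field_simp
  rw [hZ]
  push_cast
  set s := (committeeSize n k b : ℝ)
  set c := (Nat.clog 2 n : ℝ)
  set l := Real.log n
  have hs₀ : 0 ≤ s := Nat.cast_nonneg _
  have hy₀ : 0 < l / γ := by positivity
  set y := l / γ
  have hc₀ : 0 ≤ c := Nat.cast_nonneg _
  have e₁ : s ^ 2 * (depth n k * n) ≤ (20 * y) ^ 2 * (12 * l * n) := by gcongr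
  have e₂ : (1 + s * c) * (2 * (k * (s * treeCount n k))) ≤
      (2 * (20 * y * (4 * l))) * (2 * (20 * y * (2 * n))) := by
    have h₁ : 1 + s * c ≤ 2 * (20 * y * (4 * l)) := by
      have : s * c ≤ 20 * y * (4 * l) := by gcongr
      linarith
    have h₂ : k * (s * treeCount n k) ≤ 20 * y * (2 * n) := by
      calc (k : ℝ) * (s * treeCount n k) = s * (treeCount n k * k) := by ring
        _ ≤ _ := by gcongr
    gcongr
  have hpos : 0 ≤ n * (y ^ 2 * l) := by positivity
  calc _ ≤ (20 * y) ^ 2 * (12 * l * n) + (2 * (20 * y * (4 * l))) * (2 * (20 * y * (2 * n))) :=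
        add_le_add e₁ e₂
    _ = 17600 * (n * (y ^ 2 * l)) := by ring
    _ ≤ _ := by linarith

lemma ceilDiv_le_succ (a : ℕ) {c : ℕ} (hc : 0 < c) : a ⌈/⌉ c ≤ a + 1 := by
  rw [Nat.ceilDiv_eq_add_pred_div]
  refine Nat.div_le_of_le_mul ?_
  have : a ≤ c * a := Nat.le_mul_of_pos_left a hc
  rw [mul_add, mul_one]
  omega

/-- The leading terms are the seed, σ² words read `n` bits per round (bounded without using this
factor `n`), and σ · clog n search steps of two times the load. -/
lemma rounds_estimate {s c l y m ld : ℝ} (hl : 1 / 2 < l) (hy : 1 / 2 < y) (hs₀ : 0 ≤ s)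
    (hs : s ≤ 20 * y) (hm₀ : 0 ≤ m) (hm : m ≤ 12 * l) (hc₀ : 0 ≤ c) (hc : c ≤ 4 * l)
    (hld₀ : 0 ≤ ld) (hld : ld ≤ 49 * s) :
    s * s * m + 2 + (ld + ld + s * (c * (ld + ld) + 1)) ≤ 330000 * (y ^ 2 * l) := by
  have hld₁ : ld + ld ≤ 98 * (20 * y) := by linarith
  have e₁ : s * s * m ≤ 20 * y * (20 * y) * (12 * l) := by gcongr
  have e₂ : s * (c * (ld + ld) + 1) ≤ 20 * y * (4 * l * (98 * (20 * y)) + 1) := by gcongr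
  have p : y ≤ 4 * (y ^ 2 * l) := by
    have := mul_le_mul_of_nonneg_left hl.le (sq_nonneg y)
    linarith only [this, le_two_mul_sq hy]
  calc _ ≤ 20 * y * (20 * y) * (12 * l) + 2 + (98 * (20 * y) +
        20 * y * (4 * l * (98 * (20 * y)) + 1)) := by linarith only [e₁, e₂, hld₁]
    _ = 161600 * (y ^ 2 * l) + 1980 * y + 2 := by ring
    _ ≤ _ := by linarith only [p, hy]

/-- The time spent outside the convergecast. -/
lemma time_bound_aux {F : Node → Finset (Fin k)} (hn : 2 ≤ n) (hkn : k ≤ n) (hb : b < k)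
    (hγ : γ = 1 - (b : ℝ) / k) (hld : load n F ≤ 49 * committeeSize n k b) :
    ((seedLength n k b ⌈/⌉ n : ℕ) : ℝ) + 1 + resolveRounds n F (committeeSize n k b) ≤
      330000 * ((Real.log n / γ) ^ 2 * Real.log n) := by
  have hk : 0 < k := (Nat.zero_le b).trans_lt hb
  have hγ₀ := gamma_pos hb hγ
  have hl := half_lt_log hn
  have hy : 1 / 2 < Real.log n / γ := by
    rw [lt_div_iff₀ hγ₀]
    linarith [gamma_le_one hγ]
  have hseed : ((seedLength n k b ⌈/⌉ n : ℕ) : ℝ) ≤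
      committeeSize n k b * committeeSize n k b * wordLength n k + 1 := by
    exact_mod_cast ceilDiv_le_succ (seedLength n k b) (show 0 < n by omega)
  have h := rounds_estimate hl hy (Nat.cast_nonneg _) (committeeSize_le hn hb hγ)
    (Nat.cast_nonneg _) (wordLength_le hn hk hkn) (Nat.cast_nonneg _) (clog_two_le_log hn)
    (Nat.cast_nonneg (load n F)) (by exact_mod_cast hld)
  unfold resolveRounds
  push_cast
  linarith only [h, hseed]

lemma time_bound_small {F : Node → Finset (Fin k)} (hn : 2 ≤ n) (hkn : k ≤ n) (hb : b < k)
    (hγ : γ = 1 - (b : ℝ) / k) (hld : load n F ≤ 49 * committeeSize n k b) (h : k ^ 2 ≤ n) :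
    ((seedLength n k b ⌈/⌉ n + (convergecastRounds n F +
      resolveRounds n F (committeeSize n k b)) : ℕ) : ℝ) ≤
        1000000 * (Real.log n ^ 4 / γ ^ 3) := by
  have hγ₀ := gamma_pos hb hγ
  have hγ₁ := gamma_le_one hγ
  have hl := half_lt_log hn
  have h₁ := time_bound_aux hn hkn hb hγ hld
  -- For k² ≤ n every tree is a single leaf, and only the round of queries remains.
  have h₂ : convergecastRounds n F = 1 := by
    rw [convergecastRounds, depth_eq_zero (by omega) h]; simp
  rw [h₂]
  push_cast
  have hZ : Real.log n ^ 4 / γ ^ 3 = (Real.log n / γ) ^ 2 * Real.log n * (Real.log n / γ) := by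
    field_simp
  have hy : 1 / 2 < Real.log n / γ := by
    rw [lt_div_iff₀ hγ₀]; nlinarith
  rw [hZ]
  have hpos : 0 < (Real.log n / γ) ^ 2 * Real.log n := by positivity
  nlinarith

lemma time_bound_large {F : Node → Finset (Fin k)} (hn : 2 ≤ n) (hkn : k ≤ n) (hb : b < k)
    (hγ : γ = 1 - (b : ℝ) / k) (hld : load n F ≤ 49 * committeeSize n k b) (h : n < k ^ 2) :
    ((seedLength n k b ⌈/⌉ n + (convergecastRounds n F +
      resolveRounds n F (committeeSize n k b)) : ℕ) : ℝ) ≤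
        1000000 * (((n : ℝ) / k + (k : ℝ) ^ 2 / n + Real.log n ^ 2 / γ) *
          (Real.log n ^ 2 / γ ^ 2)) := by
  have hk : 0 < k := (Nat.zero_le b).trans_lt hb
  have hγ₀ := gamma_pos hb hγ
  have hγ₁ := gamma_le_one hγ
  have hl := half_lt_log hn
  have h₁ := time_bound_aux hn hkn hb hγ hld
  have hs := committeeSize_le hn hb hγ
  have hs₁ : (1 : ℝ) ≤ committeeSize n k b := by exact_mod_cast committeeSize_pos hn hb
  have hld' : (load n F : ℝ) ≤ 49 * committeeSize n k b := by exact_mod_cast hld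
  have hn₀ : (0 : ℝ) < n := by positivity
  have hw := ceilDiv_cast_le hk hkn
  have hlc : (leafCount n k : ℝ) ≤ 2 * ((k : ℝ) ^ 2 / n) := by
    have h₂ : leafCount n k * n < k ^ 2 + n := ceilDiv_mul_lt (k ^ 2) (by omega)
    have h₃ : (leafCount n k : ℝ) * n ≤ 2 * k ^ 2 := by
      exact_mod_cast h₂.le.trans (by omega)
    rw [← mul_div_assoc, le_div_iff₀ hn₀]
    exact h₃
  have hsum : (∑ i ∈ Finset.range (depth n k), maxAssigned n k (i + 2) : ℕ) ≤
      6 * ((n : ℝ) / k + (k : ℝ) ^ 2 / n) := by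
    have h₂ : ((∑ i ∈ Finset.range (depth n k), maxAssigned n k (i + 2) : ℕ) : ℝ) ≤
      3 * leafCount n k + (n ⌈/⌉ k : ℕ) := by exact_mod_cast sum_maxAssigned_le hk hkn
    have : 0 ≤ (n : ℝ) / k := by positivity
    linarith
  have hcc : convergecastRounds n F =
      1 + (∑ i ∈ Finset.range (depth n k), maxAssigned n k (i + 2)) * (load n F + 1) := by
    rw [convergecastRounds, Finset.sum_mul]
    simp only [mul_add, mul_one]
  have hZ : ((n : ℝ) / k + (k : ℝ) ^ 2 / n + Real.log n ^ 2 / γ) * (Real.log n ^ 2 / γ ^ 2) =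
      ((n : ℝ) / k + (k : ℝ) ^ 2 / n) * (Real.log n / γ) ^ 2 +
        (Real.log n / γ) ^ 2 * Real.log n * (Real.log n / γ) := by
    field_simp
  rw [hcc, hZ, Nat.cast_add, Nat.cast_add, Nat.cast_add, Nat.cast_mul, Nat.cast_add, Nat.cast_one]
  set A := (n : ℝ) / k + (k : ℝ) ^ 2 / n
  have hA : 0 ≤ A := by positivity
  have hy : 1 / 2 < Real.log n / γ := by
    rw [lt_div_iff₀ hγ₀]; nlinarith
  set y := Real.log n / γ
  -- Here load + 1 ≤ 50σ ≤ 1000y ≤ 2000y², by y > 1/2.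
  have e : ((∑ i ∈ Finset.range (depth n k), maxAssigned n k (i + 2) : ℕ) : ℝ) *
      ((load n F : ℝ) + 1) ≤ 6 * A * (2000 * y ^ 2) := by
    refine mul_le_mul hsum ?_ (by positivity) (by positivity)
    nlinarith
  have hpos : 0 < y ^ 2 * Real.log n := by positivity
  have hAy : 0 ≤ A * y ^ 2 := by positivity
  nlinarith

lemma logb_card_msg_le (hn : 2 ≤ n) :
    Real.logb 2 (Fintype.card (Msg n)) ≤ 1000000 * Real.log n := by
  have h₁ : Fintype.card (Msg n) ≤ n ^ 4 := by
    have h : Fintype.card (Msg n) = 2 + (n + 1) * (n + 1) := by simp [Msg]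
    rw [h]
    have h₂ : 2 ^ 2 ≤ n ^ 2 := Nat.pow_le_pow_left hn 2
    calc 2 + (n + 1) * (n + 1) ≤ 4 * n ^ 2 := by nlinarith
      _ ≤ n ^ 2 * n ^ 2 := Nat.mul_le_mul_right _ h₂
      _ = n ^ 4 := by ring
  have h₂ : Real.logb 2 (Fintype.card (Msg n)) ≤ Real.logb 2 ((n : ℝ) ^ 4) :=
    Real.logb_le_logb_of_le (by norm_num) (by exact_mod_cast Fintype.card_pos)
      (by exact_mod_cast h₁)
  rw [Real.logb_pow] at h₂
  have h₃ := logb_le_two_mul_log hn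
  have h₄ := half_lt_log hn
  push_cast at h₂
  linarith

end Estimates

end CCA

/-! ### The main theorem -/

theorem mainTheorem5 :
    ∃ C : ℝ, 0 < C ∧ ∀ (n k b : ℕ) (γ : ℝ), 2 ≤ n → k ≤ n → b < k → γ = 1 - (b : ℝ) / k →
      Real.logb 2 (Fintype.card (CCA.Msg n)) ≤ C * Real.log n ∧
      ∀ (x : Fin n → Bool) (B : Finset (Fin k)), B.card ≤ b →
        ∀ adv : (ℕ → Bool) → ℕ → Fin k → Fin k → Option (CCA.Msg n),
          CCA.coinMeasure {ω | ¬ ∃ T : ℕ,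
              (CCA.convergeParityRun n k b x B adv ω).HonestOutput T (CCA.parity x) ∧
              (∀ t, ∀ i ∉ B, (CCA.convergeParityRun n k b x B adv ω).queriesInRound t i ≤ n) ∧
              (∀ i ∉ B, ((CCA.convergeParityRun n k b x B adv ω).queryCount T i : ℝ) ≤
                C * (n * Real.log n ^ 3 / (γ ^ 3 * k))) ∧
              ((CCA.convergeParityRun n k b x B adv ω).messageCount T : ℝ) ≤
                C * (n * Real.log n ^ 3 / γ ^ 2) ∧
              (k ^ 2 ≤ n → (T : ℝ) ≤ C * (Real.log n ^ 4 / γ ^ 3)) ∧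
              (n < k ^ 2 → (T : ℝ) ≤
                C * (((n : ℝ) / k + (k : ℝ) ^ 2 / n + Real.log n ^ 2 / γ) *
                  (Real.log n ^ 2 / γ ^ 2)))} ≤ ENNReal.ofReal (C / n) := by
  refine ⟨1000000, by norm_num, fun n k b γ hn hkn hb hγ =>
    ⟨CCA.logb_card_msg_le hn, fun x B hB adv => ?_⟩⟩
  have hk : 0 < k := (Nat.zero_le b).trans_lt hb
  -- The adversary is an arbitrary function of the coins, so the failure event need not be
  -- measurable; monotonicity of the measure holds regardless.
  refine (MeasureTheory.measure_mono fun ω hω => ?_).trans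
    ((CCA.coinMeasure_bad_le hn hkn hb hB).trans (ENNReal.ofReal_le_ofReal ?_))
  · rintro ⟨hhonest, hload⟩
    obtain ⟨T, hT, h₁, h₂, h₃, h₄⟩ :=
      CCA.convergeParityRun_of_honest hk hkn x B adv ω hhonest
    refine hω ⟨T, h₁, fun t i _ => h₂ t i, fun i _ => ?_, ?_, fun h => ?_, fun h => ?_⟩
    · exact (Nat.cast_le.2 (h₃ i)).trans (CCA.query_bound hn hkn hb hγ hload)
    · exact (Nat.cast_le.2 h₄).trans (CCA.message_bound hn hkn hb hγ)
    · rw [hT]; exact CCA.time_bound_small hn hkn hb hγ hload h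
    · rw [hT]; exact CCA.time_bound_large hn hkn hb hγ hload h
  · gcongr
    norm_num
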